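/- Let $\Gamma\subset\mathbb{R}^2$ be the unit circle, parametrised by $\gamma(t)=(\cos t,\sin t)$, $t\in[0,2\pi)$, so that $L^2(\Gamma)\cong L^2(0,2\pi)$, with outward unit normal $\nu(y)=y$. For integers $n\ge 0$ let $J_n$, $Y_n$ be the Bessel functions of the first and second kind and $H^{(1)}_n=J_n+\mathrm{i}Y_n$. For $k>0$ let $\Phi_k(x,y)=\frac{\mathrm{i}}{4}H^{(1)}_0(k|x-y|)$ and $$A_k=\tfrac12 I+D_k-\mathrm{i}kS_k,\qquad S_k\phi(x)=\int_\Gamma\Phi_k(x,y)\phi(y)\,ds(y),\qquad D_k\phi(x)=\int_\Gamma\frac{\partial\Phi_k(x,y)}{\partial\nu(y)}\phi(y)\,ds(y)$$ on $L^2(\Gamma)$. For $m\in\mathbb{Z}$ and $k>0$ put $$\lambda_m(k)=\pi k\,H^{(1)}_{|m|}(k)\big(\mathrm{i}J'_{|m|}(k)+J_{|m|}(k)\big).$$ (i) For every $k>0$ the eigenvalues of $2A_k$ on $L^2(\Gamma)$ are exactly the numbers $\lambda_m(k)$, $m\in\mathbb{Z}$, and $2A_k\,\mathrm{e}^{\mathrm{i}mt}=\lambda_m(k)\,\mathrm{e}^{\mathrm{i}mt}$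 for every $m\in\mathbb{Z}$. (ii) For every $\delta>0$ there exists $C>0$ such that, for all $m\in\mathbb{Z}$ and all $k>0$ with $0<k/m<1-\delta$, $$|\lambda_m(k)-1|\le C\,\frac{k}{m}.$$ -/

import Mathlib

open MeasureTheory

noncomputable section

/-- The Bessel function of the first kind `J_n(x)`, of integer order `n ≥ 0`:
`J_n(x) = ∑_j (-1)^j / (j! (n+j)!) (x/2)^(2j+n)`. -/
def besselJ (n : ℕ) (x : ℝ) : ℝ :=
  ∑' j : ℕ, (-1) ^ j / ((j.factorial : ℝ) * ((n + j).factorial : ℝ)) * (x / 2) ^ (2 * j + n)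

/-- The digamma function at positive integers: `ψ(j+1) = 1 + 1/2 + ⋯ + 1/j - γ`. -/
def digammaSucc (j : ℕ) : ℝ := (harmonic j : ℝ) - Real.eulerMascheroniConstant

/-- The Bessel function of the second kind `Y_n(x)`, of integer order `n ≥ 0`, for `x > 0`:
`Y_n(x) = -(1/π) ∑_{j<n} (n-j-1)!/j! (x/2)^(2j-n) + (2/π) log(x/2) J_n(x)
  - (1/π) ∑_j (ψ(j+1) + ψ(n+j+1)) (-1)^j / (j! (n+j)!) (x/2)^(2j+n)`.
In the finite sum `j < n`, so that the truncated difference `n - j - 1` is the true one. -/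
def besselY (n : ℕ) (x : ℝ) : ℝ :=
  -(1 / Real.pi) * ∑ j ∈ Finset.range n,
      ((n - j - 1).factorial : ℝ) / (j.factorial : ℝ) * (x / 2) ^ (2 * (j : ℤ) - (n : ℤ))
    + 2 / Real.pi * Real.log (x / 2) * besselJ n x
    - 1 / Real.pi * ∑' j : ℕ, (digammaSucc j + digammaSucc (n + j)) *
        ((-1) ^ j / ((j.factorial : ℝ) * ((n + j).factorial : ℝ)) * (x / 2) ^ (2 * j + n))

/-- The Hankel function of the first kind `H_n^{(1)}(x) = J_n(x) + i Y_n(x)`, for `x > 0`. -/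
def hankelH1 (n : ℕ) (x : ℝ) : ℂ := (besselJ n x : ℂ) + Complex.I * (besselY n x : ℂ)

/-- `λ_m(k) = π k H^{(1)}_{|m|}(k) (i J'_{|m|}(k) + J_{|m|}(k))`. -/
def circleLambda (m : ℤ) (k : ℝ) : ℂ :=
  (Real.pi : ℂ) * (k : ℂ) * hankelH1 m.natAbs k *
    (Complex.I * ((deriv (besselJ m.natAbs) k : ℝ) : ℂ) + ((besselJ m.natAbs k : ℝ) : ℂ))

/-- The parametrisation `γ(t) = (cos t, sin t)` of the unit circle `Γ`. It has unit speed, so that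
`∫_Γ f ds = ∫_0^{2π} f(γ(t)) dt`. -/
def circleParam (t : ℝ) : EuclideanSpace ℝ (Fin 2) := !₂[Real.cos t, Real.sin t]

/-- The fundamental solution `Φ_k(x,y) = (i/4) H_0^{(1)}(k|x-y|)` of the Helmholtz equation in the
plane. -/
def helmholtzPhi (k : ℝ) (x y : EuclideanSpace ℝ (Fin 2)) : ℂ :=
  Complex.I / 4 * hankelH1 0 (k * ‖x - y‖)

/-- The normal derivative `∂Φ_k(x,y)/∂ν(y)` at a point `y` of the unit circle, where the unit
normal pointing out of the disc is `ν(y) = y`. -/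
def helmholtzPhiNormal (k : ℝ) (x y : EuclideanSpace ℝ (Fin 2)) : ℂ :=
  lineDeriv ℝ (fun y' => helmholtzPhi k x y') y y

/-- The single-layer operator `S_k` on the unit circle. Functions on `Γ` are written as functions
of the parameter `t`; the value at `γ(t)` is given. -/
def singleLayer (k : ℝ) (v : ℝ → ℂ) (t : ℝ) : ℂ :=
  ∫ s in (0 : ℝ)..(2 * Real.pi), helmholtzPhi k (circleParam t) (circleParam s) * v s

/-- The double-layer operator `D_k` on the unit circle. -/
def doubleLayer (k : ℝ) (v : ℝ → ℂ) (t : ℝ) : ℂ :=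
  ∫ s in (0 : ℝ)..(2 * Real.pi), helmholtzPhiNormal k (circleParam t) (circleParam s) * v s

/-- The combined operator `A_k = (1/2) I + D_k - i k S_k` on the unit circle. -/
def combinedLayer (k : ℝ) (v : ℝ → ℂ) (t : ℝ) : ℂ :=
  1 / 2 * v t + doubleLayer k v t - Complex.I * (k : ℂ) * singleLayer k v t

/-- Arc-length measure on the unit circle, in the parameter `t`; `L²(Γ)` is `L²(0,2π)`. -/
def arcMeasure : Measure ℝ := volume.restrict (Set.Ioc 0 (2 * Real.pi))

/-- `μ` is an eigenvalue of `2 A_k` on `L²(Γ)`: there is a nonzero `v ∈ L²(Γ)` such that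
`2 A_k v = μ v` as elements of `L²(Γ)`. -/
def IsEigenvalueTwoA (k : ℝ) (μ : ℂ) : Prop :=
  ∃ v : ℝ → ℂ, MemLp v 2 arcMeasure ∧ ¬ (v =ᵐ[arcMeasure] fun _ => 0) ∧
    (fun t => 2 * combinedLayer k v t) =ᵐ[arcMeasure] fun t => μ * v t

end

open Filter Topology

/-! ### Entire series behind the Bessel functions -/

/-! On the circle the chord |γ(t) - γ(s)| equals 2|sin((t-s)/2)|, and moving γ(s) along its own
normal changes this length at a rate equal to half of it. Both layer operators are therefore
convolutions, with kernels proportional to H_0(ρ) and ρ H_0'(ρ) at ρ = 2k|sin((t-s)/2)|, and the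
exponentials diagonalise A_k. The eigenvalues follow once the Fourier coefficients of H_0(ρ) are
identified as J_n(k) H_n(k) (`sineAvg_hankelH1_eq`): applying k d/dk gives the coefficients of ρ
H_0'(ρ), and the Wronskian collapses the sum to λ_m (`circleLambda_eq`). There are no other
eigenvalues because pairing an eigenfunction with e^{imt} multiplies its coefficient by λ_m
(symmetric kernel and Fubini), and by Parseval some coefficient is nonzero.

The coefficient identity is proved by differential equations in k. The averages of orders zero and
one of H_0, together with the mean of ρ H_0', satisfy a linear third-order system, the one satisfied
by products of two Bessel solutions. The triple built from J_0 H_0 and J_1 H_1 solves the same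
system with the same leading behaviour at k = 0, and `eq_zero_of_product_system` gives uniqueness.
Recurrences obtained by integrating by parts in the angle reach the higher orders.

For the estimate put n = |m| and θ = x J_n'(x). Then λ_m - 1 is a combination of J_n², θ J_n, J_n
Y_n and θ Y_n. Monotone quantities coming from Bessel's equation give √(n² - x²) ≤ θ / J_n ≤ n on 0
< x ≤ n, hence geometric decay of J_n below the turning point x = n. The function Y_n is reached
through (Y_n / J_n)' = 2/(π x J_n²), compared with the derivative of multiples of J_n⁻²
(`exists_mul_bessel_le`, `exists_mul_bessel_add_le`). The values at the far end of the comparison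
interval grow at most linearly in n, by the uniform bound on the Fourier coefficients, and the
geometric decay absorbs them. -/

theorem summable_mul_pow_of_le_factorial {a : ℕ → ℝ} {C : ℝ}
    (ha : ∀ j, |a j| ≤ C / (j.factorial : ℝ)) (z : ℝ) : Summable fun j => a j * z ^ j := by
  refine Summable.of_norm_bounded ((Real.summable_pow_div_factorial |z|).mul_left C) fun j => ?_
  rw [norm_mul, norm_pow, Real.norm_eq_abs, Real.norm_eq_abs]
  calc |a j| * |z| ^ j ≤ C / (j.factorial : ℝ) * |z| ^ j := by gcongr; exact ha j
    _ = _ := by ring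

theorem hasDerivAt_tsum_mul_pow {a : ℕ → ℝ} {C : ℝ}
    (ha : ∀ j, |a j| ≤ C / (j.factorial : ℝ)) (z : ℝ) :
    HasDerivAt (fun z => ∑' j, a j * z ^ j) (∑' j : ℕ, ((j : ℝ) + 1) * a (j + 1) * z ^ j) z := by
  -- Any radius exceeding |z| serves: termwise differentiation needs an open ball containing z with
  -- a summable bound on it.
  set R : ℝ := |z| + 1
  have hR : 0 ≤ R := by positivity
  have hfac (n : ℕ) : ((n + 1 : ℕ) : ℝ) / ((n + 1).factorial : ℝ) = 1 / (n.factorial : ℝ) := by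
    rw [Nat.factorial_succ]; push_cast
    have : (n.factorial : ℝ) ≠ 0 := by positivity
    field_simp
  have hu : Summable fun n : ℕ => C / (n.factorial : ℝ) * (n * R ^ (n - 1)) := by
    rw [← summable_nat_add_iff 1]
    refine ((Real.summable_pow_div_factorial R).mul_left C).congr fun n => ?_
    simp only [Nat.add_sub_cancel]
    calc C * (R ^ n / (n.factorial : ℝ)) = C * (1 / (n.factorial : ℝ)) * R ^ n := by ring
      _ = _ := by rw [← hfac]; ring
  have hz : z ∈ Metric.ball (0 : ℝ) R := by simp [R]
  have hb : ∀ (n : ℕ), ∀ y ∈ Metric.ball (0 : ℝ) R,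
      ‖a n * (n * y ^ (n - 1))‖ ≤ C / (n.factorial : ℝ) * (n * R ^ (n - 1)) := by
    intro n y hy
    have hy' : |y| ≤ R := by simpa using (Metric.mem_ball.mp hy).le
    rw [norm_mul, norm_mul, norm_pow, Real.norm_eq_abs, Real.norm_eq_abs, Real.norm_eq_abs,
      Nat.abs_cast]
    gcongr
    · exact (abs_nonneg _).trans (ha n)
    · exact ha n
  have h := hasDerivAt_tsum_of_isPreconnected (g := fun n z => a n * z ^ n)
    (g' := fun n z => a n * (n * z ^ (n - 1))) hu Metric.isOpen_ball
    (convex_ball (0 : ℝ) R).isPreconnected (fun n y _ => (hasDerivAt_pow n y).const_mul (a n)) hb hz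
    (summable_mul_pow_of_le_factorial ha z) hz
  refine h.congr_deriv ?_
  rw [(Summable.of_norm_bounded hu fun n => hb n z hz).tsum_eq_zero_add]
  simp only [CharP.cast_eq_zero, zero_mul, mul_zero, zero_add, Nat.add_sub_cancel, Nat.cast_add,
    Nat.cast_one]
  exact tsum_congr fun j => by ring

noncomputable section

/-- The coefficient `(-1)^j / (j! (n+j)!)` of the Bessel series. -/
def besselJCoeff (n j : ℕ) : ℝ := (-1) ^ j / ((j.factorial : ℝ) * ((n + j).factorial : ℝ))

/-- The Bessel coefficient weighted by `h_j + h_{n+j}`, with `h` the harmonic numbers. -/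
def besselYCoeff (n j : ℕ) : ℝ := ((harmonic j : ℝ) + (harmonic (n + j) : ℝ)) * besselJCoeff n j

/-- The entire function `j_n` with `J_n(x) = (x/2)^n j_n((x/2)^2)`. -/
def entireJ (n : ℕ) (z : ℝ) : ℝ := ∑' j, besselJCoeff n j * z ^ j

/-- The entire function of the harmonic part of `Y_n`. -/
def entireY (n : ℕ) (z : ℝ) : ℝ := ∑' j, besselYCoeff n j * z ^ j

/-- The finite sum in the definition of `Y_n`. -/
def besselYPolar (n : ℕ) (x : ℝ) : ℝ :=
  ∑ j ∈ Finset.range n,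
    ((n - j - 1).factorial : ℝ) / (j.factorial : ℝ) * (x / 2) ^ (2 * (j : ℤ) - (n : ℤ))

end

theorem abs_besselJCoeff_le (n j : ℕ) : |besselJCoeff n j| ≤ 1 / (j.factorial : ℝ) := by
  rw [besselJCoeff, abs_div, abs_pow, abs_neg, abs_one, one_pow, abs_of_nonneg (by positivity)]
  have h1 : (1 : ℝ) ≤ ((n + j).factorial : ℝ) := by
    exact_mod_cast Nat.one_le_iff_ne_zero.mpr (Nat.factorial_ne_zero _)
  have h2 : (0 : ℝ) < (j.factorial : ℝ) := by positivity
  gcongr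
  nlinarith

theorem harmonic_nonneg (n : ℕ) : 0 ≤ (harmonic n : ℝ) := by
  have : (0 : ℚ) ≤ harmonic n := by
    rw [harmonic]; positivity
  exact_mod_cast this

theorem harmonic_succ_cast (n : ℕ) : (harmonic (n + 1) : ℝ) = harmonic n + 1 / ((n : ℝ) + 1) := by
  rw [harmonic_succ]; push_cast; ring

/-- A crude bound, but enough for the factor (n+j)! in the denominator to absorb the harmonic
weights of the Y series. -/
theorem harmonic_le_factorial (n : ℕ) : (harmonic n : ℝ) ≤ (n.factorial : ℝ) := by
  induction n with
  | zero => simp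
  | succ n ih =>
    have h0 : (1 : ℝ) ≤ (n.factorial : ℝ) := by
      exact_mod_cast Nat.one_le_iff_ne_zero.mpr (Nat.factorial_ne_zero _)
    have h1 : 1 / ((n : ℝ) + 1) ≤ 1 := by
      rw [div_le_one (by positivity)]; linarith [(Nat.cast_nonneg n : (0 : ℝ) ≤ n)]
    rw [harmonic_succ_cast, Nat.factorial_succ]
    rcases Nat.eq_zero_or_pos n with rfl | hn
    · simp
    · have h2 : (1 : ℝ) ≤ n := by exact_mod_cast hn
      push_cast
      nlinarith

theorem harmonic_mono {m n : ℕ} (h : m ≤ n) : (harmonic m : ℝ) ≤ harmonic n := by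
  have : Monotone fun n => (harmonic n : ℝ) := monotone_nat_of_le_succ fun n => by
    rw [harmonic_succ_cast]
    have : 0 ≤ 1 / ((n : ℝ) + 1) := by positivity
    linarith
  exact this h

theorem abs_besselYCoeff_le (n j : ℕ) : |besselYCoeff n j| ≤ 2 / (j.factorial : ℝ) := by
  have h0 := harmonic_nonneg j
  have h1 := harmonic_nonneg (n + j)
  have h2 := harmonic_le_factorial (n + j)
  have h3 := harmonic_mono (Nat.le_add_left j n)
  have hf : (0 : ℝ) < ((n + j).factorial : ℝ) := by positivity
  have hj : (0 : ℝ) < (j.factorial : ℝ) := by positivity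
  rw [besselYCoeff, besselJCoeff, abs_mul, abs_div, abs_pow, abs_neg, abs_one, one_pow,
    abs_of_nonneg (by positivity : 0 ≤ (j.factorial : ℝ) * ((n + j).factorial : ℝ)),
    abs_of_nonneg (by positivity), mul_one_div, div_le_div_iff₀ (by positivity) hj]
  nlinarith

theorem besselJCoeff_succ_mul (n j : ℕ) :
    ((j : ℝ) + 1) * besselJCoeff n (j + 1) = -besselJCoeff (n + 1) j := by
  rw [besselJCoeff, besselJCoeff, show n + (j + 1) = n + 1 + j by ring, Nat.factorial_succ, pow_succ]
  have : (j.factorial : ℝ) ≠ 0 := by positivity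
  have : ((n + 1 + j).factorial : ℝ) ≠ 0 := by positivity
  push_cast
  field_simp

theorem add_mul_besselJCoeff_succ (n j : ℕ) :
    ((j : ℝ) + (n + 1)) * besselJCoeff (n + 1) j = besselJCoeff n j := by
  rw [besselJCoeff, besselJCoeff, show n + 1 + j = (n + j) + 1 by ring, Nat.factorial_succ]
  have : (j.factorial : ℝ) ≠ 0 := by positivity
  have : ((n + j).factorial : ℝ) ≠ 0 := by positivity
  push_cast
  field_simp
  ring

theorem summable_entireJ (n : ℕ) (z : ℝ) : Summable fun j => besselJCoeff n j * z ^ j :=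
  summable_mul_pow_of_le_factorial (abs_besselJCoeff_le n) z

theorem summable_entireY (n : ℕ) (z : ℝ) : Summable fun j => besselYCoeff n j * z ^ j :=
  summable_mul_pow_of_le_factorial (abs_besselYCoeff_le n) z

theorem hasDerivAt_entireJ (n : ℕ) (z : ℝ) :
    HasDerivAt (entireJ n) (-entireJ (n + 1) z) z := by
  refine (hasDerivAt_tsum_mul_pow (abs_besselJCoeff_le n) z).congr_deriv ?_
  rw [entireJ, ← tsum_neg]
  exact tsum_congr fun j => by rw [besselJCoeff_succ_mul]; ring

theorem hasDerivAt_entireY (n : ℕ) (z : ℝ) :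
    HasDerivAt (entireY n) (∑' j : ℕ, ((j : ℝ) + 1) * besselYCoeff n (j + 1) * z ^ j) z :=
  hasDerivAt_tsum_mul_pow (abs_besselYCoeff_le n) z

/-- The Euler operator z d/dz multiplies the j-th coefficient by j. This turns coefficient
identities containing j + n + 1 into differential relations. -/
theorem mul_tsum_succ {a : ℕ → ℝ} {C : ℝ} (ha : ∀ j, |a j| ≤ C / (j.factorial : ℝ)) (z : ℝ) :
    Summable (fun j : ℕ => (j : ℝ) * a j * z ^ j) ∧
    z * (∑' j : ℕ, ((j : ℝ) + 1) * a (j + 1) * z ^ j) = ∑' j : ℕ, (j : ℝ) * a j * z ^ j := by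
  have hb : ∀ j : ℕ, |((j : ℝ) + 1) * a (j + 1)| ≤ C / (j.factorial : ℝ) := by
    intro j
    rw [abs_mul, abs_of_nonneg (by positivity : (0 : ℝ) ≤ (j : ℝ) + 1)]
    calc ((j : ℝ) + 1) * |a (j + 1)| ≤ ((j : ℝ) + 1) * (C / ((j + 1).factorial : ℝ)) := by
          gcongr; exact ha _
      _ = _ := by
        rw [Nat.factorial_succ]; push_cast
        have : (j.factorial : ℝ) ≠ 0 := by positivity
        field_simp
  have hs := (summable_mul_pow_of_le_factorial hb z).mul_left z
  have hs' : Summable (fun j : ℕ => (j : ℝ) * a j * z ^ j) := by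
    rw [← summable_nat_add_iff 1]
    refine hs.congr fun j => ?_
    push_cast; ring
  refine ⟨hs', ?_⟩
  rw [hs'.tsum_eq_zero_add, ← tsum_mul_left]
  simp only [CharP.cast_eq_zero, zero_mul, zero_add]
  refine tsum_congr fun j => ?_
  push_cast; ring

theorem mul_entireJ_add (n : ℕ) (z : ℝ) :
    entireJ n z = ((n : ℝ) + 1) * entireJ (n + 1) z - z * entireJ (n + 2) z := by
  obtain ⟨h1, h2⟩ := mul_tsum_succ (abs_besselJCoeff_le (n + 1)) z
  have h3 : ∑' j : ℕ, ((j : ℝ) + 1) * besselJCoeff (n + 1) (j + 1) * z ^ j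
      = -entireJ (n + 2) z := by
    rw [entireJ, ← tsum_neg]
    exact tsum_congr fun j => by rw [besselJCoeff_succ_mul]; ring
  rw [h3] at h2
  have h4 : z * entireJ (n + 2) z = -∑' j : ℕ, (j : ℝ) * besselJCoeff (n + 1) j * z ^ j := by
    linarith
  rw [h4, sub_neg_eq_add]
  simp only [entireJ]
  rw [← tsum_mul_left, ← ((summable_entireJ (n + 1) z).mul_left _).tsum_add h1]
  exact tsum_congr fun j => by rw [← add_mul_besselJCoeff_succ n j]; ring

/-- The extra `entireJ` term comes from the increment 1/(n+j+1) of the harmonic number; in Y it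
cancels against the derivative of the logarithm. Only z * d is recorded because the chain rule for z
= (x/2)² produces exactly this product. -/
theorem hasDerivAt_entireY_succ (n : ℕ) (z : ℝ) : ∃ d, HasDerivAt (entireY (n + 1)) d z ∧
    z * d = entireY n z + entireJ (n + 1) z - ((n : ℝ) + 1) * entireY (n + 1) z := by
  refine ⟨_, hasDerivAt_entireY (n + 1) z, ?_⟩
  obtain ⟨h1, h2⟩ := mul_tsum_succ (abs_besselYCoeff_le (n + 1)) z
  rw [h2, eq_sub_iff_add_eq]
  simp only [entireJ, entireY]
  rw [← tsum_mul_left, ← h1.tsum_add ((summable_entireY (n + 1) z).mul_left _),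
    ← (summable_entireY n z).tsum_add (summable_entireJ (n + 1) z)]
  refine tsum_congr fun j => ?_
  rw [besselYCoeff, besselYCoeff, ← add_mul_besselJCoeff_succ n j,
    show n + 1 + j = n + j + 1 by ring, harmonic_succ_cast]
  have : ((n : ℝ) + j + 1) ≠ 0 := by positivity
  push_cast
  field_simp
  ring

/-- Here the harmonic increment is 1/(j+1), and the shift of index loses the constant coefficient
1/n!. That loss is compensated by the boundary term in `hasDerivAt_besselYPolar`. -/
theorem hasDerivAt_entireY_pred (n : ℕ) (z : ℝ) : ∃ d, HasDerivAt (entireY n) d z ∧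
    z * d = entireJ n z - 1 / (n.factorial : ℝ) - z * entireY (n + 1) z := by
  refine ⟨_, hasDerivAt_entireY n z, ?_⟩
  have h0 : entireJ n z - 1 / (n.factorial : ℝ) = ∑' j : ℕ, besselJCoeff n (j + 1) * z ^ (j + 1) := by
    rw [entireJ, (summable_entireJ n z).tsum_eq_zero_add]
    simp [besselJCoeff]
  have hs := (summable_nat_add_iff 1).mpr (summable_entireJ n z)
  rw [h0, entireY, ← tsum_mul_left, ← tsum_mul_left,
    ← hs.tsum_sub ((summable_entireY (n + 1) z).mul_left z)]
  refine tsum_congr fun j => ?_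
  have h2 := besselJCoeff_succ_mul n j
  have h3 : besselJCoeff (n + 1) j = -(((j : ℝ) + 1) * besselJCoeff n (j + 1)) := by linarith
  rw [besselYCoeff, besselYCoeff, h3, show n + (j + 1) = n + 1 + j by ring, harmonic_succ_cast]
  have : ((j : ℝ) + 1) ≠ 0 := by positivity
  field_simp
  ring

/-! ### Recurrences of the Bessel functions -/

theorem besselJ_eq_entireJ (n : ℕ) (x : ℝ) :
    besselJ n x = (x / 2) ^ n * entireJ n ((x / 2) ^ 2) := by
  rw [besselJ, entireJ, ← tsum_mul_left]
  refine tsum_congr fun j => ?_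
  rw [besselJCoeff, pow_add, pow_mul]; ring

/-- Splitting each digamma value into a harmonic number and -γ moves the Euler constant to a
multiple of J_n, so that the remaining series has the coefficients `besselYCoeff`. -/
theorem besselY_eq_entireY (n : ℕ) (x : ℝ) :
    besselY n x = 2 / Real.pi * Real.log (x / 2) * besselJ n x
      + 2 / Real.pi * Real.eulerMascheroniConstant * besselJ n x
      - 1 / Real.pi * ((x / 2) ^ n * entireY n ((x / 2) ^ 2))
      - 1 / Real.pi * besselYPolar n x := by
  have h : ∑' j : ℕ, (digammaSucc j + digammaSucc (n + j)) *
        ((-1) ^ j / ((j.factorial : ℝ) * ((n + j).factorial : ℝ)) * (x / 2) ^ (2 * j + n))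
      = (x / 2) ^ n * entireY n ((x / 2) ^ 2)
        - 2 * Real.eulerMascheroniConstant * ((x / 2) ^ n * entireJ n ((x / 2) ^ 2)) := by
    rw [entireY, entireJ, ← tsum_mul_left, ← tsum_mul_left, ← tsum_mul_left,
      ← ((summable_entireY n _).mul_left _).tsum_sub (((summable_entireJ n _).mul_left _).mul_left _)]
    refine tsum_congr fun j => ?_
    rw [besselYCoeff, besselJCoeff, digammaSucc, digammaSucc, pow_add, pow_mul]; ring
  rw [besselY, h, besselJ_eq_entireJ, besselYPolar]
  ring

theorem hasDerivAt_div_two_pow (n : ℕ) {x : ℝ} (hx : x ≠ 0) :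
    HasDerivAt (fun x : ℝ => (x / 2) ^ n) ((n : ℝ) / x * (x / 2) ^ n) x := by
  have h := ((hasDerivAt_id x).div_const 2).pow n
  refine h.congr_deriv ?_
  rcases n with _ | n
  · simp
  · simp only [id, Nat.add_sub_cancel, pow_succ]
    field_simp

theorem HasDerivAt.comp_div_two_sq {f : ℝ → ℝ} {d x : ℝ} (hx : x ≠ 0)
    (h : HasDerivAt f d ((x / 2) ^ 2)) :
    HasDerivAt (fun x : ℝ => f ((x / 2) ^ 2)) (2 / x * ((x / 2) ^ 2 * d)) x := by
  have := h.comp x (hasDerivAt_div_two_pow 2 hx)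
  refine this.congr_deriv ?_
  push_cast; ring

theorem hasDerivAt_besselJ (n : ℕ) {x : ℝ} (hx : x ≠ 0) :
    HasDerivAt (besselJ n) ((n : ℝ) / x * besselJ n x - besselJ (n + 1) x) x := by
  rw [funext (besselJ_eq_entireJ n)]
  refine ((hasDerivAt_div_two_pow n hx).mul
    ((hasDerivAt_entireJ n _).comp_div_two_sq hx)).congr_deriv ?_
  simp only [besselJ_eq_entireJ, pow_succ]
  field_simp
  ring

theorem besselJ_add_two (n : ℕ) {x : ℝ} (hx : x ≠ 0) :
    besselJ (n + 2) x = 2 * ((n : ℝ) + 1) / x * besselJ (n + 1) x - besselJ n x := by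
  rw [besselJ_eq_entireJ n, mul_entireJ_add n ((x / 2) ^ 2)]
  simp only [besselJ_eq_entireJ, pow_succ]
  field_simp
  ring

theorem hasDerivAt_besselJ_succ (n : ℕ) {x : ℝ} (hx : x ≠ 0) :
    HasDerivAt (besselJ (n + 1)) (besselJ n x - ((n : ℝ) + 1) / x * besselJ (n + 1) x) x := by
  refine (hasDerivAt_besselJ (n + 1) hx).congr_deriv ?_
  rw [besselJ_add_two n hx]; push_cast; ring

theorem hasDerivAt_besselYPolar_term (c : ℝ) (n : ℤ) {x : ℝ} (hx : x ≠ 0) :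
    HasDerivAt (fun x : ℝ => c * (x / 2) ^ n) (c * ((n : ℝ) / x * (x / 2) ^ n)) x := by
  have h := ((hasDerivAt_zpow n (x / 2) (Or.inl (by simpa using hx))).comp x
    ((hasDerivAt_id x).div_const 2)).const_mul c
  refine h.congr_deriv ?_
  rw [zpow_sub_one₀ (by simpa using hx)]
  field_simp

theorem hasDerivAt_besselYPolar_succ (n : ℕ) {x : ℝ} (hx : x ≠ 0) :
    HasDerivAt (besselYPolar (n + 1))
      (besselYPolar n x - ((n : ℝ) + 1) / x * besselYPolar (n + 1) x) x := by
  have h := HasDerivAt.fun_sum (u := Finset.range (n + 1)) fun j _ => hasDerivAt_besselYPolar_term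
    (((n + 1 - j - 1).factorial : ℝ) / (j.factorial : ℝ)) (2 * (j : ℤ) - ((n + 1 : ℕ) : ℤ)) hx
  refine h.congr_deriv ?_
  rw [eq_sub_iff_add_eq, besselYPolar, besselYPolar, Finset.mul_sum, ← Finset.sum_add_distrib,
    -- In the term j = 0 the exponent -(n+1) cancels the added n+1; for the others the factor 2(j+1)
    -- reduces (j+1)! to j!, which is the sum of order n.
    Finset.sum_range_succ']
  have hw : x / 2 ≠ 0 := by simpa using hx
  refine (congrArg₂ (· + ·) (Finset.sum_congr rfl fun j _ => ?_) ?_).trans (add_zero _)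
  · have e : (2 * ((j + 1 : ℕ) : ℤ) - ((n + 1 : ℕ) : ℤ)) = 2 * (j : ℤ) - n + 1 := by push_cast; ring
    rw [e, zpow_add_one₀ hw, show n + 1 - (j + 1) - 1 = n - j - 1 by omega, Nat.factorial_succ]
    have : (j.factorial : ℝ) ≠ 0 := by positivity
    push_cast
    field_simp
    ring_nf
  · push_cast
    ring

theorem hasDerivAt_besselYPolar (n : ℕ) {x : ℝ} (hx : x ≠ 0) :
    HasDerivAt (besselYPolar n) ((n : ℝ) / x * besselYPolar n x - besselYPolar (n + 1) x
      + 2 / x * ((x / 2) ^ n / (n.factorial : ℝ))) x := by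
  have h := HasDerivAt.fun_sum (u := Finset.range n) fun j _ => hasDerivAt_besselYPolar_term
    (((n - j - 1).factorial : ℝ) / (j.factorial : ℝ)) (2 * (j : ℤ) - (n : ℤ)) hx
  refine h.congr_deriv ?_
  have hw : x / 2 ≠ 0 := by simpa using hx
  have e : besselYPolar (n + 1) x - 2 / x * ((x / 2) ^ n / (n.factorial : ℝ))
      = ∑ j ∈ Finset.range n, (((n - j).factorial : ℝ) / (j.factorial : ℝ)
        * (x / 2) ^ (2 * (j : ℤ) - (n : ℤ)) * (2 / x)) := by
    rw [besselYPolar, Finset.sum_range_succ, add_sub_assoc]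
    refine (congrArg₂ (· + ·) (Finset.sum_congr rfl fun j _ => ?_) ?_).trans (add_zero _)
    rotate_left
    · rw [sub_eq_zero, show 2 * (n : ℤ) - ((n + 1 : ℕ) : ℤ) = n - 1 by push_cast; ring,
        zpow_sub_one₀ hw, show n + 1 - n - 1 = 0 by omega, zpow_natCast]
      simp only [Nat.factorial_zero, Nat.cast_one]
      field_simp
    · rw [show 2 * (j : ℤ) - ((n + 1 : ℕ) : ℤ) = 2 * (j : ℤ) - n - 1 by push_cast; ring,
        zpow_sub_one₀ hw, show n + 1 - j - 1 = n - j by omega]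
      field_simp
  rw [sub_add, e, besselYPolar, Finset.mul_sum, ← Finset.sum_sub_distrib]
  refine Finset.sum_congr rfl fun j hj => ?_
  have hj' : j < n := Finset.mem_range.mp hj
  rw [show n - j = (n - j - 1) + 1 by omega, Nat.factorial_succ]
  have h1 : ((n - j - 1 + 1 : ℕ) : ℝ) = n - j := by
    rw [Nat.sub_add_cancel (by omega), Nat.cast_sub hj'.le]
  rw [Nat.cast_mul, h1, Nat.add_sub_cancel]
  push_cast
  ring

theorem hasDerivAt_log_div_two {x : ℝ} (hx : x ≠ 0) :
    HasDerivAt (fun x : ℝ => Real.log (x / 2)) (1 / x) x := by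
  refine (((hasDerivAt_id x).div_const 2).log (by simpa using hx)).congr_deriv ?_
  simp only [id]; field_simp

theorem hasDerivAt_besselY_succ (n : ℕ) {x : ℝ} (hx : x ≠ 0) :
    HasDerivAt (besselY (n + 1)) (besselY n x - ((n : ℝ) + 1) / x * besselY (n + 1) x) x := by
  obtain ⟨d, hd, hd'⟩ := hasDerivAt_entireY_succ n ((x / 2) ^ 2)
  have hJ := hasDerivAt_besselJ_succ n hx
  have h := (((((hasDerivAt_log_div_two hx).const_mul (2 / Real.pi)).mul hJ).add
    (hJ.const_mul (2 / Real.pi * Real.eulerMascheroniConstant))).sub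
    (((hasDerivAt_div_two_pow (n + 1) hx).mul (hd.comp_div_two_sq hx)).const_mul (1 / Real.pi))).sub
    ((hasDerivAt_besselYPolar_succ n hx).const_mul (1 / Real.pi))
  rw [funext (besselY_eq_entireY (n + 1))]
  refine h.congr_deriv ?_
  beta_reduce
  rw [hd', besselY_eq_entireY n, besselJ_eq_entireJ (n + 1), pow_succ]
  push_cast
  have := Real.pi_ne_zero
  field_simp
  ring

theorem hasDerivAt_besselY (n : ℕ) {x : ℝ} (hx : x ≠ 0) :
    HasDerivAt (besselY n) ((n : ℝ) / x * besselY n x - besselY (n + 1) x) x := by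
  obtain ⟨d, hd, hd'⟩ := hasDerivAt_entireY_pred n ((x / 2) ^ 2)
  have hJ := hasDerivAt_besselJ n hx
  have h := (((((hasDerivAt_log_div_two hx).const_mul (2 / Real.pi)).mul hJ).add
    (hJ.const_mul (2 / Real.pi * Real.eulerMascheroniConstant))).sub
    (((hasDerivAt_div_two_pow n hx).mul (hd.comp_div_two_sq hx)).const_mul (1 / Real.pi))).sub
    ((hasDerivAt_besselYPolar n hx).const_mul (1 / Real.pi))
  rw [funext (besselY_eq_entireY n)]
  refine h.congr_deriv ?_
  beta_reduce
  rw [hd', besselY_eq_entireY (n + 1), besselJ_eq_entireJ n, pow_succ]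
  have := Real.pi_ne_zero
  field_simp
  ring

/-- The two formulas for the derivative of Y_{n+1}, one lowering and one raising the order, must
agree. -/
theorem besselY_add_two (n : ℕ) {x : ℝ} (hx : x ≠ 0) :
    besselY (n + 2) x = 2 * ((n : ℝ) + 1) / x * besselY (n + 1) x - besselY n x := by
  have h := (hasDerivAt_besselY (n + 1) hx).unique (hasDerivAt_besselY_succ n hx)
  push_cast at h
  linear_combination -h

/-! ### Behaviour near zero, Wronskian, bounds -/

theorem exists_abs_tsum_mul_pow_sub_le {a : ℕ → ℝ} {C : ℝ}
    (ha : ∀ j, |a j| ≤ C / (j.factorial : ℝ)) :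
    ∃ K : ℝ, 0 < K ∧ ∀ z : ℝ, 0 ≤ z → z ≤ 1 → |(∑' j, a j * z ^ j) - a 0| ≤ K * z := by
  have hC : 0 ≤ C := by simpa using (abs_nonneg _).trans (ha 0)
  have hb : ∀ j, |a (j + 1)| ≤ C / (j.factorial : ℝ) := fun j => (ha (j + 1)).trans <| by
    have h1 : (0 : ℝ) < (j.factorial : ℝ) := by positivity
    have h2 : (j.factorial : ℝ) ≤ ((j + 1).factorial : ℝ) := by
      exact_mod_cast Nat.factorial_le (Nat.le_succ j)
    gcongr
  have hs : Summable fun j : ℕ => C / (j.factorial : ℝ) := by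
    simpa [div_eq_mul_inv] using (Real.summable_pow_div_factorial 1).mul_left C
  refine ⟨∑' j : ℕ, C / (j.factorial : ℝ) + 1, ?_, fun z hz hz1 => ?_⟩
  · have : 0 ≤ ∑' j : ℕ, C / (j.factorial : ℝ) := tsum_nonneg fun j => by positivity
    linarith
  have hle : ∀ j, ‖a (j + 1) * z ^ j‖ ≤ C / (j.factorial : ℝ) := fun j => by
    rw [norm_mul, norm_pow, Real.norm_eq_abs, Real.norm_eq_abs, abs_of_nonneg hz]
    calc _ ≤ C / (j.factorial : ℝ) * 1 := by
          gcongr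
          · exact hb j
          · exact pow_le_one₀ hz hz1
      _ = _ := mul_one _
  have h : (∑' j, a j * z ^ j) - a 0 = z * ∑' j, a (j + 1) * z ^ j := by
    rw [(summable_mul_pow_of_le_factorial ha z).tsum_eq_zero_add, ← tsum_mul_left]
    simp only [pow_zero, mul_one, add_sub_cancel_left]
    exact tsum_congr fun j => by ring
  rw [h, abs_mul, abs_of_nonneg hz, mul_comm]
  have := tsum_of_norm_bounded hs.hasSum hle
  rw [Real.norm_eq_abs] at this
  gcongr
  linarith

theorem exists_abs_entireJ_sub_le (n : ℕ) : ∃ K : ℝ, 0 < K ∧ ∀ x : ℝ, 0 < x → x ≤ 1 →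
    |entireJ n ((x / 2) ^ 2) - 1 / (n.factorial : ℝ)| ≤ K * x ^ 2 := by
  obtain ⟨K, hK, h⟩ := exists_abs_tsum_mul_pow_sub_le (abs_besselJCoeff_le n)
  refine ⟨K, hK, fun x hx hx1 => ?_⟩
  have h1 := h ((x / 2) ^ 2) (by positivity) (by nlinarith)
  have h2 : besselJCoeff n 0 = 1 / (n.factorial : ℝ) := by simp [besselJCoeff]
  rw [h2] at h1
  refine h1.trans ?_
  nlinarith [sq_nonneg x]

theorem exists_abs_entireY_sub_le (n : ℕ) : ∃ K : ℝ, 0 < K ∧ ∀ x : ℝ, 0 < x → x ≤ 1 →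
    |entireY n ((x / 2) ^ 2) - besselYCoeff n 0| ≤ K * x ^ 2 := by
  obtain ⟨K, hK, h⟩ := exists_abs_tsum_mul_pow_sub_le (abs_besselYCoeff_le n)
  refine ⟨K, hK, fun x hx hx1 => ?_⟩
  refine (h ((x / 2) ^ 2) (by positivity) (by nlinarith)).trans ?_
  nlinarith [sq_nonneg x]

theorem mul_abs_log_le_one {x : ℝ} (hx : 0 < x) (hx1 : x ≤ 1) : x * |Real.log x| ≤ 1 := by
  have := Real.abs_log_mul_self_lt x hx hx1
  rw [abs_mul, abs_of_pos hx] at this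
  linarith

theorem mul_sq_le_mul {K x : ℝ} (hK : 0 < K) (hx : 0 < x) (hx1 : x ≤ 1) : K * x ^ 2 ≤ K * x := by
  have : x ^ 2 ≤ x := by nlinarith
  gcongr

theorem exists_abs_besselJ_zero_sub_le : ∃ K : ℝ, 0 < K ∧ ∀ x : ℝ, 0 < x → x ≤ 1 →
    |besselJ 0 x - 1| ≤ K * x ^ 2 := by
  obtain ⟨K, hK, h⟩ := exists_abs_entireJ_sub_le 0
  refine ⟨K, hK, fun x hx hx1 => ?_⟩
  simpa [besselJ_eq_entireJ] using h x hx hx1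

theorem exists_abs_besselJ_one_le : ∃ K : ℝ, 0 < K ∧ ∀ x : ℝ, 0 < x → x ≤ 1 →
    |besselJ 1 x| ≤ K * x := by
  obtain ⟨K, hK, h⟩ := exists_abs_entireJ_sub_le 1
  refine ⟨K + 1, by positivity, fun x hx hx1 => ?_⟩
  have h1 := h x hx hx1
  simp only [Nat.factorial_one, Nat.cast_one, div_one] at h1
  rw [besselJ_eq_entireJ, abs_mul, pow_one, abs_of_pos (by positivity)]
  have h2 : |entireJ 1 ((x / 2) ^ 2)| ≤ K + 1 := by
    have := abs_sub_abs_le_abs_sub (entireJ 1 ((x / 2) ^ 2)) 1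
    rw [abs_one] at this
    have h3 := mul_sq_le_mul hK hx hx1
    have h4 := mul_le_of_le_one_right hK.le hx1
    linarith
  nlinarith [abs_nonneg (entireJ 1 ((x / 2) ^ 2))]

/-- The logarithm multiplies J_0 - 1 = O(x²), and x |log x| ≤ 1 turns that product into O(x). -/
theorem exists_abs_besselY_zero_sub_le : ∃ K : ℝ, 0 < K ∧ ∀ x : ℝ, 0 < x → x ≤ 1 →
    |besselY 0 x - 2 / Real.pi * (Real.log x + (Real.eulerMascheroniConstant - Real.log 2))|
      ≤ K * x := by
  obtain ⟨K, hK, h⟩ := exists_abs_besselJ_zero_sub_le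
  obtain ⟨K', hK', h'⟩ := exists_abs_entireY_sub_le 0
  set g := Real.eulerMascheroniConstant - Real.log 2
  refine ⟨2 / Real.pi * (1 + |g|) * K + 1 / Real.pi * K', by positivity, fun x hx hx1 => ?_⟩
  have h1 := h x hx hx1
  have h2 := h' x hx hx1
  have h3 : besselYCoeff 0 0 = 0 := by simp [besselYCoeff]
  rw [h3, sub_zero] at h2
  have e : besselY 0 x - 2 / Real.pi * (Real.log x + g)
      = 2 / Real.pi * ((Real.log x + g) * (besselJ 0 x - 1))
        - 1 / Real.pi * entireY 0 ((x / 2) ^ 2) := by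
    rw [besselY_eq_entireY, besselYPolar, Real.log_div hx.ne' two_ne_zero]
    simp only [g, Finset.range_zero, Finset.sum_empty, pow_zero, one_mul]
    ring
  have h4 := mul_abs_log_le_one hx hx1
  have hp := Real.pi_pos
  have h5 : |(Real.log x + g) * (besselJ 0 x - 1)| ≤ (1 + |g|) * K * x := by
    rw [abs_mul]
    calc |Real.log x + g| * |besselJ 0 x - 1| ≤ (|Real.log x| + |g|) * (K * x ^ 2) := by
          gcongr
          exact abs_add_le _ _
      _ = (x * |Real.log x| + x * |g|) * (K * x) := by ring
      _ ≤ (1 + 1 * |g|) * (K * x) := by gcongr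
      _ = _ := by ring
  have h6 : |entireY 0 ((x / 2) ^ 2)| ≤ K' * x := h2.trans (mul_sq_le_mul hK' hx hx1)
  rw [e]
  calc _ ≤ 2 / Real.pi * |(Real.log x + g) * (besselJ 0 x - 1)|
        + 1 / Real.pi * |entireY 0 ((x / 2) ^ 2)| := by
        refine (abs_sub _ _).trans (le_of_eq ?_)
        rw [abs_mul (2 / Real.pi), abs_mul (1 / Real.pi),
          abs_of_pos (by positivity : 0 < 2 / Real.pi),
          abs_of_pos (by positivity : 0 < 1 / Real.pi)]
    _ ≤ 2 / Real.pi * ((1 + |g|) * K * x) + 1 / Real.pi * (K' * x) := by gcongr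
    _ = _ := by ring

/-- The finite sum of order one is the single term 2/x, which supplies the pole -2/(πx); everything
else is O(x) after multiplication by x. -/
theorem exists_abs_mul_besselY_one_add_le : ∃ K : ℝ, 0 < K ∧ ∀ x : ℝ, 0 < x → x ≤ 1 →
    |x * besselY 1 x + 2 / Real.pi| ≤ K * x := by
  obtain ⟨K, hK, h⟩ := exists_abs_besselJ_one_le
  obtain ⟨K', hK', h'⟩ := exists_abs_entireY_sub_le 1
  set g := Real.eulerMascheroniConstant - Real.log 2
  refine ⟨2 / Real.pi * (1 + |g|) * K + 1 / Real.pi * (K' + |besselYCoeff 1 0|), by positivity,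
    fun x hx hx1 => ?_⟩
  have h1 := h x hx hx1
  have h2 := h' x hx hx1
  have e : x * besselY 1 x + 2 / Real.pi
      = 2 / Real.pi * ((Real.log x + g) * (x * besselJ 1 x))
        - 1 / Real.pi * (x ^ 2 / 2 * entireY 1 ((x / 2) ^ 2)) := by
    rw [besselY_eq_entireY, besselYPolar, Real.log_div hx.ne' two_ne_zero]
    simp only [g, Finset.range_one, Finset.sum_singleton, pow_one]
    norm_num
    field_simp
    ring
  have h4 := mul_abs_log_le_one hx hx1
  have hp := Real.pi_pos
  have h5 : |(Real.log x + g) * (x * besselJ 1 x)| ≤ (1 + |g|) * K * x := by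
    rw [abs_mul, abs_mul, abs_of_pos hx]
    calc |Real.log x + g| * (x * |besselJ 1 x|) ≤ (|Real.log x| + |g|) * (x * (K * x)) := by
          gcongr
          exact abs_add_le _ _
      _ = (x * |Real.log x| + x * |g|) * (K * x) := by ring
      _ ≤ (1 + 1 * |g|) * (K * x) := by gcongr
      _ = _ := by ring
  have h6 : |x ^ 2 / 2 * entireY 1 ((x / 2) ^ 2)| ≤ (K' + |besselYCoeff 1 0|) * x := by
    rw [abs_mul, abs_of_pos (by positivity)]
    have h7 : |entireY 1 ((x / 2) ^ 2)| ≤ K' + |besselYCoeff 1 0| := by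
      have := abs_sub_abs_le_abs_sub (entireY 1 ((x / 2) ^ 2)) (besselYCoeff 1 0)
      have h3 := mul_sq_le_mul hK' hx hx1
      have h4 := mul_le_of_le_one_right hK'.le hx1
      linarith
    calc x ^ 2 / 2 * |entireY 1 ((x / 2) ^ 2)| ≤ x * (K' + |besselYCoeff 1 0|) := by
          gcongr
          nlinarith
      _ = _ := by ring
  rw [e]
  calc _ ≤ 2 / Real.pi * |(Real.log x + g) * (x * besselJ 1 x)|
        + 1 / Real.pi * |x ^ 2 / 2 * entireY 1 ((x / 2) ^ 2)| := by
        refine (abs_sub _ _).trans (le_of_eq ?_)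
        rw [abs_mul (2 / Real.pi), abs_mul (1 / Real.pi),
          abs_of_pos (by positivity : 0 < 2 / Real.pi),
          abs_of_pos (by positivity : 0 < 1 / Real.pi)]
    _ ≤ 2 / Real.pi * ((1 + |g|) * K * x) + 1 / Real.pi * ((K' + |besselYCoeff 1 0|) * x) := by
        gcongr
    _ = _ := by ring

theorem tendsto_of_abs_sub_le {f : ℝ → ℝ} {c K : ℝ}
    (h : ∀ x : ℝ, 0 < x → x ≤ 1 → |f x - c| ≤ K * x) : Tendsto f (𝓝[>] 0) (𝓝 c) := by
  rw [tendsto_iff_norm_sub_tendsto_zero]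
  have h0 : Tendsto (fun x : ℝ => K * x) (𝓝[>] 0) (𝓝 0) := by
    have : Tendsto (fun x : ℝ => K * x) (𝓝 0) (𝓝 (K * 0)) := (continuous_const_mul K).tendsto 0
    rw [mul_zero] at this
    exact this.mono_left nhdsWithin_le_nhds
  refine squeeze_zero' (Eventually.of_forall fun _ => norm_nonneg _) ?_ h0
  filter_upwards [Ioc_mem_nhdsGT (zero_lt_one' ℝ)] with x hx using h x hx.1 hx.2

/-- A function on `(0, ∞)` with zero derivative that tends to `c` at `0` is constantly `c`. -/
theorem eq_of_hasDerivAt_zero_of_tendsto {E : Type*} [NormedAddCommGroup E] [NormedSpace ℝ E]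
    {f : ℝ → E} {c : E} (hf : ∀ x : ℝ, 0 < x → HasDerivAt f 0 x)
    (hc : Tendsto f (𝓝[>] 0) (𝓝 c)) {x : ℝ} (hx : 0 < x) : f x = c := by
  have hconst : ∀ y ∈ Set.Ioi (0 : ℝ), f y = f x := fun y hy =>
    (convex_Ioi (0 : ℝ)).is_const_of_fderivWithin_eq_zero (𝕜 := ℝ)
      (fun z hz => (hf z hz).differentiableAt.differentiableWithinAt)
      (fun z hz => by
        rw [fderivWithin_of_isOpen isOpen_Ioi hz, (hf z hz).hasFDerivAt.fderiv]
        ext; simp) hy hx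
  have h1 : Tendsto f (𝓝[>] 0) (𝓝 (f x)) :=
    tendsto_const_nhds.congr' (by filter_upwards [self_mem_nhdsWithin] with y hy using (hconst y hy).symm)
  exact tendsto_nhds_unique h1 hc

/-- The recurrences make the derivative vanish, and the constant is read off at 0, where only J_0 ·
x Y_1 → -2/π survives. -/
theorem wronskian_bessel_zero {x : ℝ} (hx : 0 < x) :
    x * (besselJ 1 x * besselY 0 x - besselJ 0 x * besselY 1 x) = 2 / Real.pi := by
  obtain ⟨K0, hK0, h0⟩ := exists_abs_besselJ_zero_sub_le
  obtain ⟨K1, hK1, h1⟩ := exists_abs_besselJ_one_le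
  obtain ⟨L0, hL0, g0⟩ := exists_abs_besselY_zero_sub_le
  obtain ⟨L1, hL1, g1⟩ := exists_abs_mul_besselY_one_add_le
  have t0 : Tendsto (besselJ 0) (𝓝[>] 0) (𝓝 1) :=
    tendsto_of_abs_sub_le (K := K0) fun x hx hx1 => (h0 x hx hx1).trans (mul_sq_le_mul hK0 hx hx1)
  have t1 : Tendsto (besselJ 1) (𝓝[>] 0) (𝓝 0) :=
    tendsto_of_abs_sub_le (K := K1) fun x hx hx1 => by simpa using h1 x hx hx1
  have s1 : Tendsto (fun x => x * besselY 1 x) (𝓝[>] 0) (𝓝 (-(2 / Real.pi))) :=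
    tendsto_of_abs_sub_le (K := L1) fun x hx hx1 => by simpa using g1 x hx hx1
  have hlog : Tendsto (fun x : ℝ => x * Real.log x) (𝓝[>] 0) (𝓝 0) := by
    have := Real.continuous_mul_log.tendsto 0
    simp only [zero_mul] at this
    exact this.mono_left nhdsWithin_le_nhds
  have hid : Tendsto (fun x : ℝ => x) (𝓝[>] 0) (𝓝 0) := nhdsWithin_le_nhds
  have s0 : Tendsto (fun x => x * besselY 0 x) (𝓝[>] 0) (𝓝 0) := by
    have ha : Tendsto (fun x => besselY 0 x - 2 / Real.pi *
        (Real.log x + (Real.eulerMascheroniConstant - Real.log 2))) (𝓝[>] 0) (𝓝 0) :=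
      tendsto_of_abs_sub_le (K := L0) fun x hx hx1 => by simpa using g0 x hx hx1
    have := (hid.mul ha).add ((hlog.add (hid.mul_const
      (Real.eulerMascheroniConstant - Real.log 2))).const_mul (2 / Real.pi))
    simp only [zero_mul, add_zero, mul_zero] at this
    exact this.congr fun x => by ring
  refine eq_of_hasDerivAt_zero_of_tendsto
    (f := fun x => x * (besselJ 1 x * besselY 0 x - besselJ 0 x * besselY 1 x))
    (fun x hx => ?_) ?_ hx
  · have hx' := hx.ne'
    refine ((hasDerivAt_id x).mul (((hasDerivAt_besselJ_succ 0 hx').mul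
      (hasDerivAt_besselY 0 hx')).sub ((hasDerivAt_besselJ 0 hx').mul
      (hasDerivAt_besselY_succ 0 hx')))).congr_deriv ?_
    simp only [id, Nat.cast_zero, zero_add, zero_div, Pi.sub_apply, Pi.mul_apply]
    field_simp
    ring
  · have := (t1.mul s0).sub (t0.mul s1)
    simp only [mul_zero, one_mul, zero_sub, neg_neg] at this
    exact this.congr fun x => by ring

theorem wronskian_bessel (n : ℕ) {x : ℝ} (hx : 0 < x) :
    x * (besselJ (n + 1) x * besselY n x - besselJ n x * besselY (n + 1) x) = 2 / Real.pi := by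
  induction n with
  | zero => exact wronskian_bessel_zero hx
  | succ n ih =>
    rw [← ih, besselJ_add_two n hx.ne', besselY_add_two n hx.ne']
    ring

/-- The energy y² + y₁² has derivative -(2/x) y₁², so on [1, ∞) it never exceeds its value at 1. -/
theorem exists_abs_bessel_zero_le {y y₁ : ℝ → ℝ}
    (hy : ∀ x : ℝ, 0 < x → HasDerivAt y (-y₁ x) x)
    (hy₁ : ∀ x : ℝ, 0 < x → HasDerivAt y₁ (y x - 1 / x * y₁ x) x) :
    ∃ K : ℝ, 0 < K ∧ ∀ x, 1 ≤ x → |y x| ≤ K ∧ |y₁ x| ≤ K := by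
  have hd : ∀ x : ℝ, 0 < x → HasDerivAt (fun x => y x ^ 2 + y₁ x ^ 2) (-(2 / x * y₁ x ^ 2)) x :=
    fun x hx => by
      refine (((hy x hx).pow 2).add ((hy₁ x hx).pow 2)).congr_deriv ?_
      field_simp
      ring
  have hanti : AntitoneOn (fun x => y x ^ 2 + y₁ x ^ 2) (Set.Ici 1) := by
    refine antitoneOn_of_deriv_nonpos (convex_Ici 1)
      (fun x hx => (hd x (by linarith [Set.mem_Ici.mp hx])).continuousAt.continuousWithinAt)
      (fun x hx => ?_) fun x hx => ?_
    · rw [interior_Ici] at hx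
      exact (hd x (by linarith [Set.mem_Ioi.mp hx])).differentiableAt.differentiableWithinAt
    · rw [interior_Ici] at hx
      have hx0 : 0 < x := by linarith [Set.mem_Ioi.mp hx]
      rw [(hd x hx0).deriv]
      have : 0 ≤ 2 / x * y₁ x ^ 2 := by positivity
      linarith
  refine ⟨y 1 ^ 2 + y₁ 1 ^ 2 + 1, by positivity, fun x hx => ?_⟩
  have h := hanti (Set.mem_Ici.mpr le_rfl) (Set.mem_Ici.mpr hx) hx
  simp only at h
  have h0 : y x ^ 2 + y₁ x ^ 2 ≤ (y 1 ^ 2 + y₁ 1 ^ 2 + 1) ^ 2 := by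
    nlinarith [sq_nonneg (y 1), sq_nonneg (y₁ 1)]
  exact ⟨abs_le_of_sq_le_sq (by nlinarith [sq_nonneg (y₁ x)]) (by positivity),
    abs_le_of_sq_le_sq (by nlinarith [sq_nonneg (y x)]) (by positivity)⟩

/-! ### Hankel functions: derivatives, behaviour at zero, global size and measurability. -/

theorem hasDerivAt_hankelH1 (n : ℕ) {x : ℝ} (hx : x ≠ 0) :
    HasDerivAt (hankelH1 n) (((n : ℝ) / x : ℝ) * hankelH1 n x - hankelH1 (n + 1) x) x := by
  refine ((hasDerivAt_besselJ n hx).ofReal_comp.add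
    ((hasDerivAt_besselY n hx).ofReal_comp.const_mul Complex.I)).congr_deriv ?_
  simp only [hankelH1]
  push_cast
  ring

theorem hasDerivAt_hankelH1_succ (n : ℕ) {x : ℝ} (hx : x ≠ 0) :
    HasDerivAt (hankelH1 (n + 1))
      (hankelH1 n x - ((((n : ℝ) + 1) / x : ℝ) : ℂ) * hankelH1 (n + 1) x) x := by
  refine ((hasDerivAt_besselJ_succ n hx).ofReal_comp.add
    ((hasDerivAt_besselY_succ n hx).ofReal_comp.const_mul Complex.I)).congr_deriv ?_
  simp only [hankelH1]
  push_cast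
  ring

theorem exists_norm_hankelH1_zero_sub_le : ∃ (b : ℂ) (K : ℝ), 0 < K ∧ ∀ x : ℝ, 0 < x → x ≤ 1 →
    ‖hankelH1 0 x - (2 / Real.pi * Complex.I * Real.log x + b)‖ ≤ K * x := by
  obtain ⟨K0, hK0, h0⟩ := exists_abs_besselJ_zero_sub_le
  obtain ⟨L0, hL0, g0⟩ := exists_abs_besselY_zero_sub_le
  set g := Real.eulerMascheroniConstant - Real.log 2
  refine ⟨1 + 2 / Real.pi * Complex.I * g, K0 + L0, by positivity, fun x hx hx1 => ?_⟩
  have e : hankelH1 0 x - (2 / Real.pi * Complex.I * Real.log x + (1 + 2 / Real.pi * Complex.I * g))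
      = ((besselJ 0 x - 1 : ℝ) : ℂ)
        + Complex.I * ((besselY 0 x - 2 / Real.pi * (Real.log x + g) : ℝ) : ℂ) := by
    rw [hankelH1]; push_cast; ring
  rw [e]
  refine (norm_add_le _ _).trans ?_
  rw [norm_mul, Complex.norm_I, one_mul, Complex.norm_real, Complex.norm_real, Real.norm_eq_abs,
    Real.norm_eq_abs]
  have h1 := (h0 x hx hx1).trans (mul_sq_le_mul hK0 hx hx1)
  have h2 := g0 x hx hx1
  linarith

theorem exists_norm_mul_hankelH1_one_add_le : ∃ K : ℝ, 0 < K ∧ ∀ x : ℝ, 0 < x → x ≤ 1 →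
    ‖x * hankelH1 1 x + 2 / Real.pi * Complex.I‖ ≤ K * x := by
  obtain ⟨K1, hK1, h1⟩ := exists_abs_besselJ_one_le
  obtain ⟨L1, hL1, g1⟩ := exists_abs_mul_besselY_one_add_le
  refine ⟨K1 + L1, by positivity, fun x hx hx1 => ?_⟩
  have e : x * hankelH1 1 x + 2 / Real.pi * Complex.I
      = ((x * besselJ 1 x : ℝ) : ℂ) + Complex.I * ((x * besselY 1 x + 2 / Real.pi : ℝ) : ℂ) := by
    rw [hankelH1]; push_cast; ring
  rw [e]
  refine (norm_add_le _ _).trans ?_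
  rw [norm_mul, Complex.norm_I, one_mul, Complex.norm_real, Complex.norm_real, Real.norm_eq_abs,
    Real.norm_eq_abs, abs_mul, abs_of_pos hx]
  have h3 := h1 x hx hx1
  have h2 := g1 x hx hx1
  nlinarith [abs_nonneg (besselJ 1 x)]

theorem exists_norm_hankelH1_zero_le : ∃ K : ℝ, 0 < K ∧ ∀ x : ℝ, 0 < x →
    ‖hankelH1 0 x‖ ≤ K * (1 + |Real.log x|) := by
  obtain ⟨b, K, hK, h⟩ := exists_norm_hankelH1_zero_sub_le
  obtain ⟨KJ, hKJ, hJ⟩ := exists_abs_bessel_zero_le (y := besselJ 0) (y₁ := besselJ 1)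
    (fun x hx => by simpa using hasDerivAt_besselJ 0 hx.ne')
    (fun x hx => by simpa using hasDerivAt_besselJ_succ 0 hx.ne')
  obtain ⟨KY, hKY, hY⟩ := exists_abs_bessel_zero_le (y := besselY 0) (y₁ := besselY 1)
    (fun x hx => by simpa using hasDerivAt_besselY 0 hx.ne')
    (fun x hx => by simpa using hasDerivAt_besselY_succ 0 hx.ne')
  have hp := Real.pi_pos
  refine ⟨K + ‖b‖ + 2 / Real.pi + KJ + KY, by positivity, fun x hx => ?_⟩
  have hl := abs_nonneg (Real.log x)
  rcases le_total x 1 with hx1 | hx1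
  · have h1 := h x hx hx1
    have h2 : ‖(2 / Real.pi * Complex.I * Real.log x + b : ℂ)‖ ≤ 2 / Real.pi * |Real.log x| + ‖b‖ := by
      refine (norm_add_le _ _).trans (le_of_eq ?_)
      simp [abs_of_pos hp]
    have h3 := norm_sub_norm_le (hankelH1 0 x) (2 / Real.pi * Complex.I * Real.log x + b)
    have h5 : 0 < 2 / Real.pi := by positivity
    have h4 : K * x ≤ K := by nlinarith
    have h6 : 0 ≤ (K + ‖b‖ + KJ + KY) * |Real.log x| := by positivity
    nlinarith
  · have h1 : ‖hankelH1 0 x‖ ≤ KJ + KY := by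
      rw [hankelH1]
      refine (norm_add_le _ _).trans ?_
      rw [norm_mul, Complex.norm_I, one_mul, Complex.norm_real, Complex.norm_real]
      exact add_le_add (hJ x hx1).1 (hY x hx1).1
    have h5 : 0 < 2 / Real.pi := by positivity
    have h6 : 0 ≤ (K + ‖b‖ + 2 / Real.pi + KJ + KY) * |Real.log x| := by positivity
    nlinarith [norm_nonneg b]

theorem exists_norm_mul_hankelH1_one_le : ∃ K : ℝ, 0 < K ∧ ∀ x : ℝ, 0 < x →
    ‖(x : ℂ) * hankelH1 1 x‖ ≤ K * (1 + x) := by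
  obtain ⟨K, hK, h⟩ := exists_norm_mul_hankelH1_one_add_le
  obtain ⟨KJ, hKJ, hJ⟩ := exists_abs_bessel_zero_le (y := besselJ 0) (y₁ := besselJ 1)
    (fun x hx => by simpa using hasDerivAt_besselJ 0 hx.ne')
    (fun x hx => by simpa using hasDerivAt_besselJ_succ 0 hx.ne')
  obtain ⟨KY, hKY, hY⟩ := exists_abs_bessel_zero_le (y := besselY 0) (y₁ := besselY 1)
    (fun x hx => by simpa using hasDerivAt_besselY 0 hx.ne')
    (fun x hx => by simpa using hasDerivAt_besselY_succ 0 hx.ne')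
  have hp := Real.pi_pos
  refine ⟨K + 2 / Real.pi + KJ + KY, by positivity, fun x hx => ?_⟩
  rcases le_total x 1 with hx1 | hx1
  · have h1 := h x hx hx1
    have h2 : ‖(2 / Real.pi * Complex.I : ℂ)‖ = 2 / Real.pi := by
      simp [abs_of_pos hp]
    have h3 := norm_sub_norm_le (x * hankelH1 1 x) (-(2 / Real.pi * Complex.I))
    rw [norm_neg, h2, sub_neg_eq_add] at h3
    have h5 : 0 < 2 / Real.pi := by positivity
    have h6 : 0 ≤ (KJ + KY) * (1 + x) := by positivity
    nlinarith
  · have h1 : ‖hankelH1 1 x‖ ≤ KJ + KY := by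
      rw [hankelH1]
      refine (norm_add_le _ _).trans ?_
      rw [norm_mul, Complex.norm_I, one_mul, Complex.norm_real, Complex.norm_real]
      exact add_le_add (hJ x hx1).2 (hY x hx1).2
    rw [norm_mul, Complex.norm_real, Real.norm_eq_abs, abs_of_pos hx]
    have h5 : 0 < 2 / Real.pi := by positivity
    have h6 : 0 ≤ (K + 2 / Real.pi) * (1 + x) := by positivity
    nlinarith

theorem continuous_entireJ (n : ℕ) : Continuous (entireJ n) :=
  continuous_iff_continuousAt.mpr fun z => (hasDerivAt_entireJ n z).continuousAt

theorem continuous_entireY (n : ℕ) : Continuous (entireY n) :=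
  continuous_iff_continuousAt.mpr fun z => (hasDerivAt_entireY n z).continuousAt

theorem continuous_besselJ (n : ℕ) : Continuous (besselJ n) := by
  rw [funext (besselJ_eq_entireJ n)]
  have := continuous_entireJ n
  fun_prop

theorem measurable_besselY (n : ℕ) : Measurable (besselY n) := by
  rw [funext (besselY_eq_entireY n)]
  have h1 := (continuous_besselJ n).measurable
  have h2 := (continuous_entireY n).measurable
  have h3 : Measurable (besselYPolar n) := by
    unfold besselYPolar
    refine Finset.measurable_fun_sum _ fun j _ => Measurable.const_mul ?_ _
    exact (measurable_id.div_const 2).pow_const _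
  have h4 : Measurable fun x : ℝ => entireY n ((x / 2) ^ 2) := h2.comp (by fun_prop)
  fun_prop

theorem measurable_hankelH1 (n : ℕ) : Measurable (hankelH1 n) := by
  have h1 := (continuous_besselJ n).measurable
  have h2 := measurable_besselY n
  unfold hankelH1
  fun_prop

/-! ### Uniqueness for the system satisfied by the products of solutions of order zero and one -/

/-- Since log x = 2 log √x, this is √x + 2 √x |log √x| ≤ 1 + 2. -/
theorem sqrt_mul_one_add_abs_log_le {x : ℝ} (hx : 0 < x) (hx1 : x ≤ 1) :
    √x * (1 + |Real.log x|) ≤ 3 := by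
  have h0 : 0 < √x := Real.sqrt_pos.mpr hx
  have h1 : √x ≤ 1 := Real.sqrt_le_one.mpr hx1
  have h2 := mul_abs_log_le_one h0 h1
  rw [Real.log_sqrt hx.le, abs_div, abs_two] at h2
  nlinarith

/-- The bilinear form in two solutions `(y, y₁)`, `(z, z₁)` of the Bessel system of order zero that
is conserved along solutions `(D, A, B)` of the system satisfied by `(y², -2xyy₁, y₁²)`. -/
theorem conserved_form_eq_zero {D A B : ℝ → ℂ} {y y₁ z z₁ : ℝ → ℝ}
    (hD : ∀ x : ℝ, 0 < x → HasDerivAt D (A x / x) x)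
    (hA : ∀ x : ℝ, 0 < x → HasDerivAt A (-2 * x * (D x - B x)) x)
    (hB : ∀ x : ℝ, 0 < x → HasDerivAt B ((-2 * B x - A x) / x) x)
    (hy : ∀ x : ℝ, 0 < x → HasDerivAt y (-y₁ x) x)
    (hy₁ : ∀ x : ℝ, 0 < x → HasDerivAt y₁ (y x - 1 / x * y₁ x) x)
    (hz : ∀ x : ℝ, 0 < x → HasDerivAt z (-z₁ x) x)
    (hz₁ : ∀ x : ℝ, 0 < x → HasDerivAt z₁ (z x - 1 / x * z₁ x) x)
    {K : ℝ} (bD : ∀ x : ℝ, 0 < x → x ≤ 1 / 2 → ‖D x‖ ≤ K * x)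
    (bA : ∀ x : ℝ, 0 < x → x ≤ 1 / 2 → ‖A x‖ ≤ K * x)
    (bB : ∀ x : ℝ, 0 < x → x ≤ 1 / 2 → ‖B x‖ ≤ K * (1 + |Real.log x|))
    (by_ : ∀ x : ℝ, 0 < x → x ≤ 1 / 2 → |y x| ≤ K * (1 + |Real.log x|))
    (bz : ∀ x : ℝ, 0 < x → x ≤ 1 / 2 → |z x| ≤ K * (1 + |Real.log x|))
    (by₁ : ∀ x : ℝ, 0 < x → x ≤ 1 / 2 → x * |y₁ x| ≤ K)
    (bz₁ : ∀ x : ℝ, 0 < x → x ≤ 1 / 2 → x * |z₁ x| ≤ K) {x : ℝ} (hx : 0 < x) :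
    (x : ℂ) ^ 2 * (y x * z x * B x + y₁ x * z₁ x * D x)
      + x / 2 * (y x * z₁ x + y₁ x * z x) * A x = 0 := by
  refine eq_of_hasDerivAt_zero_of_tendsto (f := fun x : ℝ => (x : ℂ) ^ 2 *
    (y x * z x * B x + y₁ x * z₁ x * D x) + x / 2 * (y x * z₁ x + y₁ x * z x) * A x)
    (fun x hx => ?_) ?_ hx
  · have hid : HasDerivAt (fun x : ℝ => (x : ℂ)) 1 x := by
      simpa using (hasDerivAt_id x).ofReal_comp
    have h1 := (hy x hx).ofReal_comp
    have h2 := (hy₁ x hx).ofReal_comp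
    have h3 := (hz x hx).ofReal_comp
    have h4 := (hz₁ x hx).ofReal_comp
    refine (((hid.pow 2).mul (((h1.mul h3).mul (hB x hx)).add ((h2.mul h4).mul (hD x hx)))).add
      (((hid.div_const 2).mul ((h1.mul h4).add (h2.mul h3))).mul (hA x hx))).congr_deriv ?_
    have hx' : (x : ℂ) ≠ 0 := by exact_mod_cast hx.ne'
    simp only [Pi.add_apply, Pi.mul_apply, Pi.pow_apply]
    push_cast
    field_simp
    ring
  · rw [tendsto_zero_iff_norm_tendsto_zero]
    have hK : 0 ≤ K := by
      have := (abs_nonneg _).trans (by_ (1 / 2) (by norm_num) le_rfl)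
      exact nonneg_of_mul_nonneg_left this (by positivity)
    -- 31 = 27 + 1 + 3 collects the bounds `e1`, `e2`, `e3` below. Each writes x as √x √x and pairs
    -- every logarithm with one factor √x; at least one √x is left over.
    have h0 : Tendsto (fun x : ℝ => 31 * K ^ 3 * √x) (𝓝[>] 0) (𝓝 0) := by
      have : Tendsto (fun x : ℝ => 31 * K ^ 3 * √x) (𝓝 0) (𝓝 (31 * K ^ 3 * √0)) :=
        (Real.continuous_sqrt.const_mul _).tendsto 0
      rw [Real.sqrt_zero, mul_zero] at this
      exact this.mono_left nhdsWithin_le_nhds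
    refine squeeze_zero' (Eventually.of_forall fun _ => norm_nonneg _) ?_ h0
    filter_upwards [Ioc_mem_nhdsGT (by norm_num : (0 : ℝ) < 1 / 2)] with x hx
    obtain ⟨hx0, hx1⟩ := hx
    set L := 1 + |Real.log x|
    have hL : 0 < L := by positivity
    set s := √x
    have hs : 0 < s := Real.sqrt_pos.mpr hx0
    have hs1 : s ≤ 1 := Real.sqrt_le_one.mpr (by linarith)
    have hsx : s * s = x := Real.mul_self_sqrt hx0.le
    have hsL : s * L ≤ 3 := sqrt_mul_one_add_abs_log_le hx0 (by linarith)
    have c1 := by_ x hx0 hx1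
    have c2 := bz x hx0 hx1
    have c3 := by₁ x hx0 hx1
    have c4 := bz₁ x hx0 hx1
    have c5 := bD x hx0 hx1
    have c6 := bA x hx0 hx1
    have c7 := bB x hx0 hx1
    have e1 : ‖(x : ℂ) ^ 2 * (y x * z x * B x)‖ ≤ 27 * K ^ 3 * s := by
      rw [norm_mul, norm_mul, norm_mul, norm_pow, Complex.norm_real, Complex.norm_real,
        Complex.norm_real, Real.norm_eq_abs, Real.norm_eq_abs, Real.norm_eq_abs, abs_of_pos hx0]
      calc x ^ 2 * (|y x| * |z x| * ‖B x‖) ≤ x ^ 2 * ((K * L) * (K * L) * (K * L)) := by gcongr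
        _ = K ^ 3 * ((s * L) ^ 3 * s) := by rw [← hsx]; ring
        _ ≤ K ^ 3 * (3 ^ 3 * s) := by gcongr
        _ = _ := by ring
    have e2 : ‖(x : ℂ) ^ 2 * (y₁ x * z₁ x * D x)‖ ≤ K ^ 3 * s := by
      rw [norm_mul, norm_mul, norm_mul, norm_pow, Complex.norm_real, Complex.norm_real,
        Complex.norm_real, Real.norm_eq_abs, Real.norm_eq_abs, Real.norm_eq_abs, abs_of_pos hx0]
      calc x ^ 2 * (|y₁ x| * |z₁ x| * ‖D x‖) = (x * |y₁ x|) * (x * |z₁ x|) * ‖D x‖ := by ring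
        _ ≤ K * K * (K * x) := by gcongr
        _ ≤ K * K * (K * s) := by gcongr; nlinarith
        _ = _ := by ring
    have e3 : ‖(x : ℂ) / 2 * (y x * z₁ x + y₁ x * z x) * A x‖ ≤ 3 * K ^ 3 * s := by
      have e4 : ‖((y x : ℂ) * z₁ x + y₁ x * z x)‖ ≤ |y x| * |z₁ x| + |y₁ x| * |z x| := by
        refine (norm_add_le _ _).trans (le_of_eq ?_)
        simp
      rw [norm_mul, norm_mul, norm_div, Complex.norm_real, Real.norm_eq_abs, abs_of_pos hx0,
        Complex.norm_ofNat]
      calc x / 2 * ‖((y x : ℂ) * z₁ x + y₁ x * z x)‖ * ‖A x‖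
          ≤ x / 2 * (|y x| * |z₁ x| + |y₁ x| * |z x|) * ‖A x‖ := by gcongr
        _ = 1 / 2 * (|y x| * (x * |z₁ x|) + (x * |y₁ x|) * |z x|) * ‖A x‖ := by ring
        _ ≤ 1 / 2 * ((K * L) * K + K * (K * L)) * (K * x) := by gcongr
        _ = K ^ 3 * ((s * L) * s) := by rw [← hsx]; ring
        _ ≤ K ^ 3 * (3 * s) := by gcongr
        _ = _ := by ring
    rw [mul_add]
    refine (norm_add₃_le).trans ?_
    linarith

/-- The conserved form vanishes for the pairs (J,J), (J,Y) and (Y,Y). With weights Y_0², -2 J_0 Y_0,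
J_0² the terms in A and B cancel and D times the squared Wronskian remains. Once D = 0, its equation
forces A = 0, and then the equation of A forces B = 0. -/
theorem eq_zero_of_product_system {D A B : ℝ → ℂ}
    (hD : ∀ x : ℝ, 0 < x → HasDerivAt D (A x / x) x)
    (hA : ∀ x : ℝ, 0 < x → HasDerivAt A (-2 * x * (D x - B x)) x)
    (hB : ∀ x : ℝ, 0 < x → HasDerivAt B ((-2 * B x - A x) / x) x)
    {K : ℝ} (bD : ∀ x : ℝ, 0 < x → x ≤ 1 / 2 → ‖D x‖ ≤ K * x)
    (bA : ∀ x : ℝ, 0 < x → x ≤ 1 / 2 → ‖A x‖ ≤ K * x)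
    (bB : ∀ x : ℝ, 0 < x → x ≤ 1 / 2 → ‖B x‖ ≤ K * (1 + |Real.log x|))
    {x : ℝ} (hx : 0 < x) : D x = 0 ∧ B x = 0 := by
  obtain ⟨K₁, hK₁, h₁⟩ := exists_norm_hankelH1_zero_le
  obtain ⟨K₂, hK₂, h₂⟩ := exists_norm_mul_hankelH1_one_le
  have re_le (n : ℕ) (x : ℝ) : |besselJ n x| ≤ ‖hankelH1 n x‖ := by
    simpa [hankelH1] using Complex.abs_re_le_norm (hankelH1 n x)
  have im_le (n : ℕ) (x : ℝ) : |besselY n x| ≤ ‖hankelH1 n x‖ := by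
    simpa [hankelH1] using Complex.abs_im_le_norm (hankelH1 n x)
  -- The 2 covers the factor 1 + x in the bound on x H_1, for x ≤ 1/2.
  set K' := max K (max K₁ (2 * K₂))
  have kk : K ≤ K' := le_max_left _ _
  have kk₁ : K₁ ≤ K' := (le_max_left _ _).trans (le_max_right _ _)
  have kk₂ : 2 * K₂ ≤ K' := (le_max_right _ _).trans (le_max_right _ _)
  have bD' : ∀ x : ℝ, 0 < x → x ≤ 1 / 2 → ‖D x‖ ≤ K' * x := fun x h0 h1 =>
    (bD x h0 h1).trans (by gcongr)
  have bA' : ∀ x : ℝ, 0 < x → x ≤ 1 / 2 → ‖A x‖ ≤ K' * x := fun x h0 h1 =>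
    (bA x h0 h1).trans (by gcongr)
  have bB' : ∀ x : ℝ, 0 < x → x ≤ 1 / 2 → ‖B x‖ ≤ K' * (1 + |Real.log x|) := fun x h0 h1 =>
    (bB x h0 h1).trans (by gcongr)
  have b0 : ∀ x : ℝ, 0 < x → x ≤ 1 / 2 → ‖hankelH1 0 x‖ ≤ K' * (1 + |Real.log x|) :=
    fun x h0 h1 => (h₁ x h0).trans (by gcongr)
  have b1 : ∀ x : ℝ, 0 < x → x ≤ 1 / 2 → x * ‖hankelH1 1 x‖ ≤ K' := fun x h0 h1 => by
    have := h₂ x h0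
    rw [norm_mul, Complex.norm_real, Real.norm_eq_abs, abs_of_pos h0] at this
    nlinarith
  have dJ0 : ∀ x : ℝ, 0 < x → HasDerivAt (besselJ 0) (-besselJ 1 x) x :=
    fun x hx => by simpa using hasDerivAt_besselJ 0 hx.ne'
  have dJ1 : ∀ x : ℝ, 0 < x → HasDerivAt (besselJ 1) (besselJ 0 x - 1 / x * besselJ 1 x) x :=
    fun x hx => by simpa using hasDerivAt_besselJ_succ 0 hx.ne'
  have dY0 : ∀ x : ℝ, 0 < x → HasDerivAt (besselY 0) (-besselY 1 x) x :=
    fun x hx => by simpa using hasDerivAt_besselY 0 hx.ne'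
  have dY1 : ∀ x : ℝ, 0 < x → HasDerivAt (besselY 1) (besselY 0 x - 1 / x * besselY 1 x) x :=
    fun x hx => by simpa using hasDerivAt_besselY_succ 0 hx.ne'
  have bJ0 := fun x h0 h1 => (re_le 0 x).trans (b0 x h0 h1)
  have bY0 := fun x h0 h1 => (im_le 0 x).trans (b0 x h0 h1)
  have bJ1 : ∀ x : ℝ, 0 < x → x ≤ 1 / 2 → x * |besselJ 1 x| ≤ K' := fun x h0 h1 =>
    (mul_le_mul_of_nonneg_left (re_le 1 x) h0.le).trans (b1 x h0 h1)
  have bY1 : ∀ x : ℝ, 0 < x → x ≤ 1 / 2 → x * |besselY 1 x| ≤ K' := fun x h0 h1 =>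
    (mul_le_mul_of_nonneg_left (im_le 1 x) h0.le).trans (b1 x h0 h1)
  have hzero : ∀ x : ℝ, 0 < x → D x = 0 := fun x hx => by
    have q1 := conserved_form_eq_zero hD hA hB dJ0 dJ1 dJ0 dJ1 bD' bA' bB' bJ0 bJ0 bJ1 bJ1 hx
    have q2 := conserved_form_eq_zero hD hA hB dJ0 dJ1 dY0 dY1 bD' bA' bB' bJ0 bY0 bJ1 bY1 hx
    have q3 := conserved_form_eq_zero hD hA hB dY0 dY1 dY0 dY1 bD' bA' bB' bY0 bY0 bY1 bY1 hx
    have hw : ((x * (besselJ 1 x * besselY 0 x - besselJ 0 x * besselY 1 x) : ℝ) : ℂ) ≠ 0 := by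
      rw [wronskian_bessel_zero hx]
      exact_mod_cast (by positivity : (0 : ℝ) < 2 / Real.pi).ne'
    have : ((x * (besselJ 1 x * besselY 0 x - besselJ 0 x * besselY 1 x) : ℝ) : ℂ) ^ 2 * D x = 0 := by
      push_cast
      linear_combination (besselY 0 x : ℂ) ^ 2 * q1
        - 2 * (besselJ 0 x : ℂ) * (besselY 0 x : ℂ) * q2 + (besselJ 0 x : ℂ) ^ 2 * q3
    exact (mul_eq_zero.mp this).resolve_left (pow_ne_zero 2 hw)
  have hxc : (x : ℂ) ≠ 0 := by exact_mod_cast hx.ne'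
  have hzA : ∀ x : ℝ, 0 < x → A x = 0 := fun x hx => by
    have h := (hD x hx).unique ((hasDerivAt_const x (0 : ℂ)).congr_of_eventuallyEq (by
      filter_upwards [lt_mem_nhds hx] with y hy using hzero y hy))
    exact (div_eq_zero_iff.mp h).resolve_right (by exact_mod_cast hx.ne')
  have h := (hA x hx).unique ((hasDerivAt_const x (0 : ℂ)).congr_of_eventuallyEq (by
      filter_upwards [lt_mem_nhds hx] with y hy using hzA y hy))
  refine ⟨hzero x hx, ?_⟩
  rw [hzero x hx] at h
  simpa [hxc] using h

/-! ### Averages of radial functions over the circle -/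

noncomputable section

/-- The `m`-th Fourier coefficient of `θ ↦ f(2k sin(θ/2))` on `(0, 2π)`, written with `u = θ/2`. -/
def sineAvg (f : ℝ → ℂ) (m : ℕ) (k : ℝ) : ℂ :=
  1 / (Real.pi : ℂ) * ∫ u in (0 : ℝ)..Real.pi, f (2 * k * Real.sin u) * (Real.cos (2 * m * u) : ℂ)

/-- `ρ H_0'(ρ)`. -/
def hankelG (ρ : ℝ) : ℂ := -(ρ * hankelH1 1 ρ)

end

theorem measurable_hankelG : Measurable hankelG := by
  have := measurable_hankelH1 1
  unfold hankelG
  fun_prop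

theorem hasDerivAt_hankelH1_zero {x : ℝ} (hx : 0 < x) :
    HasDerivAt (hankelH1 0) (hankelG x / x) x := by
  refine (hasDerivAt_hankelH1 0 hx.ne').congr_deriv ?_
  have hxc : (x : ℂ) ≠ 0 := by exact_mod_cast hx.ne'
  rw [hankelG]
  simp only [CharP.cast_eq_zero, zero_div, Complex.ofReal_zero, zero_mul, zero_add]
  field_simp
  ring

/-- This is Bessel's equation of order zero in the form (x H_0')' = -x H_0. -/
theorem hasDerivAt_hankelG {x : ℝ} (hx : 0 < x) :
    HasDerivAt hankelG (-(x * hankelH1 0 x)) x := by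
  have hid : HasDerivAt (fun x : ℝ => (x : ℂ)) 1 x := by
    simpa using (hasDerivAt_id x).ofReal_comp
  refine (hid.mul (hasDerivAt_hankelH1_succ 0 hx.ne')).neg.congr_deriv ?_
  have hxc : (x : ℂ) ≠ 0 := by exact_mod_cast hx.ne'
  push_cast
  simp only [zero_add]
  field_simp
  ring

theorem exists_norm_hankelG_le (R : ℝ) : ∃ B, ∀ x, 0 < x → x ≤ R → ‖hankelG x‖ ≤ B := by
  obtain ⟨K, hK, h⟩ := exists_norm_mul_hankelH1_one_le
  refine ⟨K * (1 + R), fun x hx hxR => ?_⟩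
  rw [hankelG, norm_neg]
  exact (h x hx).trans (by gcongr)

theorem mul_abs_log_le {x : ℝ} (hx : 0 < x) : x * |Real.log x| ≤ 1 + x ^ 2 := by
  rcases le_total x 1 with h | h
  · exact (mul_abs_log_le_one hx h).trans (by nlinarith [sq_nonneg x])
  · rw [abs_of_nonneg (Real.log_nonneg h)]
    nlinarith [Real.log_le_self hx.le]

theorem exists_norm_sq_mul_hankelH1_le (R : ℝ) :
    ∃ B, ∀ x, 0 < x → x ≤ R → ‖-((x : ℂ) ^ 2 * hankelH1 0 x)‖ ≤ B := by
  obtain ⟨K, hK, h⟩ := exists_norm_hankelH1_zero_le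
  refine ⟨R * (K * (R + (1 + R ^ 2))), fun x hx hxR => ?_⟩
  rw [norm_neg, norm_mul, norm_pow, Complex.norm_real, Real.norm_eq_abs, abs_of_pos hx]
  have h0 : 0 ≤ R := hx.le.trans hxR
  calc x ^ 2 * ‖hankelH1 0 x‖ ≤ x ^ 2 * (K * (1 + |Real.log x|)) := by gcongr; exact h x hx
    _ = x * (K * (x + x * |Real.log x|)) := by ring
    _ ≤ R * (K * (R + (1 + R ^ 2))) := by
      gcongr
      exact (mul_abs_log_le hx).trans (by gcongr)

/-- The kernel is unbounded at both ends, but only logarithmically, and log sin is integrable. -/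
theorem intervalIntegrable_hankelH1_sin {k : ℝ} (hk : 0 < k) :
    IntervalIntegrable (fun u => hankelH1 0 (2 * k * Real.sin u)) volume 0 Real.pi := by
  obtain ⟨K, hK, h⟩ := exists_norm_hankelH1_zero_le
  have hb : IntervalIntegrable (fun u => K * (1 + |Real.log (2 * k)| + |Real.log (Real.sin u)|))
      volume 0 Real.pi := by
    refine IntervalIntegrable.const_mul (IntervalIntegrable.add intervalIntegrable_const ?_) _
    exact (intervalIntegrable_log_sin (a := 0) (b := Real.pi)).abs
  refine hb.mono_fun' ?_ ?_
  · exact ((measurable_hankelH1 0).comp (by fun_prop)).aestronglyMeasurable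
  · rw [Set.uIoc_of_le Real.pi_pos.le, ← restrict_Ioo_eq_restrict_Ioc]
    filter_upwards [ae_restrict_mem measurableSet_Ioo] with u hu
    have hs := Real.sin_pos_of_mem_Ioo hu
    refine (h _ (by positivity)).trans ?_
    rw [Real.log_mul (by positivity) hs.ne', add_assoc]
    gcongr
    exact abs_add_le _ _

theorem intervalIntegrable_of_bound_sin {g : ℝ → ℂ} (hgm : Measurable g)
    (hg : ∀ R : ℝ, ∃ B : ℝ, ∀ x, 0 < x → x ≤ R → ‖g x‖ ≤ B) {k : ℝ} (hk : 0 < k) :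
    IntervalIntegrable (fun u => g (2 * k * Real.sin u)) volume 0 Real.pi := by
  obtain ⟨B, hB⟩ := hg (2 * k)
  refine (intervalIntegrable_const (c := B)).mono_fun'
    (hgm.comp (by fun_prop)).aestronglyMeasurable ?_
  rw [Set.uIoc_of_le Real.pi_pos.le, ← restrict_Ioo_eq_restrict_Ioc]
  filter_upwards [ae_restrict_mem measurableSet_Ioo] with u hu
  have hs := Real.sin_pos_of_mem_Ioo hu
  exact hB _ (by positivity) (mul_le_of_le_one_right (by positivity) (Real.sin_le_one u))

theorem IntervalIntegrable.mul_cos {f : ℝ → ℂ} {a b : ℝ} (hf : IntervalIntegrable f volume a b)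
    (c : ℝ) : IntervalIntegrable (fun u => f u * (Real.cos (c * u) : ℂ)) volume a b :=
  hf.mul_continuousOn (by fun_prop)

/-- With g = x f', differentiating f(2k sin u) in k gives g(2k sin u)/k: the factor sin u cancels.
Hence a bound on g alone dominates the differentiated integrand. -/
theorem hasDerivAt_sineAvg {f g : ℝ → ℂ} (m : ℕ) (hf : ∀ x : ℝ, 0 < x → HasDerivAt f (g x / x) x)
    (hfm : Measurable f) (hgm : Measurable g)
    (hg : ∀ R : ℝ, ∃ B : ℝ, ∀ x, 0 < x → x ≤ R → ‖g x‖ ≤ B) {k : ℝ} (hk : 0 < k)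
    (hfi : IntervalIntegrable (fun u => f (2 * k * Real.sin u)) volume 0 Real.pi) :
    HasDerivAt (sineAvg f m) (sineAvg g m k / k) k := by
  -- For parameters in (k/2, 2k) the argument of g stays below 4k, and dividing by the parameter
  -- costs at most 2/k.
  obtain ⟨B, hB⟩ := hg (2 * (2 * k))
  have key := intervalIntegral.hasDerivAt_integral_of_dominated_loc_of_deriv_le (μ := volume)
    (a := 0) (b := Real.pi) (x₀ := k) (s := Set.Ioo (k / 2) (2 * k)) (bound := fun _ => 2 * B / k)
    (F := fun k u => f (2 * k * Real.sin u) * (Real.cos (2 * m * u) : ℂ))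
    (F' := fun k u => g (2 * k * Real.sin u) * (Real.cos (2 * m * u) : ℂ) / k)
    (Ioo_mem_nhds (by linarith) (by linarith))
    (Eventually.of_forall fun x => by
      refine Measurable.aestronglyMeasurable ?_
      have : Measurable fun u => f (2 * x * Real.sin u) := hfm.comp (by fun_prop)
      fun_prop)
    (hfi.mul_cos _)
    (by
      refine Measurable.aestronglyMeasurable ?_
      have : Measurable fun u => g (2 * k * Real.sin u) := hgm.comp (by fun_prop)
      fun_prop)
    (by
      rw [← ae_restrict_iff' measurableSet_uIoc, Set.uIoc_of_le Real.pi_pos.le,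
        ← restrict_Ioo_eq_restrict_Ioc]
      filter_upwards [ae_restrict_mem measurableSet_Ioo] with u hu x hx
      have hs := Real.sin_pos_of_mem_Ioo hu
      have hx0 : 0 < x := by linarith [hx.1]
      have h1 := hB (2 * x * Real.sin u) (by positivity) (by
        have := Real.sin_le_one u
        calc 2 * x * Real.sin u ≤ 2 * x * 1 := by gcongr
          _ ≤ _ := by linarith [hx.2])
      have hB0 : 0 ≤ B := (norm_nonneg _).trans h1
      rw [norm_div, norm_mul, Complex.norm_real, Complex.norm_real, Real.norm_eq_abs,
        Real.norm_eq_abs, abs_of_pos hx0, div_le_div_iff₀ hx0 hk]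
      calc ‖g (2 * x * Real.sin u)‖ * |Real.cos (2 * m * u)| * k ≤ B * 1 * k := by
            gcongr
            exact Real.abs_cos_le_one _
        _ ≤ 2 * B * x := by nlinarith [hx.1])
    intervalIntegrable_const
    (by
      rw [← ae_restrict_iff' measurableSet_uIoc, Set.uIoc_of_le Real.pi_pos.le,
        ← restrict_Ioo_eq_restrict_Ioc]
      filter_upwards [ae_restrict_mem measurableSet_Ioo] with u hu x hx
      have hs := Real.sin_pos_of_mem_Ioo hu
      have hx0 : 0 < x := by linarith [hx.1]
      have h1 : HasDerivAt (fun x : ℝ => 2 * x * Real.sin u) (2 * Real.sin u) x := by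
        simpa using ((hasDerivAt_id x).const_mul 2).mul_const (Real.sin u)
      refine (((hf _ (by positivity)).scomp x h1).mul_const _).congr_deriv ?_
      have hxc : (x : ℂ) ≠ 0 := by exact_mod_cast hx0.ne'
      have hsc : (Real.sin u : ℂ) ≠ 0 := by exact_mod_cast hs.ne'
      rw [Complex.real_smul]
      push_cast at hsc ⊢
      field_simp)
  refine (key.2.const_mul (1 / (Real.pi : ℂ))).congr_deriv ?_
  rw [sineAvg, intervalIntegral.integral_div]
  ring

theorem hasDerivAt_sineAvg_hankelH1 (m : ℕ) {k : ℝ} (hk : 0 < k) :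
    HasDerivAt (sineAvg (hankelH1 0) m) (sineAvg hankelG m k / k) k :=
  hasDerivAt_sineAvg m (fun _ hx => hasDerivAt_hankelH1_zero hx) (measurable_hankelH1 0)
    measurable_hankelG exists_norm_hankelG_le hk (intervalIntegrable_hankelH1_sin hk)

theorem intervalIntegrable_hankelG_sin {k : ℝ} (hk : 0 < k) :
    IntervalIntegrable (fun u => hankelG (2 * k * Real.sin u)) volume 0 Real.pi :=
  intervalIntegrable_of_bound_sin measurable_hankelG exists_norm_hankelG_le hk

/-- The function x G'(x) = -x² H_0(x), taken at x = 2k sin u, carries 4k² sin² u = 2k² (1 - cos 2u),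
which produces the averages of orders zero and one. -/
theorem hasDerivAt_sineAvg_hankelG {k : ℝ} (hk : 0 < k) :
    HasDerivAt (sineAvg hankelG 0)
      (-2 * k * (sineAvg (hankelH1 0) 0 k - sineAvg (hankelH1 0) 1 k)) k := by
  have hm := measurable_hankelH1 0
  refine (hasDerivAt_sineAvg (g := fun x => -((x : ℂ) ^ 2 * hankelH1 0 x)) 0 (fun x hx => ?_)
    measurable_hankelG (by fun_prop) exists_norm_sq_mul_hankelH1_le hk
    (intervalIntegrable_hankelG_sin hk)).congr_deriv ?_
  · refine (hasDerivAt_hankelG hx).congr_deriv ?_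
    have hxc : (x : ℂ) ≠ 0 := by exact_mod_cast hx.ne'
    field_simp
  · have hi := intervalIntegrable_hankelH1_sin hk
    have hkc : (k : ℂ) ≠ 0 := by exact_mod_cast hk.ne'
    have e : ∫ u in (0 : ℝ)..Real.pi, -(((2 * k * Real.sin u : ℝ) : ℂ) ^ 2 *
          hankelH1 0 (2 * k * Real.sin u)) * (Real.cos (2 * (0 : ℕ) * u) : ℂ)
        = -2 * k ^ 2 * ((∫ u in (0 : ℝ)..Real.pi, hankelH1 0 (2 * k * Real.sin u) *
            (Real.cos (2 * (0 : ℕ) * u) : ℂ))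
          - ∫ u in (0 : ℝ)..Real.pi, hankelH1 0 (2 * k * Real.sin u) *
            (Real.cos (2 * (1 : ℕ) * u) : ℂ)) := by
      rw [← intervalIntegral.integral_sub (hi.mul_cos _) (hi.mul_cos _),
        ← intervalIntegral.integral_const_mul]
      refine intervalIntegral.integral_congr fun u _ => ?_
      have h1 : ((Real.cos (2 * (1 : ℕ) * u) : ℝ) : ℂ) = 1 - 2 * (Real.sin u : ℂ) ^ 2 := by
        rw [Nat.cast_one, mul_one, Real.cos_two_mul, Real.cos_sq']; push_cast; ring
      have h0 : ((Real.cos (2 * (0 : ℕ) * u) : ℝ) : ℂ) = 1 := by simp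
      simp only [h1, h0]
      push_cast
      ring
    simp only [sineAvg]
    rw [e]
    field_simp

theorem tendsto_sin_zero_pos {k : ℝ} (hk : 0 < k) :
    Tendsto (fun u => 2 * k * Real.sin u) (𝓝[>] 0) (𝓝[>] 0) := by
  refine tendsto_nhdsWithin_iff.mpr ⟨?_, ?_⟩
  · have : Tendsto (fun u => 2 * k * Real.sin u) (𝓝 0) (𝓝 (2 * k * Real.sin 0)) :=
      (Real.continuous_sin.const_mul _).tendsto 0
    rw [Real.sin_zero, mul_zero] at this
    exact this.mono_left nhdsWithin_le_nhds
  · filter_upwards [Ioo_mem_nhdsGT Real.pi_pos] with u hu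
    exact mul_pos (by positivity) (Real.sin_pos_of_mem_Ioo hu)

theorem tendsto_sin_pi_pos {k : ℝ} (hk : 0 < k) :
    Tendsto (fun u => 2 * k * Real.sin u) (𝓝[<] Real.pi) (𝓝[>] 0) := by
  refine tendsto_nhdsWithin_iff.mpr ⟨?_, ?_⟩
  · have : Tendsto (fun u => 2 * k * Real.sin u) (𝓝 Real.pi) (𝓝 (2 * k * Real.sin Real.pi)) :=
      (Real.continuous_sin.const_mul _).tendsto Real.pi
    rw [Real.sin_pi, mul_zero] at this
    exact this.mono_left nhdsWithin_le_nhds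
  · filter_upwards [Ioo_mem_nhdsLT Real.pi_pos] with u hu
    exact mul_pos (by positivity) (Real.sin_pos_of_mem_Ioo hu)

theorem tendsto_of_norm_sub_le {f : ℝ → ℂ} {c : ℂ} {K : ℝ}
    (h : ∀ x : ℝ, 0 < x → x ≤ 1 → ‖f x - c‖ ≤ K * x) : Tendsto f (𝓝[>] 0) (𝓝 c) := by
  rw [tendsto_iff_norm_sub_tendsto_zero]
  exact tendsto_of_abs_sub_le (K := K) fun x hx hx1 => by simpa using h x hx hx1

theorem tendsto_hankelG : Tendsto hankelG (𝓝[>] 0) (𝓝 (2 / Real.pi * Complex.I)) := by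
  obtain ⟨K, hK, h⟩ := exists_norm_mul_hankelH1_one_add_le
  refine tendsto_of_norm_sub_le (K := K) fun x hx hx1 => ?_
  rw [hankelG, ← neg_add', norm_neg]
  exact h x hx hx1

theorem tendsto_mul_hankelH1_zero :
    Tendsto (fun x : ℝ => (x : ℂ) * hankelH1 0 x) (𝓝[>] 0) (𝓝 0) := by
  obtain ⟨K, hK, h⟩ := exists_norm_hankelH1_zero_le
  rw [tendsto_zero_iff_norm_tendsto_zero]
  have h0 : Tendsto (fun x : ℝ => K * (x + |x * Real.log x|)) (𝓝[>] 0) (𝓝 0) := by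
    have : Tendsto (fun x : ℝ => K * (x + |x * Real.log x|)) (𝓝 0)
        (𝓝 (K * (0 + |0 * Real.log 0|))) := by
      have := Real.continuous_mul_log
      exact (by fun_prop : Continuous fun x : ℝ => K * (x + |x * Real.log x|)).tendsto 0
    simp only [zero_mul, abs_zero, add_zero, mul_zero] at this
    exact this.mono_left nhdsWithin_le_nhds
  refine squeeze_zero' (Eventually.of_forall fun _ => norm_nonneg _) ?_ h0
  filter_upwards [self_mem_nhdsWithin] with x hx
  have hx : 0 < x := hx
  rw [norm_mul, Complex.norm_real, Real.norm_eq_abs, abs_mul, abs_of_pos hx]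
  calc x * ‖hankelH1 0 x‖ ≤ x * (K * (1 + |Real.log x|)) := by gcongr; exact h x hx
    _ = _ := by ring

theorem hasDerivAt_two_mul_sin (k u : ℝ) :
    HasDerivAt (fun u => 2 * k * Real.sin u) (2 * k * Real.cos u) u :=
  (Real.hasDerivAt_sin u).const_mul _

/-- Integrate the derivative of H_0(2k sin u) sin 2u over (0, π). The boundary terms vanish because
sin 2u contains 2k sin u, and x H_0(x) → 0. -/
theorem sineAvg_hankelG_add {k : ℝ} (hk : 0 < k) :
    sineAvg hankelG 0 k + sineAvg hankelG 1 k + 2 * sineAvg (hankelH1 0) 1 k = 0 := by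
  have hG := intervalIntegrable_hankelG_sin hk
  have hF := intervalIntegrable_hankelH1_sin hk
  have hkc : (k : ℂ) ≠ 0 := by exact_mod_cast hk.ne'
  have key := intervalIntegral.integral_eq_sub_of_hasDerivAt_of_tendsto Real.pi_pos
    (f := fun u => hankelH1 0 (2 * k * Real.sin u) * (Real.sin (2 * u) : ℂ))
    (f' := fun u => hankelG (2 * k * Real.sin u) * (Real.cos (2 * (0 : ℕ) * u) : ℂ)
      + hankelG (2 * k * Real.sin u) * (Real.cos (2 * (1 : ℕ) * u) : ℂ)
      + 2 * (hankelH1 0 (2 * k * Real.sin u) * (Real.cos (2 * (1 : ℕ) * u) : ℂ)))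
    (fa := 0 * (Real.cos 0 / k)) (fb := 0 * (Real.cos Real.pi / k))
    (fun u hu => by
      have hs := Real.sin_pos_of_mem_Ioo hu
      have h2 : HasDerivAt (fun u : ℝ => Real.sin (2 * u)) (2 * Real.cos (2 * u)) u := by
        simpa [mul_comm] using ((hasDerivAt_id u).const_mul 2).sin
      refine (((hasDerivAt_hankelH1_zero (by positivity)).scomp u
        (hasDerivAt_two_mul_sin k u)).mul h2.ofReal_comp).congr_deriv ?_
      have h1 : ((Real.cos (2 * (1 : ℕ) * u) : ℝ) : ℂ) = 2 * (Real.cos u : ℂ) ^ 2 - 1 := by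
        rw [Nat.cast_one, mul_one, Real.cos_two_mul]; push_cast; ring
      have h0 : ((Real.cos (2 * (0 : ℕ) * u) : ℝ) : ℂ) = 1 := by simp
      have h3 : ((Real.cos (2 * u) : ℝ) : ℂ) = 2 * (Real.cos u : ℂ) ^ 2 - 1 := by
        rw [Real.cos_two_mul]; push_cast; ring
      have hsc : (Real.sin u : ℂ) ≠ 0 := by exact_mod_cast hs.ne'
      simp only [h1, h0, Complex.real_smul, Function.comp_apply]
      rw [Real.sin_two_mul, Complex.ofReal_mul 2 (Real.cos (2 * u)), h3]
      simp only [Complex.ofReal_mul, Complex.ofReal_ofNat]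
      field_simp
      ring)
    (((hG.mul_cos _).add (hG.mul_cos _)).add ((hF.mul_cos _).const_mul 2))
    (by
      refine ((tendsto_mul_hankelH1_zero.comp (tendsto_sin_zero_pos hk)).mul
        (((Complex.continuous_ofReal.comp Real.continuous_cos).div_const (k : ℂ)).tendsto 0
          |>.mono_left nhdsWithin_le_nhds)).congr fun u => ?_
      simp only [Function.comp_apply, Real.sin_two_mul]
      push_cast
      field_simp)
    (by
      refine ((tendsto_mul_hankelH1_zero.comp (tendsto_sin_pi_pos hk)).mul
        (((Complex.continuous_ofReal.comp Real.continuous_cos).div_const (k : ℂ)).tendsto Real.pi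
          |>.mono_left nhdsWithin_le_nhds)).congr fun u => ?_
      simp only [Function.comp_apply, Real.sin_two_mul]
      push_cast
      field_simp)
  rw [intervalIntegral.integral_add ((hG.mul_cos _).add (hG.mul_cos _))
    ((hF.mul_cos _).const_mul 2), intervalIntegral.integral_add (hG.mul_cos _) (hG.mul_cos _),
    intervalIntegral.integral_const_mul] at key
  simp only [sineAvg]
  linear_combination 1 / (Real.pi : ℂ) * key

/-- Integrate the derivative of G(2k sin u) sin(2(n+1)u). By Bessel's equation, differentiating G
brings sin u cos u sin(2(n+1)u), a difference of the cosines of frequencies 2n and 2(n+2). At the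
ends G has a finite limit and the sine vanishes. -/
theorem sineAvg_hankelH1_sub (n : ℕ) {k : ℝ} (hk : 0 < k) :
    (k : ℂ) ^ 2 * (sineAvg (hankelH1 0) n k - sineAvg (hankelH1 0) (n + 2) k)
      = 2 * (n + 1) * sineAvg hankelG (n + 1) k := by
  have hG := intervalIntegrable_hankelG_sin hk
  have hF := intervalIntegrable_hankelH1_sin hk
  have hkc : (k : ℂ) ≠ 0 := by exact_mod_cast hk.ne'
  have key := intervalIntegral.integral_eq_sub_of_hasDerivAt_of_tendsto Real.pi_pos
    (f := fun u => hankelG (2 * k * Real.sin u) * (Real.sin (2 * (n + 1 : ℕ) * u) : ℂ))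
    (f' := fun u => 2 * (n + 1) * (hankelG (2 * k * Real.sin u)
        * (Real.cos (2 * (n + 1 : ℕ) * u) : ℂ))
      - (k : ℂ) ^ 2 * (hankelH1 0 (2 * k * Real.sin u) * (Real.cos (2 * n * u) : ℂ)
        - hankelH1 0 (2 * k * Real.sin u) * (Real.cos (2 * (n + 2 : ℕ) * u) : ℂ)))
    (fa := 2 / Real.pi * Complex.I * (Real.sin (2 * (n + 1 : ℕ) * 0) : ℂ))
    (fb := 2 / Real.pi * Complex.I * (Real.sin (2 * (n + 1 : ℕ) * Real.pi) : ℂ))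
    (fun u hu => by
      have hs := Real.sin_pos_of_mem_Ioo hu
      have h2 : HasDerivAt (fun u : ℝ => Real.sin (2 * (n + 1 : ℕ) * u))
          (2 * (n + 1) * Real.cos (2 * (n + 1 : ℕ) * u)) u := by
        simpa [mul_comm] using ((hasDerivAt_id u).const_mul (2 * ((n + 1 : ℕ) : ℝ))).sin
      refine (((hasDerivAt_hankelG (by positivity)).scomp u
        (hasDerivAt_two_mul_sin k u)).mul h2.ofReal_comp).congr_deriv ?_
      have e1 : Real.cos (2 * n * u) - Real.cos (2 * (n + 2 : ℕ) * u)
          = 4 * Real.sin (2 * (n + 1 : ℕ) * u) * (Real.sin u * Real.cos u) := by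
        have := Real.sin_two_mul u
        rw [Real.cos_sub_cos, show (2 * n * u - 2 * (n + 2 : ℕ) * u) / 2 = -(2 * u) by
          push_cast; ring, show (2 * n * u + 2 * (n + 2 : ℕ) * u) / 2 = 2 * (n + 1 : ℕ) * u by
          push_cast; ring, Real.sin_neg, this]
        ring
      have e2 := congrArg (fun r : ℝ => (r : ℂ)) e1
      simp only [Complex.ofReal_sub, Complex.ofReal_mul, Complex.ofReal_ofNat] at e2
      simp only [Complex.real_smul, Function.comp_apply]
      rw [← mul_sub, e2]
      simp only [Complex.ofReal_mul, Complex.ofReal_ofNat, Complex.ofReal_add, Complex.ofReal_one,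
        Complex.ofReal_natCast]
      ring)
    (((hG.mul_cos _).const_mul _).sub (((hF.mul_cos _).sub (hF.mul_cos _)).const_mul _))
    (by
      refine (tendsto_hankelG.comp (tendsto_sin_zero_pos hk)).mul ?_
      exact ((by fun_prop : Continuous fun u : ℝ => (Real.sin (2 * (n + 1 : ℕ) * u) : ℂ)).tendsto 0
          |>.mono_left nhdsWithin_le_nhds))
    (by
      refine (tendsto_hankelG.comp (tendsto_sin_pi_pos hk)).mul ?_
      exact ((by fun_prop : Continuous fun u : ℝ =>
        (Real.sin (2 * (n + 1 : ℕ) * u) : ℂ)).tendsto Real.pi |>.mono_left nhdsWithin_le_nhds))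
  have hs : Real.sin (2 * (n + 1 : ℕ) * Real.pi) = 0 := by
    have := Real.sin_nat_mul_pi (2 * (n + 1))
    push_cast at this ⊢
    exact this
  rw [intervalIntegral.integral_sub ((hG.mul_cos _).const_mul _)
    (((hF.mul_cos _).sub (hF.mul_cos _)).const_mul _), intervalIntegral.integral_const_mul,
    intervalIntegral.integral_const_mul, intervalIntegral.integral_sub (hF.mul_cos _) (hF.mul_cos _),
    hs, mul_zero, Real.sin_zero] at key
  simp only [sineAvg]
  linear_combination -(1 / (Real.pi : ℂ)) * key

theorem norm_integral_zero_pi_le {f : ℝ → ℂ} {b : ℝ → ℝ}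
    (h : ∀ u ∈ Set.Ioo 0 Real.pi, ‖f u‖ ≤ b u) (hb : IntervalIntegrable b volume 0 Real.pi) :
    ‖∫ u in (0 : ℝ)..Real.pi, f u‖ ≤ ∫ u in (0 : ℝ)..Real.pi, b u := by
  refine intervalIntegral.norm_integral_le_of_norm_le Real.pi_pos.le ?_ hb
  rw [← ae_restrict_iff' measurableSet_Ioc, ← restrict_Ioo_eq_restrict_Ioc]
  filter_upwards [ae_restrict_mem measurableSet_Ioo] with u hu using h u hu

/-- Uniformity in m costs nothing, since |cos| ≤ 1. Besides bounding the order-one average near k =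
0, this later yields the a priori bound on J_n H_n for large n. -/
theorem exists_norm_sineAvg_hankelH1_le : ∃ K : ℝ, 0 < K ∧ ∀ (m : ℕ) (k : ℝ), 0 < k →
    ‖sineAvg (hankelH1 0) m k‖ ≤ K * (1 + |Real.log k|) := by
  obtain ⟨K, hK, h⟩ := exists_norm_hankelH1_zero_le
  have hp := Real.pi_pos
  have hls : IntervalIntegrable (fun u => |Real.log (Real.sin u)|) volume 0 Real.pi :=
    (intervalIntegrable_log_sin (a := 0) (b := Real.pi)).abs
  set S := ∫ u in (0 : ℝ)..Real.pi, |Real.log (Real.sin u)|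
  have hS : 0 ≤ S := intervalIntegral.integral_nonneg hp.le fun u _ => abs_nonneg _
  have hl2 : 0 ≤ |Real.log 2| := abs_nonneg _
  refine ⟨K * (1 + |Real.log 2| + 1 / Real.pi * S), by positivity, fun m k hk => ?_⟩
  have hb : IntervalIntegrable
      (fun u => K * ((1 + |Real.log 2| + |Real.log k|) + |Real.log (Real.sin u)|))
      volume 0 Real.pi :=
    IntervalIntegrable.const_mul (IntervalIntegrable.add intervalIntegrable_const hls) _
  have h1 := norm_integral_zero_pi_le (f := fun u => hankelH1 0 (2 * k * Real.sin u) *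
    (Real.cos (2 * m * u) : ℂ)) (fun u hu => by
      have hs := Real.sin_pos_of_mem_Ioo hu
      rw [norm_mul, Complex.norm_real, Real.norm_eq_abs]
      calc ‖hankelH1 0 (2 * k * Real.sin u)‖ * |Real.cos (2 * m * u)|
          ≤ (K * (1 + |Real.log (2 * k * Real.sin u)|)) * 1 := by
            gcongr
            · exact h _ (by positivity)
            · exact Real.abs_cos_le_one _
        _ ≤ _ := by
            rw [mul_one, Real.log_mul (by positivity) hs.ne', Real.log_mul two_ne_zero hk.ne']
            refine mul_le_mul_of_nonneg_left ?_ hK.le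
            linarith [abs_add_le (Real.log 2) (Real.log k),
              abs_add_le (Real.log 2 + Real.log k) (Real.log (Real.sin u))]) hb
  rw [intervalIntegral.integral_const_mul, intervalIntegral.integral_add intervalIntegrable_const hls,
    intervalIntegral.integral_const, sub_zero, smul_eq_mul] at h1
  rw [sineAvg, norm_mul, norm_div, norm_one, Complex.norm_real, Real.norm_eq_abs, abs_of_pos hp]
  have hl : 0 ≤ |Real.log k| := abs_nonneg _
  calc _ ≤ 1 / Real.pi * (K * (Real.pi * (1 + |Real.log 2| + |Real.log k|) + S)) := by gcongr
    _ = K * (1 + |Real.log 2| + |Real.log k| + 1 / Real.pi * S) := by field_simp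
    _ ≤ K * (1 + |Real.log 2| + |Real.log k| + 1 / Real.pi * S)
        + K * (|Real.log 2| + 1 / Real.pi * S) * |Real.log k| := by
      have : 0 ≤ K * (|Real.log 2| + 1 / Real.pi * S) * |Real.log k| := by positivity
      linarith
    _ = _ := by ring

theorem sineAvg_zero_eq (f : ℝ → ℂ) (k : ℝ) :
    sineAvg f 0 k = 1 / (Real.pi : ℂ) * ∫ u in (0 : ℝ)..Real.pi, f (2 * k * Real.sin u) := by
  simp [sineAvg]

/-- If `f(ρ) = a log ρ + b + O(ρ)` near `0`, the average of `f(2k sin u)` is `a log k + b + O(k)`. -/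
theorem norm_sineAvg_zero_sub_le {f : ℝ → ℂ} {a b : ℂ} {K : ℝ}
    (h : ∀ x : ℝ, 0 < x → x ≤ 1 → ‖f x - (a * Real.log x + b)‖ ≤ K * x) {k : ℝ} (hk : 0 < k)
    (hk1 : k ≤ 1 / 2) (hf : IntervalIntegrable (fun u => f (2 * k * Real.sin u)) volume 0 Real.pi) :
    ‖sineAvg f 0 k - (a * Real.log k + b)‖ ≤ 2 * K * k := by
  have hp := Real.pi_pos
  have hpc : (Real.pi : ℂ) ≠ 0 := by exact_mod_cast hp.ne'
  have hls : IntervalIntegrable (fun u => (Real.log (Real.sin u) : ℂ)) volume 0 Real.pi := by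
    have := (intervalIntegrable_log_sin (a := 0) (b := Real.pi))
    rw [intervalIntegrable_iff] at this ⊢
    exact this.ofReal
  have hK : 0 ≤ K := by
    have := (norm_nonneg _).trans (h 1 one_pos le_rfl)
    linarith
  have h1 := norm_integral_zero_pi_le
    (f := fun u => f (2 * k * Real.sin u)
      - (a * (Real.log (Real.sin u) : ℂ) + (a * Real.log (2 * k) + b)))
    (b := fun _ => K * (2 * k)) (fun u hu => by
      have hs := Real.sin_pos_of_mem_Ioo hu
      have hs1 := Real.sin_le_one u
      have h2 := h (2 * k * Real.sin u) (by positivity) (by nlinarith)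
      rw [Real.log_mul (by positivity) hs.ne'] at h2
      calc _ = ‖f (2 * k * Real.sin u)
            - (a * ((Real.log (2 * k) + Real.log (Real.sin u) : ℝ) : ℂ) + b)‖ := by
            congr 1; push_cast; ring
        _ ≤ _ := h2
        _ ≤ _ := mul_le_mul_of_nonneg_left (mul_le_of_le_one_right (by positivity) hs1) hK)
    intervalIntegrable_const
  -- The mean of log sin u over (0, π) is -log 2, which cancels the log 2 in log(2k sin u); hence
  -- the constant b is unchanged by averaging.
  rw [intervalIntegral.integral_sub hf ((hls.const_mul _).add intervalIntegrable_const),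
    intervalIntegral.integral_add (hls.const_mul _) intervalIntegrable_const,
    intervalIntegral.integral_const_mul, intervalIntegral.integral_ofReal, integral_log_sin_zero_pi,
    intervalIntegral.integral_const, intervalIntegral.integral_const, sub_zero, smul_eq_mul,
    Real.log_mul two_ne_zero hk.ne'] at h1
  have e : sineAvg f 0 k - (a * Real.log k + b) = 1 / (Real.pi : ℂ) *
      ((∫ u in (0 : ℝ)..Real.pi, f (2 * k * Real.sin u)) - (a * ((-Real.log 2 * Real.pi : ℝ) : ℂ)
        + Real.pi • (a * ((Real.log 2 + Real.log k : ℝ) : ℂ) + b))) := by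
    rw [sineAvg_zero_eq, Complex.real_smul]
    push_cast
    field_simp
    ring
  rw [e, norm_mul, norm_div, norm_one, Complex.norm_real, Real.norm_eq_abs, abs_of_pos hp]
  calc _ ≤ 1 / Real.pi * (Real.pi * (K * (2 * k))) := by gcongr
    _ = _ := by field_simp

/-! ### The Fourier coefficients of the kernel as products of Bessel functions. -/

theorem hasDerivAt_bessel_zero_mul {x : ℝ} (hx : 0 < x) :
    HasDerivAt (fun x => (besselJ 0 x : ℂ) * hankelH1 0 x)
      (-(x * (besselJ 1 x * hankelH1 0 x + besselJ 0 x * hankelH1 1 x)) / x) x := by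
  have hxc : (x : ℂ) ≠ 0 := by exact_mod_cast hx.ne'
  refine ((hasDerivAt_besselJ 0 hx.ne').ofReal_comp.mul
    (hasDerivAt_hankelH1 0 hx.ne')).congr_deriv ?_
  push_cast
  simp only [zero_div, zero_mul, zero_sub]
  field_simp
  ring

theorem hasDerivAt_bessel_mul_cross {x : ℝ} (hx : 0 < x) :
    HasDerivAt (fun x : ℝ => -((x : ℂ) * (besselJ 1 x * hankelH1 0 x + besselJ 0 x * hankelH1 1 x)))
      (-2 * x * (besselJ 0 x * hankelH1 0 x - besselJ 1 x * hankelH1 1 x)) x := by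
  have hxc : (x : ℂ) ≠ 0 := by exact_mod_cast hx.ne'
  have hid : HasDerivAt (fun x : ℝ => (x : ℂ)) 1 x := by
    simpa using (hasDerivAt_id x).ofReal_comp
  refine (hid.mul (((hasDerivAt_besselJ_succ 0 hx.ne').ofReal_comp.mul
    (hasDerivAt_hankelH1 0 hx.ne')).add ((hasDerivAt_besselJ 0 hx.ne').ofReal_comp.mul
    (hasDerivAt_hankelH1_succ 0 hx.ne')))).neg.congr_deriv ?_
  simp only [Pi.add_apply, Pi.mul_apply]
  push_cast
  simp only [zero_div, zero_mul, zero_sub, zero_add]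
  field_simp
  ring

theorem hasDerivAt_bessel_one_mul {x : ℝ} (hx : 0 < x) :
    HasDerivAt (fun x : ℝ => (besselJ 1 x : ℂ) * hankelH1 1 x)
      ((-2 * (besselJ 1 x * hankelH1 1 x)
        - -(x * (besselJ 1 x * hankelH1 0 x + besselJ 0 x * hankelH1 1 x))) / x) x := by
  have hxc : (x : ℂ) ≠ 0 := by exact_mod_cast hx.ne'
  refine ((hasDerivAt_besselJ_succ 0 hx.ne').ofReal_comp.mul
    (hasDerivAt_hankelH1_succ 0 hx.ne')).congr_deriv ?_
  push_cast
  simp only [zero_add]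
  field_simp
  ring

/-- The averages and the products solve the same system, and near k = 0 the two candidates for D
share the expansion (2i/π) log k + b, while those for A share the limit 2i/π. The differences thus
meet the smallness hypotheses of `eq_zero_of_product_system`. -/
theorem sineAvg_hankelH1_zero_one {k : ℝ} (hk : 0 < k) :
    sineAvg (hankelH1 0) 0 k = besselJ 0 k * hankelH1 0 k ∧
    sineAvg (hankelH1 0) 1 k = besselJ 1 k * hankelH1 1 k := by
  obtain ⟨b, K₀, hK₀, h₀⟩ := exists_norm_hankelH1_zero_sub_le
  obtain ⟨K₁, hK₁, h₁⟩ := exists_norm_mul_hankelH1_one_add_le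
  obtain ⟨K₂, hK₂, h₂⟩ := exists_norm_hankelH1_zero_le
  obtain ⟨K₃, hK₃, h₃⟩ := exists_norm_mul_hankelH1_one_le
  obtain ⟨K₄, hK₄, h₄⟩ := exists_norm_sineAvg_hankelH1_le
  obtain ⟨K₅, hK₅, h₅⟩ := exists_abs_besselJ_zero_sub_le
  obtain ⟨K₆, hK₆, h₆⟩ := exists_abs_besselJ_one_le
  set α : ℂ := 2 / Real.pi * Complex.I
  have hlog : ∀ x : ℝ, 0 < x → x ≤ 1 / 2 → x * (1 + |Real.log x|) ≤ 2 := fun x hx hx1 => by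
    have := mul_abs_log_le_one hx (by linarith)
    linarith
  have nJ0 : ∀ x : ℝ, 0 < x → x ≤ 1 → ‖((besselJ 0 x : ℂ) - 1)‖ ≤ K₅ * x ^ 2 := fun x hx hx1 => by
    have := h₅ x hx hx1
    rwa [← Real.norm_eq_abs, ← Complex.norm_real, Complex.ofReal_sub, Complex.ofReal_one] at this
  have nJ1 : ∀ x : ℝ, 0 < x → x ≤ 1 → ‖(besselJ 1 x : ℂ)‖ ≤ K₆ * x := fun x hx hx1 => by
    have := h₆ x hx hx1
    rwa [← Real.norm_eq_abs, ← Complex.norm_real] at this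
  -- The sum of all constants in the bounds on D, A and B; each bound drops the terms that it does
  -- not need.
  set K := 2 * K₀ + 2 * K₁ + K₀ + K₁ + 2 * K₅ * K₂ + 2 * K₅ * K₃ + 2 * K₆ * K₂ + K₄ + 2 * K₆ * K₃
  have key := eq_zero_of_product_system
    (D := fun x => sineAvg (hankelH1 0) 0 x - besselJ 0 x * hankelH1 0 x)
    (A := fun x => sineAvg hankelG 0 x
      - -((x : ℂ) * (besselJ 1 x * hankelH1 0 x + besselJ 0 x * hankelH1 1 x)))
    (B := fun x => sineAvg (hankelH1 0) 1 x - besselJ 1 x * hankelH1 1 x)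
    (K := K)
    (fun x hx => by
      refine ((hasDerivAt_sineAvg_hankelH1 0 hx).sub (hasDerivAt_bessel_zero_mul hx)).congr_deriv ?_
      ring)
    (fun x hx => by
      refine ((hasDerivAt_sineAvg_hankelG hx).sub (hasDerivAt_bessel_mul_cross hx)).congr_deriv ?_
      ring)
    (fun x hx => by
      refine ((hasDerivAt_sineAvg_hankelH1 1 hx).sub (hasDerivAt_bessel_one_mul hx)).congr_deriv ?_
      have hxc : (x : ℂ) ≠ 0 := by exact_mod_cast hx.ne'
      field_simp
      linear_combination sineAvg_hankelG_add hx)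
    (fun x hx hx1 => by
      have e1 := norm_sineAvg_zero_sub_le h₀ hx hx1 (intervalIntegrable_hankelH1_sin hx)
      have e2 := h₀ x hx (by linarith)
      have e3 : ‖((besselJ 0 x : ℂ) - 1) * hankelH1 0 x‖ ≤ 2 * K₅ * K₂ * x := by
        rw [norm_mul]
        calc _ ≤ (K₅ * x ^ 2) * (K₂ * (1 + |Real.log x|)) := by
              gcongr
              · exact nJ0 x hx (by linarith)
              · exact h₂ x hx
          _ = K₅ * K₂ * x * (x * (1 + |Real.log x|)) := by ring
          _ ≤ K₅ * K₂ * x * 2 := by gcongr; exact hlog x hx hx1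
          _ = _ := by ring
      have e4 : sineAvg (hankelH1 0) 0 x - besselJ 0 x * hankelH1 0 x
          = (sineAvg (hankelH1 0) 0 x - (α * Real.log x + b))
            - (hankelH1 0 x - (α * Real.log x + b)) - ((besselJ 0 x : ℂ) - 1) * hankelH1 0 x := by
        ring
      rw [e4]
      refine (norm_sub_le _ _).trans ?_
      have e5 := norm_sub_le (sineAvg (hankelH1 0) 0 x - (α * Real.log x + b))
        (hankelH1 0 x - (α * Real.log x + b))
      have e6 : 0 ≤ (2 * K₁ + K₁ + 2 * K₅ * K₃ + 2 * K₆ * K₂ + K₄ + 2 * K₆ * K₃) * x := by positivity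
      simp only [K]
      linarith)
    (fun x hx hx1 => by
      have hG : ∀ x : ℝ, 0 < x → x ≤ 1 → ‖hankelG x - (0 * Real.log x + α)‖ ≤ K₁ * x :=
        fun x hx hx1 => by
          rw [zero_mul, zero_add, hankelG, ← neg_add', norm_neg]
          exact h₁ x hx hx1
      have e1 := norm_sineAvg_zero_sub_le hG hx hx1 (intervalIntegrable_hankelG_sin hx)
      rw [zero_mul, zero_add] at e1
      have e2 := h₁ x hx (by linarith)
      have e3 : ‖((besselJ 0 x : ℂ) - 1) * (x * hankelH1 1 x)‖ ≤ 2 * K₅ * K₃ * x := by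
        rw [norm_mul]
        calc _ ≤ (K₅ * x ^ 2) * (K₃ * (1 + x)) := by
              gcongr
              · exact nJ0 x hx (by linarith)
              · exact h₃ x hx
          _ = K₅ * K₃ * x * (x * (1 + x)) := by ring
          _ ≤ K₅ * K₃ * x * 2 := by gcongr; nlinarith
          _ = _ := by ring
      have e4 : ‖(x : ℂ) * (besselJ 1 x * hankelH1 0 x)‖ ≤ 2 * K₆ * K₂ * x := by
        rw [norm_mul, norm_mul, Complex.norm_real, Real.norm_eq_abs, abs_of_pos hx]
        calc _ ≤ x * ((K₆ * x) * (K₂ * (1 + |Real.log x|))) := by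
              gcongr
              · exact nJ1 x hx (by linarith)
              · exact h₂ x hx
          _ = K₆ * K₂ * x * (x * (1 + |Real.log x|)) := by ring
          _ ≤ K₆ * K₂ * x * 2 := by gcongr; exact hlog x hx hx1
          _ = _ := by ring
      have e5 : sineAvg hankelG 0 x
          - -((x : ℂ) * (besselJ 1 x * hankelH1 0 x + besselJ 0 x * hankelH1 1 x))
          = (sineAvg hankelG 0 x - α) + (x * hankelH1 1 x + α)
            + ((besselJ 0 x : ℂ) - 1) * (x * hankelH1 1 x)
            + (x : ℂ) * (besselJ 1 x * hankelH1 0 x) := by ring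
      rw [e5]
      refine (norm_add_le _ _).trans ?_
      have e6 := norm_add₃_le (a := sineAvg hankelG 0 x - α) (b := x * hankelH1 1 x + α)
        (c := ((besselJ 0 x : ℂ) - 1) * (x * hankelH1 1 x))
      have e7 : 0 ≤ (2 * K₀ + K₀ + 2 * K₅ * K₂ + K₄ + 2 * K₆ * K₃) * x := by positivity
      simp only [K]
      linarith)
    (fun x hx hx1 => by
      have e1 := h₄ 1 x hx
      have e2 : ‖(besselJ 1 x : ℂ) * hankelH1 1 x‖ ≤ 2 * K₆ * K₃ := by
        have e3 := h₃ x hx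
        rw [norm_mul, Complex.norm_real, Real.norm_eq_abs, abs_of_pos hx] at e3
        rw [norm_mul]
        calc _ ≤ (K₆ * x) * ‖hankelH1 1 x‖ := by gcongr; exact nJ1 x hx (by linarith)
          _ = K₆ * (x * ‖hankelH1 1 x‖) := by ring
          _ ≤ K₆ * (K₃ * 2) := by
            refine mul_le_mul_of_nonneg_left (e3.trans ?_) hK₆.le
            exact mul_le_mul_of_nonneg_left (by linarith) hK₃.le
          _ = _ := by ring
      refine (norm_sub_le _ _).trans ?_
      have hl := abs_nonneg (Real.log x)
      have e7 : 0 ≤ (2 * K₀ + 2 * K₁ + K₀ + K₁ + 2 * K₅ * K₂ + 2 * K₅ * K₃ + 2 * K₆ * K₂)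
        * (1 + |Real.log x|) := by positivity
      have e8 : 0 ≤ 2 * K₆ * K₃ * |Real.log x| := by positivity
      simp only [K]
      linarith)
    hk
  exact ⟨sub_eq_zero.mp key.1, sub_eq_zero.mp key.2⟩

/-- The Fourier coefficients of `θ ↦ H_0(2k sin(θ/2))` are the products `J_m(k) H_m(k)`. -/
theorem sineAvg_hankelH1_eq (n : ℕ) : ∀ k : ℝ, 0 < k →
    sineAvg (hankelH1 0) n k = besselJ n k * hankelH1 n k := by
  induction n using Nat.twoStepInduction with
  | zero => exact fun k hk => (sineAvg_hankelH1_zero_one hk).1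
  | one => exact fun k hk => (sineAvg_hankelH1_zero_one hk).2
  | more n ih0 ih1 =>
    intro k hk
    have hkc : (k : ℂ) ≠ 0 := by exact_mod_cast hk.ne'
    -- Differentiating the known identity of order n+1 evaluates the average of G at that order; the
    -- recurrence `h2` then determines order n+2.
    have h1 := (hasDerivAt_sineAvg_hankelH1 (n + 1) hk).unique
      (((hasDerivAt_besselJ_succ n hk.ne').ofReal_comp.mul
        (hasDerivAt_hankelH1_succ n hk.ne')).congr_of_eventuallyEq (by
          filter_upwards [lt_mem_nhds hk] with y hy using ih1 y hy))
    have h2 := sineAvg_hankelH1_sub n hk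
    rw [ih0 k hk, (div_eq_iff hkc).mp h1] at h2
    have h3 : sineAvg (hankelH1 0) (n + 2) k = besselJ n k * hankelH1 n k - 2 * (n + 1) / k *
        (((besselJ n k - ((n : ℝ) + 1) / k * besselJ (n + 1) k : ℝ) : ℂ) * hankelH1 (n + 1) k
          + besselJ (n + 1) k *
            (hankelH1 n k - ((((n : ℝ) + 1) / k : ℝ) : ℂ) * hankelH1 (n + 1) k)) := by
      field_simp
      field_simp at h2
      linear_combination -h2
    rw [h3, hankelH1, hankelH1, hankelH1, besselJ_add_two n hk.ne', besselY_add_two n hk.ne']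
    push_cast
    field_simp
    ring

/-! ### The layer operators as convolutions on the circle -/

noncomputable section

/-- The operator on the circle with kernel `f(k|γ(t) - γ(s)|) = f(2k|sin((t-s)/2)|)`. -/
def chordOp (f : ℝ → ℂ) (k : ℝ) (v : ℝ → ℂ) (t : ℝ) : ℂ :=
  ∫ s in (0 : ℝ)..(2 * Real.pi), f (2 * k * |Real.sin ((t - s) / 2)|) * v s

end

/-- The point γ(s) is displaced by a along its normal, so that a = 0 gives the chord and the
derivative at a = 0 gives the normal derivative. -/
theorem circleParam_sub_norm_sq (t s a : ℝ) :
    ‖circleParam t - (circleParam s + a • circleParam s)‖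
      = √(4 * Real.sin ((t - s) / 2) ^ 2 * (1 + a) + a ^ 2) := by
  rw [EuclideanSpace.norm_eq]
  congr 1
  have h : Real.cos (t - s) = 1 - 2 * Real.sin ((t - s) / 2) ^ 2 := by
    have := Real.cos_two_mul ((t - s) / 2)
    rw [Real.cos_sq', mul_div_cancel₀ _ two_ne_zero] at this
    linarith
  rw [Real.cos_sub] at h
  have h1 := Real.sin_sq_add_cos_sq t
  have h2 := Real.sin_sq_add_cos_sq s
  simp [circleParam, Fin.sum_univ_two]
  linear_combination h1 + (1 + a) ^ 2 * h2 - 2 * (1 + a) * h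

theorem norm_circleParam_sub (t s : ℝ) :
    ‖circleParam t - circleParam s‖ = 2 * |Real.sin ((t - s) / 2)| := by
  have h := circleParam_sub_norm_sq t s 0
  rw [zero_smul, add_zero] at h
  rw [h, show 4 * Real.sin ((t - s) / 2) ^ 2 * (1 + 0) + 0 ^ 2 = (2 * Real.sin ((t - s) / 2)) ^ 2 by
    ring, Real.sqrt_sq_eq_abs, abs_mul, abs_two]

theorem helmholtzPhi_circleParam (k t s : ℝ) :
    helmholtzPhi k (circleParam t) (circleParam s)
      = Complex.I / 4 * hankelH1 0 (2 * k * |Real.sin ((t - s) / 2)|) := by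
  rw [helmholtzPhi, norm_circleParam_sub]
  congr 2
  ring

/-- The chord 2|σ| grows at rate |σ| under normal displacement, half its own length. So the normal
derivative of H_0(kr) is G(kr)/2, which turns i/4 into i/8. -/
theorem helmholtzPhiNormal_circleParam {k t s : ℝ} (hk : 0 < k) (hts : Real.sin ((t - s) / 2) ≠ 0) :
    helmholtzPhiNormal k (circleParam t) (circleParam s)
      = Complex.I / 8 * hankelG (2 * k * |Real.sin ((t - s) / 2)|) := by
  set σ := Real.sin ((t - s) / 2)
  have hσ : 0 < |σ| := abs_pos.mpr hts
  have hσ2 : σ ^ 2 = |σ| ^ 2 := (sq_abs σ).symm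
  have hsq : √(4 * σ ^ 2 * (1 + 0) + 0 ^ 2) = 2 * |σ| := by
    rw [show 4 * σ ^ 2 * (1 + 0) + 0 ^ 2 = (2 * σ) ^ 2 by ring, Real.sqrt_sq_eq_abs, abs_mul, abs_two]
  have hq : HasDerivAt (fun a : ℝ => 4 * σ ^ 2 * (1 + a) + a ^ 2) (4 * σ ^ 2) 0 := by
    refine ((((hasDerivAt_id' (0 : ℝ)).const_add 1).const_mul (4 * σ ^ 2)).add
      (hasDerivAt_pow 2 (0 : ℝ))).congr_deriv ?_
    simp
  have hr : HasDerivAt (fun a : ℝ => k * √(4 * σ ^ 2 * (1 + a) + a ^ 2)) (k * |σ|) 0 := by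
    refine ((hq.sqrt (by positivity)).const_mul k).congr_deriv ?_
    rw [hsq, hσ2]
    field_simp
    ring
  have hH : HasDerivAt (hankelH1 0) (hankelG (2 * k * |σ|) / ((2 * k * |σ| : ℝ) : ℂ))
      (k * √(4 * σ ^ 2 * (1 + 0) + 0 ^ 2)) := by
    rw [hsq, show k * (2 * |σ|) = 2 * k * |σ| by ring]
    exact hasDerivAt_hankelH1_zero (by positivity)
  have h := (hH.scomp (0 : ℝ) hr).const_mul (Complex.I / 4)
  rw [helmholtzPhiNormal, lineDeriv]
  simp only [helmholtzPhi, circleParam_sub_norm_sq]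
  refine h.deriv.trans ?_
  have h1 : (k : ℂ) ≠ 0 := by exact_mod_cast hk.ne'
  have h2 : ((|σ| : ℝ) : ℂ) ≠ 0 := by exact_mod_cast hσ.ne'
  rw [Complex.real_smul]
  push_cast
  field_simp
  ring

theorem singleLayer_eq (k : ℝ) (v : ℝ → ℂ) (t : ℝ) :
    singleLayer k v t = Complex.I / 4 * chordOp (hankelH1 0) k v t := by
  rw [singleLayer, chordOp, ← intervalIntegral.integral_const_mul]
  simp only [helmholtzPhi_circleParam, mul_assoc]

/-- The formula for the normal derivative is available off the diagonal, and for fixed t the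
excluded parameters are countable. -/
theorem ae_sin_ne_zero (t : ℝ) : ∀ᵐ s : ℝ, Real.sin ((t - s) / 2) ≠ 0 := by
  have hc : (Set.range fun n : ℤ => t - 2 * (n * Real.pi)).Countable := Set.countable_range _
  filter_upwards [hc.ae_notMem volume] with s hs h0
  obtain ⟨n, hn⟩ := Real.sin_eq_zero_iff.mp h0
  exact hs ⟨n, by simp only [hn]; ring⟩

theorem doubleLayer_eq {k : ℝ} (hk : 0 < k) (v : ℝ → ℂ) (t : ℝ) :
    doubleLayer k v t = Complex.I / 8 * chordOp hankelG k v t := by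
  rw [doubleLayer, chordOp, ← intervalIntegral.integral_const_mul]
  refine intervalIntegral.integral_congr_ae ?_
  filter_upwards [ae_sin_ne_zero t] with s hs _
  rw [helmholtzPhiNormal_circleParam hk hs, mul_assoc]

theorem periodic_chord {E : Type*} (f : ℝ → E) (k : ℝ) :
    Function.Periodic (fun v => f (2 * k * |Real.sin (v / 2)|)) (2 * Real.pi) := by
  intro v
  have h : Real.sin ((v + 2 * Real.pi) / 2) = -Real.sin (v / 2) := by
    rw [show (v + 2 * Real.pi) / 2 = v / 2 + Real.pi by ring, Real.sin_add_pi]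
  simp only [h, abs_neg]

theorem intervalIntegrable_chord {f : ℝ → ℂ} {k : ℝ}
    (hf : IntervalIntegrable (fun u => f (2 * k * Real.sin u)) volume 0 Real.pi) (a b : ℝ) :
    IntervalIntegrable (fun v => f (2 * k * |Real.sin (v / 2)|)) volume a b := by
  refine (periodic_chord f k).intervalIntegrable₀ (by positivity) ?_ a b
  have h1 : IntervalIntegrable (fun u => f (2 * k * |Real.sin u|)) volume 0 Real.pi := by
    refine hf.congr fun u hu => ?_
    rw [Set.uIoc_of_le Real.pi_pos.le] at hu
    simp only [abs_of_nonneg (Real.sin_nonneg_of_mem_Icc ⟨hu.1.le, hu.2⟩)]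
  have h2 := h1.comp_mul_left (c := 1 / 2)
  simpa [div_eq_inv_mul] using h2

/-- Substitute v = 2u, then average with the reflection u ↦ π - u, which preserves sin u and
conjugates the exponential; only the cosine survives. -/
theorem integral_chord_exp {f : ℝ → ℂ} {k : ℝ}
    (hf : IntervalIntegrable (fun u => f (2 * k * Real.sin u)) volume 0 Real.pi) (m : ℤ) :
    ∫ v in (0 : ℝ)..(2 * Real.pi), f (2 * k * |Real.sin (v / 2)|)
        * Complex.exp (-(Complex.I * (m : ℂ) * (v : ℂ)))
      = 2 * Real.pi * sineAvg f m.natAbs k := by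
  have hpc : (Real.pi : ℂ) ≠ 0 := by exact_mod_cast Real.pi_ne_zero
  have h1 := intervalIntegral.integral_comp_mul_left (a := 0) (b := Real.pi)
    (fun v : ℝ => f (2 * k * |Real.sin (v / 2)|) * Complex.exp (-(Complex.I * (m : ℂ) * (v : ℂ))))
    (two_ne_zero (α := ℝ))
  rw [mul_zero] at h1
  rw [(inv_smul_eq_iff₀ (two_ne_zero (α := ℝ))).mp h1.symm]
  set E : ℝ → ℂ := fun u => Complex.exp (-(Complex.I * (m : ℂ) * ((2 * u : ℝ) : ℂ)))
  have hE : Continuous E := by fun_prop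
  have h2 : ∫ u in (0 : ℝ)..Real.pi, f (2 * k * |Real.sin (2 * u / 2)|) *
      Complex.exp (-(Complex.I * (m : ℂ) * ((2 * u : ℝ) : ℂ)))
      = ∫ u in (0 : ℝ)..Real.pi, f (2 * k * Real.sin u) * E u := by
    refine intervalIntegral.integral_congr fun u hu => ?_
    rw [Set.uIcc_of_le Real.pi_pos.le] at hu
    simp only [mul_div_cancel_left₀ u (two_ne_zero (α := ℝ)),
      abs_of_nonneg (Real.sin_nonneg_of_mem_Icc hu), E]
  have h3 : ∫ u in (0 : ℝ)..Real.pi, f (2 * k * Real.sin u) * E u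
      = ∫ u in (0 : ℝ)..Real.pi, f (2 * k * Real.sin u) * E (Real.pi - u) := by
    have := intervalIntegral.integral_comp_sub_left (a := 0) (b := Real.pi)
      (fun u => f (2 * k * Real.sin u) * E u) Real.pi
    simp only [Real.sin_pi_sub, sub_self, sub_zero] at this
    exact this.symm
  have h4 : ∀ u, E u + E (Real.pi - u) = 2 * (Real.cos (2 * m.natAbs * u) : ℂ) := by
    intro u
    have hcos : Real.cos (2 * m.natAbs * u) = Real.cos (2 * m * u) := by
      rcases Int.natAbs_eq m with h | h
      · conv_rhs => rw [h]
        rw [Int.cast_natCast]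
      · conv_rhs => rw [h]
        rw [Int.cast_neg, Int.cast_natCast, ← Real.cos_neg]
        congr 1; ring
    have e1 : E u = Complex.exp (-((2 * m * u : ℂ) * Complex.I)) := by
      simp only [E]; congr 1; push_cast; ring
    have e2 : E (Real.pi - u) = Complex.exp ((2 * m * u : ℂ) * Complex.I) := by
      simp only [E]
      rw [← mul_one (Complex.exp ((2 * m * u : ℂ) * Complex.I)),
        ← Complex.exp_int_mul_two_pi_mul_I (-m), ← Complex.exp_add]
      congr 1; push_cast; ring
    rw [e1, e2, hcos, Complex.ofReal_cos, Complex.two_cos]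
    push_cast
    rw [neg_mul, add_comm]
  have i1 : IntervalIntegrable (fun u => f (2 * k * Real.sin u) * E u) volume 0 Real.pi :=
    hf.mul_continuousOn hE.continuousOn
  have i2 : IntervalIntegrable (fun u => f (2 * k * Real.sin u) * E (Real.pi - u))
      volume 0 Real.pi := hf.mul_continuousOn (by fun_prop)
  have h5 := intervalIntegral.integral_add i1 i2
  rw [← h3] at h5
  simp only [← mul_add, h4] at h5
  have h6 : ∫ u in (0 : ℝ)..Real.pi, f (2 * k * Real.sin u) * (2 * (Real.cos (2 * m.natAbs * u) : ℂ))
      = 2 * ∫ u in (0 : ℝ)..Real.pi, f (2 * k * Real.sin u) *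
        (Real.cos (2 * m.natAbs * u) : ℂ) := by
    rw [← intervalIntegral.integral_const_mul]
    refine intervalIntegral.integral_congr fun u _ => ?_
    ring
  rw [h6] at h5
  rw [h2, sineAvg, Complex.real_smul, Complex.ofReal_ofNat]
  field_simp
  linear_combination -(1 / 2 : ℂ) * h5

theorem chordOp_exp {f : ℝ → ℂ} {k : ℝ}
    (hf : IntervalIntegrable (fun u => f (2 * k * Real.sin u)) volume 0 Real.pi) (m : ℤ) (t : ℝ) :
    chordOp f k (fun s => Complex.exp (Complex.I * (m : ℂ) * (s : ℂ))) t
      = 2 * Real.pi * sineAvg f m.natAbs k * Complex.exp (Complex.I * (m : ℂ) * (t : ℂ)) := by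
  set g : ℝ → ℂ := fun v => f (2 * k * |Real.sin (v / 2)|)
    * Complex.exp (-(Complex.I * (m : ℂ) * (v : ℂ))) with hg
  have hper : Function.Periodic g (2 * Real.pi) := by
    refine (periodic_chord f k).mul fun v => ?_
    rw [← mul_one (Complex.exp (-(Complex.I * (m : ℂ) * (v : ℂ)))),
        ← Complex.exp_int_mul_two_pi_mul_I (-m), ← Complex.exp_add]
    congr 1; push_cast; ring
  have h1 := intervalIntegral.integral_comp_sub_left (a := 0) (b := 2 * Real.pi) g t
  have h2 := hper.intervalIntegral_add_eq (t - 2 * Real.pi) 0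
  rw [sub_add_cancel, zero_add] at h2
  rw [sub_zero, h2, hg, integral_chord_exp hf m] at h1
  rw [← h1, chordOp, ← intervalIntegral.integral_mul_const]
  refine intervalIntegral.integral_congr fun s _ => ?_
  simp only
  have e : Complex.exp (Complex.I * (m : ℂ) * (s : ℂ)) = Complex.exp (Complex.I * (m : ℂ) * (t : ℂ))
      * Complex.exp (-(Complex.I * (m : ℂ) * ((t - s : ℝ) : ℂ))) := by
    rw [← Complex.exp_add]; congr 1; push_cast; ring
  rw [e]; ring

theorem combinedLayer_eq {k : ℝ} (hk : 0 < k) (v : ℝ → ℂ) (t : ℝ) :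
    2 * combinedLayer k v t = v t + Complex.I / 4 * chordOp hankelG k v t
      + k / 2 * chordOp (hankelH1 0) k v t := by
  rw [combinedLayer, doubleLayer_eq hk, singleLayer_eq]
  linear_combination -((k : ℂ) / 2 * chordOp (hankelH1 0) k v t) * Complex.I_sq

/-- The average of G is k (J H)' = k (J' H + J H'). The Wronskian J H' - J' H = 2i/(πk) replaces
this by 2k J' H + 2i/π, and the last term, multiplied by iπ/2, cancels the 1. -/
theorem circleLambda_eq (m : ℤ) {k : ℝ} (hk : 0 < k) :
    circleLambda m k = 1 + Complex.I / 4 * (2 * Real.pi * sineAvg hankelG m.natAbs k)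
      + k / 2 * (2 * Real.pi * sineAvg (hankelH1 0) m.natAbs k) := by
  rw [circleLambda]
  generalize m.natAbs = n
  have hkc : (k : ℂ) ≠ 0 := by exact_mod_cast hk.ne'
  have hpc : (Real.pi : ℂ) ≠ 0 := by exact_mod_cast Real.pi_ne_zero
  have h1 := (hasDerivAt_sineAvg_hankelH1 n hk).unique
      (((hasDerivAt_besselJ n hk.ne').ofReal_comp.mul
        (hasDerivAt_hankelH1 n hk.ne')).congr_of_eventuallyEq (by
          filter_upwards [lt_mem_nhds hk] with y hy using sineAvg_hankelH1_eq n y hy))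
  rw [div_eq_iff hkc] at h1
  have hw := congrArg (fun r : ℝ => (r : ℂ)) (wronskian_bessel n hk)
  simp only [Complex.ofReal_mul, Complex.ofReal_sub, Complex.ofReal_div, Complex.ofReal_ofNat] at hw
  rw [eq_div_iff hpc] at hw
  rw [h1, sineAvg_hankelH1_eq n k hk, (hasDerivAt_besselJ n hk.ne').deriv]
  simp only [hankelH1]
  push_cast
  field_simp
  linear_combination 2 * hw + 2 * (Real.pi * k * (besselJ n k * besselY (n + 1) k
    - besselY n k * besselJ (n + 1) k)) * Complex.I_sq

theorem combinedLayer_exp {k : ℝ} (hk : 0 < k) (m : ℤ) (t : ℝ) :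
    2 * combinedLayer k (fun s => Complex.exp (Complex.I * (m : ℂ) * (s : ℂ))) t
      = circleLambda m k * Complex.exp (Complex.I * (m : ℂ) * (t : ℂ)) := by
  rw [combinedLayer_eq hk, chordOp_exp (intervalIntegrable_hankelG_sin hk),
    chordOp_exp (intervalIntegrable_hankelH1_sin hk), circleLambda_eq m hk]
  ring

/-! ### Eigenvalues -/

theorem integral_arcMeasure (f : ℝ → ℂ) :
    ∫ t, f t ∂arcMeasure = ∫ t in (0 : ℝ)..(2 * Real.pi), f t := by
  rw [intervalIntegral.integral_of_le (by positivity), arcMeasure]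

instance isFiniteMeasure_arcMeasure : IsFiniteMeasure arcMeasure := by
  unfold arcMeasure; infer_instance

theorem chordOp_eq_integral (f : ℝ → ℂ) (k : ℝ) (v : ℝ → ℂ) (t : ℝ) :
    chordOp f k v t = ∫ s, f (2 * k * |Real.sin ((t - s) / 2)|) * v s ∂arcMeasure := by
  rw [integral_arcMeasure, chordOp]

theorem norm_exp_int_mul (m : ℤ) (t : ℝ) :
    ‖Complex.exp (Complex.I * (m : ℂ) * (t : ℂ))‖ = 1 := by
  rw [show Complex.I * (m : ℂ) * (t : ℂ) = ((m * t : ℝ) : ℂ) * Complex.I by push_cast; ring]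
  exact Complex.norm_exp_ofReal_mul_I _

/-- By periodicity the integral of the kernel's norm over t does not depend on s, so integrability
of v alone justifies Fubini despite the singular diagonal. -/
theorem integrable_chord_prod {f : ℝ → ℂ} {k : ℝ} (hfm : Measurable f)
    (hf : IntervalIntegrable (fun u => f (2 * k * Real.sin u)) volume 0 Real.pi)
    {v : ℝ → ℂ} (hv : Integrable v arcMeasure) :
    Integrable (fun p : ℝ × ℝ => f (2 * k * |Real.sin ((p.1 - p.2) / 2)|) * v p.2)
      (arcMeasure.prod arcMeasure) := by
  have hfm' : Measurable fun p : ℝ × ℝ => f (2 * k * |Real.sin ((p.1 - p.2) / 2)|) :=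
    hfm.comp (by fun_prop)
  have hshift : ∀ s : ℝ, Integrable (fun t => f (2 * k * |Real.sin ((t - s) / 2)|)) arcMeasure :=
    fun s => by
      have h := (intervalIntegrable_chord hf (0 - s) (2 * Real.pi - s)).comp_sub_right s
      simp only [sub_add_cancel] at h
      rwa [intervalIntegrable_iff_integrableOn_Ioc_of_le (by positivity)] at h
  have hmeas : AEStronglyMeasurable
      (fun p : ℝ × ℝ => f (2 * k * |Real.sin ((p.1 - p.2) / 2)|) * v p.2)
      (arcMeasure.prod arcMeasure) := hfm'.aestronglyMeasurable.mul hv.1.comp_snd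
  rw [integrable_prod_iff' hmeas]
  refine ⟨Eventually.of_forall fun s => (hshift s).mul_const (v s), ?_⟩
  have hc : ∀ s : ℝ, ∫ t, ‖f (2 * k * |Real.sin ((t - s) / 2)|) * v s‖ ∂arcMeasure
      = (∫ t in (0 : ℝ)..(2 * Real.pi), ‖f (2 * k * |Real.sin (t / 2)|)‖) * ‖v s‖ := by
    intro s
    simp only [norm_mul]
    rw [integral_mul_const, arcMeasure, ← intervalIntegral.integral_of_le (by positivity),
      intervalIntegral.integral_comp_sub_right (fun t => ‖f (2 * k * |Real.sin (t / 2)|)‖)]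
    have := (periodic_chord (fun x => ‖f x‖) k).intervalIntegral_add_eq (0 - s) 0
    rw [zero_add, show 0 - s + 2 * Real.pi = 2 * Real.pi - s by ring] at this
    rw [this]
  simp only [hc]
  exact hv.norm.const_mul _

/-- The kernel is symmetric in t and s, so after Fubini the operator acts on the exponential, where
it is known. -/
theorem chordOp_dual {f : ℝ → ℂ} {k : ℝ} (hfm : Measurable f)
    (hf : IntervalIntegrable (fun u => f (2 * k * Real.sin u)) volume 0 Real.pi)
    {v : ℝ → ℂ} (hv : Integrable v arcMeasure) (m : ℤ) :
    Integrable (chordOp f k v) arcMeasure ∧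
    ∫ t, chordOp f k v t * Complex.exp (Complex.I * (m : ℂ) * (t : ℂ)) ∂arcMeasure
      = 2 * Real.pi * sineAvg f m.natAbs k *
        ∫ t, v t * Complex.exp (Complex.I * (m : ℂ) * (t : ℂ)) ∂arcMeasure := by
  have hi := integrable_chord_prod hfm hf hv
  refine ⟨hi.integral_prod_left.congr (Eventually.of_forall fun t =>
    (chordOp_eq_integral f k v t).symm), ?_⟩
  have hi' : Integrable (fun p : ℝ × ℝ => f (2 * k * |Real.sin ((p.1 - p.2) / 2)|) * v p.2
      * Complex.exp (Complex.I * (m : ℂ) * (p.1 : ℂ))) (arcMeasure.prod arcMeasure) :=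
    hi.mul_bdd (c := 1) (by fun_prop) (Eventually.of_forall fun p => (norm_exp_int_mul m p.1).le)
  have hsw := integral_integral_swap (f := fun t s => f (2 * k * |Real.sin ((t - s) / 2)|) * v s
      * Complex.exp (Complex.I * (m : ℂ) * (t : ℂ))) hi'
  have e1 : ∀ t, ∫ s, f (2 * k * |Real.sin ((t - s) / 2)|) * v s
      * Complex.exp (Complex.I * (m : ℂ) * (t : ℂ)) ∂arcMeasure
      = chordOp f k v t * Complex.exp (Complex.I * (m : ℂ) * (t : ℂ)) := fun t => by
    rw [integral_mul_const, chordOp_eq_integral]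
  have e2 : ∀ s, ∫ t, f (2 * k * |Real.sin ((t - s) / 2)|) * v s
      * Complex.exp (Complex.I * (m : ℂ) * (t : ℂ)) ∂arcMeasure
      = 2 * Real.pi * sineAvg f m.natAbs k * (v s * Complex.exp (Complex.I * (m : ℂ) * (s : ℂ))) :=
    fun s => by
      have h := chordOp_exp hf m s
      rw [chordOp_eq_integral] at h
      calc _ = ∫ t, v s * (f (2 * k * |Real.sin ((s - t) / 2)|)
            * Complex.exp (Complex.I * (m : ℂ) * (t : ℂ))) ∂arcMeasure := by
            refine integral_congr_ae (Eventually.of_forall fun t => ?_)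
            simp only
            rw [show (t - s) / 2 = -((s - t) / 2) by ring, Real.sin_neg, abs_neg]
            ring
        _ = _ := by
          rw [integral_const_mul, h]
          ring
  simp only [e1, e2] at hsw
  rw [hsw, integral_const_mul]

theorem integral_combinedLayer_mul_exp {k : ℝ} (hk : 0 < k) {v : ℝ → ℂ}
    (hv : Integrable v arcMeasure) (m : ℤ) :
    ∫ t, 2 * combinedLayer k v t * Complex.exp (Complex.I * (m : ℂ) * (t : ℂ)) ∂arcMeasure
      = circleLambda m k * ∫ t, v t * Complex.exp (Complex.I * (m : ℂ) * (t : ℂ)) ∂arcMeasure := by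
  obtain ⟨iG, eG⟩ := chordOp_dual measurable_hankelG (intervalIntegrable_hankelG_sin hk) hv m
  obtain ⟨iH, eH⟩ := chordOp_dual (measurable_hankelH1 0) (intervalIntegrable_hankelH1_sin hk) hv m
  have hmul : ∀ {g : ℝ → ℂ}, Integrable g arcMeasure →
      Integrable (fun t => g t * Complex.exp (Complex.I * (m : ℂ) * (t : ℂ))) arcMeasure :=
    fun hg => hg.mul_bdd (c := 1) (by fun_prop)
      (Eventually.of_forall fun t => (norm_exp_int_mul m t).le)
  have e : ∀ t : ℝ, 2 * combinedLayer k v t * Complex.exp (Complex.I * (m : ℂ) * (t : ℂ))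
      = v t * Complex.exp (Complex.I * (m : ℂ) * (t : ℂ))
        + (Complex.I / 4 * (chordOp hankelG k v t * Complex.exp (Complex.I * (m : ℂ) * (t : ℂ)))
        + k / 2 * (chordOp (hankelH1 0) k v t * Complex.exp (Complex.I * (m : ℂ) * (t : ℂ)))) :=
    fun t => by rw [combinedLayer_eq hk]; ring
  have i1 := (hmul iG).const_mul (Complex.I / 4)
  have i2 := (hmul iH).const_mul (k / 2 : ℂ)
  have s1 := integral_add (hmul hv) (i1.add i2)
  simp only [Pi.add_apply] at s1
  simp only [e]
  rw [s1, integral_add i1 i2, integral_const_mul,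
    integral_const_mul, eG, eH, circleLambda_eq m hk]
  ring

/-- Parseval: if every Fourier coefficient vanishes, so does the L² norm. -/
theorem exists_integral_mul_exp_ne_zero {v : ℝ → ℂ} (hv : MemLp v 2 arcMeasure)
    (h0 : ¬ (v =ᵐ[arcMeasure] fun _ => 0)) :
    ∃ m : ℤ, ∫ t, v t * Complex.exp (Complex.I * (m : ℂ) * (t : ℂ)) ∂arcMeasure ≠ 0 := by
  by_contra! h
  apply h0
  have hab : (0 : ℝ) < 2 * Real.pi := by positivity
  have hs := hasSum_sq_fourierCoeffOn hab hv
  have hz : ∀ n : ℤ, fourierCoeffOn hab v n = 0 := fun n => by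
    rw [fourierCoeffOn_eq_integral]
    -- The n-th Fourier coefficient pairs v with e^{-int}, hence the sign.
    have h1 := h (-n)
    rw [integral_arcMeasure] at h1
    rw [smul_eq_zero]
    right
    rw [← h1]
    refine intervalIntegral.integral_congr fun t _ => ?_
    simp only [smul_eq_mul]
    rw [fourier_coe_apply, mul_comm]
    congr 2
    have hpc : (Real.pi : ℂ) ≠ 0 := by exact_mod_cast Real.pi_ne_zero
    push_cast
    field_simp
    ring
  simp only [hz, norm_zero, ne_eq, OfNat.ofNat_ne_zero, not_false_eq_true, zero_pow] at hs
  have h2 := hs.unique hasSum_zero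
  rw [smul_eq_zero] at h2
  have h3 := h2.resolve_left (by rw [sub_zero]; positivity)
  rw [intervalIntegral.integral_of_le hab.le] at h3
  have h4 := (integral_eq_zero_iff_of_nonneg (fun t => by positivity) hv.integrable_norm_pow').mp h3
  filter_upwards [h4] with t ht
  simpa using ht

/-- Pair 2A v = μ v with a mode m on which v has a nonzero coefficient: both μ and λ_m multiply it,
so they agree. -/
theorem isEigenvalueTwoA_iff {k : ℝ} (hk : 0 < k) (μ : ℂ) :
    IsEigenvalueTwoA k μ ↔ ∃ m : ℤ, μ = circleLambda m k := by
  constructor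
  · rintro ⟨v, hv, hv0, hev⟩
    obtain ⟨m, hm⟩ := exists_integral_mul_exp_ne_zero hv hv0
    refine ⟨m, ?_⟩
    have h1 := integral_combinedLayer_mul_exp hk (hv.integrable one_le_two) m
    have h2 : ∫ t, 2 * combinedLayer k v t * Complex.exp (Complex.I * (m : ℂ) * (t : ℂ)) ∂arcMeasure
        = μ * ∫ t, v t * Complex.exp (Complex.I * (m : ℂ) * (t : ℂ)) ∂arcMeasure := by
      rw [← integral_const_mul]
      refine integral_congr_ae ?_
      filter_upwards [hev] with t ht
      rw [ht, mul_assoc]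
    exact mul_right_cancel₀ hm (h2.symm.trans h1)
  · rintro ⟨m, rfl⟩
    refine ⟨fun t => Complex.exp (Complex.I * (m : ℂ) * (t : ℂ)), ?_, ?_, ?_⟩
    · exact MemLp.of_bound (by fun_prop) 1 (Eventually.of_forall fun t => (norm_exp_int_mul m t).le)
    · intro h
      have h1 : ∀ᵐ t ∂arcMeasure, False := by
        filter_upwards [h] with t ht using Complex.exp_ne_zero _ ht
      rw [eventually_false_iff_eq_bot, ae_eq_bot, arcMeasure, Measure.restrict_eq_zero,
        Real.volume_Ioc, ENNReal.ofReal_eq_zero] at h1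
      linarith [Real.pi_pos]
    · exact Eventually.of_forall fun t => combinedLayer_exp hk m t

/-! ### Bessel functions below the turning point -/

/-- `x J_n'(x)`. -/
noncomputable def besselTheta (n : ℕ) (x : ℝ) : ℝ := n * besselJ n x - x * besselJ (n + 1) x

theorem hasDerivAt_besselJ_theta (n : ℕ) {x : ℝ} (hx : 0 < x) :
    HasDerivAt (besselJ n) (besselTheta n x / x) x := by
  refine (hasDerivAt_besselJ n hx.ne').congr_deriv ?_
  rw [besselTheta]
  have := hx.ne'
  field_simp

/-- Bessel's equation; the sign of n² - x² drives all the monotonicity below the turning point. -/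
theorem hasDerivAt_besselTheta (n : ℕ) {x : ℝ} (hx : 0 < x) :
    HasDerivAt (besselTheta n) (((n : ℝ) ^ 2 - x ^ 2) / x * besselJ n x) x := by
  have hx' := hx.ne'
  refine (((hasDerivAt_besselJ n hx').const_mul (n : ℝ)).sub
    ((hasDerivAt_id x).mul (hasDerivAt_besselJ_succ n hx'))).congr_deriv ?_
  simp only [id]
  field_simp
  ring

theorem continuous_besselTheta (n : ℕ) : Continuous (besselTheta n) := by
  have h1 := continuous_besselJ n
  have h2 := continuous_besselJ (n + 1)
  unfold besselTheta
  fun_prop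

theorem besselJ_at_zero {n : ℕ} (hn : 1 ≤ n) : besselJ n 0 = 0 := by
  rw [besselJ_eq_entireJ, zero_div, zero_pow (by omega), zero_mul]

theorem besselTheta_at_zero {n : ℕ} (hn : 1 ≤ n) : besselTheta n 0 = 0 := by
  rw [besselTheta, besselJ_at_zero hn]; ring

theorem monotoneOn_Icc_of_hasDerivAt {f f' : ℝ → ℝ} {a b : ℝ} (hc : ContinuousOn f (Set.Icc a b))
    (hd : ∀ x ∈ Set.Ioo a b, HasDerivAt f (f' x) x) (h0 : ∀ x ∈ Set.Ioo a b, 0 ≤ f' x) :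
    MonotoneOn f (Set.Icc a b) := by
  refine monotoneOn_of_deriv_nonneg (convex_Icc a b) hc (fun x hx => ?_) fun x hx => ?_
  · rw [interior_Icc] at hx
    exact (hd x hx).differentiableAt.differentiableWithinAt
  · rw [interior_Icc] at hx
    rw [(hd x hx).deriv]
    exact h0 x hx

theorem antitoneOn_Icc_of_hasDerivAt {f f' : ℝ → ℝ} {a b : ℝ} (hc : ContinuousOn f (Set.Icc a b))
    (hd : ∀ x ∈ Set.Ioo a b, HasDerivAt f (f' x) x) (h0 : ∀ x ∈ Set.Ioo a b, f' x ≤ 0) :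
    AntitoneOn f (Set.Icc a b) := by
  refine antitoneOn_of_deriv_nonpos (convex_Icc a b) hc (fun x hx => ?_) fun x hx => ?_
  · rw [interior_Icc] at hx
    exact (hd x hx).differentiableAt.differentiableWithinAt
  · rw [interior_Icc] at hx
    rw [(hd x hx).deriv]
    exact h0 x hx

/-- The product vanishes at 0 and has derivative (θ² + (n² - x²) J²)/x ≥ 0 up to x = n. -/
theorem besselJ_mul_theta_nonneg {n : ℕ} (hn : 1 ≤ n) {x : ℝ} (hx : 0 ≤ x) (hxn : x ≤ n) :
    0 ≤ besselJ n x * besselTheta n x := by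
  have hm := monotoneOn_Icc_of_hasDerivAt (f := fun x => besselJ n x * besselTheta n x)
    (f' := fun x => (besselTheta n x ^ 2 + ((n : ℝ) ^ 2 - x ^ 2) * besselJ n x ^ 2) / x)
    (a := 0) (b := n) ((continuous_besselJ n).mul (continuous_besselTheta n)).continuousOn
    (fun x hx => by
      refine ((hasDerivAt_besselJ_theta n hx.1).mul (hasDerivAt_besselTheta n hx.1)).congr_deriv ?_
      have := hx.1.ne'
      field_simp)
    (fun x hx => by
      have h1 : 0 ≤ (n : ℝ) ^ 2 - x ^ 2 := by nlinarith [hx.1, hx.2]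
      have := hx.1
      positivity)
  have h := hm ⟨le_rfl, Nat.cast_nonneg n⟩ ⟨hx, hxn⟩ hx
  simpa [besselJ_at_zero hn] using h

theorem besselJ_sq_monotoneOn {n : ℕ} (hn : 1 ≤ n) :
    MonotoneOn (fun x => besselJ n x ^ 2) (Set.Icc 0 (n : ℝ)) := by
  refine monotoneOn_Icc_of_hasDerivAt (f' := fun x => 2 * (besselJ n x * besselTheta n x) / x)
    ((continuous_besselJ n).pow 2).continuousOn (fun x hx => ?_) fun x hx => ?_
  · refine ((hasDerivAt_besselJ_theta n hx.1).pow 2).congr_deriv ?_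
    have := hx.1.ne'
    field_simp
    ring
  · have h := besselJ_mul_theta_nonneg hn hx.1.le hx.2.le
    have := hx.1
    positivity

theorem exists_besselJ_pos_of_lt (n : ℕ) {x : ℝ} (hx : 0 < x) :
    ∃ y, 0 < y ∧ y < x ∧ 0 < besselJ n y := by
  have h0 : entireJ n ((0 / 2) ^ 2) = 1 / (n.factorial : ℝ) := by
    rw [entireJ, tsum_eq_single 0]
    · simp [besselJCoeff]
    · intro j hj; simp [hj]
  have hc : Continuous fun x : ℝ => entireJ n ((x / 2) ^ 2) := by
    have := continuous_entireJ n
    fun_prop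
  have hpos : ∀ᶠ y in 𝓝[>] (0 : ℝ), 0 < entireJ n ((y / 2) ^ 2) := by
    refine (hc.tendsto 0).mono_left nhdsWithin_le_nhds |>.eventually (lt_mem_nhds ?_)
    rw [h0]; positivity
  obtain ⟨y, hy, hy'⟩ := (hpos.and (Ioo_mem_nhdsGT hx)).exists
  refine ⟨y, hy'.1, hy'.2, ?_⟩
  rw [besselJ_eq_entireJ]
  have := hy'.1
  positivity

/-- J_n takes positive values arbitrarily close to 0, and J_n² is nondecreasing up to n, so J_n
cannot return to zero. -/
theorem besselJ_pos {n : ℕ} (hn : 1 ≤ n) {x : ℝ} (hx : 0 < x) (hxn : x ≤ n) : 0 < besselJ n x := by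
  obtain ⟨y, hy0, hyx, hy⟩ := exists_besselJ_pos_of_lt n hx
  by_contra! hneg
  obtain ⟨z, hz, hz0⟩ := intermediate_value_Icc' hyx.le (continuous_besselJ n).continuousOn
    (⟨hneg, hy.le⟩ : (0 : ℝ) ∈ Set.Icc (besselJ n x) (besselJ n y))
  have h := besselJ_sq_monotoneOn hn ⟨hy0.le, hyx.le.trans hxn⟩
    ⟨hy0.le.trans hz.1, hz.2.trans hxn⟩ hz.1
  simp only [hz0] at h
  nlinarith

theorem besselTheta_nonneg {n : ℕ} (hn : 1 ≤ n) {x : ℝ} (hx : 0 < x) (hxn : x ≤ n) :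
    0 ≤ besselTheta n x :=
  nonneg_of_mul_nonneg_right (besselJ_mul_theta_nonneg hn hx.le hxn) (besselJ_pos hn hx hxn)

/-- The difference of the two sides vanishes at 0 and has derivative 2x J². This is the lower bound
√(n² - x²) for the logarithmic derivative θ/J. -/
theorem mul_besselJ_sq_le_theta_sq {n : ℕ} (hn : 1 ≤ n) {x : ℝ} (hx : 0 < x) (hxn : x ≤ n) :
    ((n : ℝ) ^ 2 - x ^ 2) * besselJ n x ^ 2 ≤ besselTheta n x ^ 2 := by
  have hJ := continuous_besselJ n
  have hT := continuous_besselTheta n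
  have hm := monotoneOn_Icc_of_hasDerivAt
    (f := fun x => besselTheta n x ^ 2 - ((n : ℝ) ^ 2 - x ^ 2) * besselJ n x ^ 2)
    (f' := fun x => 2 * x * besselJ n x ^ 2)
    (a := 0) (b := n) (by fun_prop)
    (fun x hx => by
      refine (((hasDerivAt_besselTheta n hx.1).pow 2).sub (((hasDerivAt_pow 2 x).const_sub
        ((n : ℝ) ^ 2)).mul ((hasDerivAt_besselJ_theta n hx.1).pow 2))).congr_deriv ?_
      have := hx.1.ne'
      simp only [Pi.pow_apply]
      push_cast
      field_simp
      ring)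
    (fun x hx => by
      have := hx.1
      positivity)
  have h := hm ⟨le_rfl, Nat.cast_nonneg n⟩ ⟨hx.le, hxn⟩ hx.le
  simp only [besselJ_at_zero hn, besselTheta_at_zero hn] at h
  linarith

/-- The function n² J² - θ² vanishes at 0 and has derivative 2x J θ ≥ 0. -/
theorem besselTheta_le {n : ℕ} (hn : 1 ≤ n) {x : ℝ} (hx : 0 < x) (hxn : x ≤ n) :
    besselTheta n x ≤ n * besselJ n x := by
  have hJ := continuous_besselJ n
  have hT := continuous_besselTheta n
  have hm := monotoneOn_Icc_of_hasDerivAt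
    (f := fun x => (n : ℝ) ^ 2 * besselJ n x ^ 2 - besselTheta n x ^ 2)
    (f' := fun x => 2 * x * (besselJ n x * besselTheta n x))
    (a := 0) (b := n) (by fun_prop)
    (fun x hx => by
      refine ((((hasDerivAt_besselJ_theta n hx.1).pow 2).const_mul ((n : ℝ) ^ 2)).sub
        ((hasDerivAt_besselTheta n hx.1).pow 2)).congr_deriv ?_
      have := hx.1.ne'
      push_cast
      field_simp
      ring)
    (fun x hx => by
      have h := besselJ_mul_theta_nonneg hn hx.1.le hx.2.le
      have := hx.1
      positivity)
  have h := hm ⟨le_rfl, Nat.cast_nonneg n⟩ ⟨hx.le, hxn⟩ hx.le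
  simp only [besselJ_at_zero hn, besselTheta_at_zero hn] at h
  have hJ0 := besselJ_pos hn hx hxn
  refine le_of_sq_le_sq ?_ (by positivity)
  nlinarith

theorem mul_besselJ_le_theta {n : ℕ} (hn : 1 ≤ n) {x a : ℝ} (hx : 0 < x) (hxn : x ≤ n)
    (ha : a ^ 2 ≤ (n : ℝ) ^ 2 - x ^ 2) : a * besselJ n x ≤ besselTheta n x := by
  refine le_of_sq_le_sq ?_ (besselTheta_nonneg hn hx hxn)
  refine le_trans ?_ (mul_besselJ_sq_le_theta_sq hn hx hxn)
  rw [mul_pow]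
  gcongr

theorem sub_mul_besselJ_le_theta {n : ℕ} (hn : 1 ≤ n) {x : ℝ} (hx : 0 < x) (hxn : x ≤ n) :
    (n - x ^ 2 / n) * besselJ n x ≤ besselTheta n x := by
  refine mul_besselJ_le_theta hn hx hxn ?_
  have hn0 : (0 : ℝ) < n := by exact_mod_cast hn
  have h1 : (x / n) ^ 2 ≤ 1 := pow_le_one₀ (by positivity) (by rwa [div_le_one hn0])
  have h2 : (n - x ^ 2 / n : ℝ) ^ 2 = n ^ 2 - 2 * x ^ 2 + x ^ 2 * (x / n) ^ 2 := by
    field_simp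
    ring
  rw [h2]
  nlinarith [sq_nonneg x]

/-! ### Decay of J_n and size of J_n Y_n away from the turning point. -/

/-- Power-type growth of `J_n²` on an interval where `x J_n' / J_n ≥ p / 2`. -/
theorem besselJ_sq_le_rpow_mul {n : ℕ} {p x x₁ : ℝ}
    (hp : ∀ y, 0 < y → y ≤ x₁ → p * besselJ n y ≤ 2 * besselTheta n y)
    (hpos : ∀ y, 0 < y → y ≤ x₁ → 0 < besselJ n y) (hx : 0 < x) (hx₁ : x ≤ x₁) :
    besselJ n x ^ 2 ≤ (x / x₁) ^ p * besselJ n x₁ ^ 2 := by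
  have hd : ∀ y : ℝ, 0 < y → HasDerivAt (fun y => besselJ n y ^ 2 * y ^ (-p))
      (y ^ (-p) / y * (besselJ n y * (2 * besselTheta n y - p * besselJ n y))) y := fun y hy => by
    refine (((hasDerivAt_besselJ_theta n hy).pow 2).mul
      (Real.hasDerivAt_rpow_const (p := -p) (Or.inl hy.ne'))).congr_deriv ?_
    rw [Real.rpow_sub_one hy.ne']
    have := hy.ne'
    simp only [Pi.pow_apply]
    push_cast
    field_simp
    ring
  have hm := monotoneOn_Icc_of_hasDerivAt (a := x) (b := x₁)
    (fun y hy => (hd y (hx.trans_le hy.1)).continuousAt.continuousWithinAt)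
    (fun y hy => hd y (hx.trans hy.1)) (fun y hy => by
      have hy0 := hx.trans hy.1
      have h1 := hpos y hy0 hy.2.le
      have h2 : 0 ≤ 2 * besselTheta n y - p * besselJ n y := by linarith [hp y hy0 hy.2.le]
      positivity)
  have h := hm ⟨le_rfl, hx₁⟩ ⟨hx₁, le_rfl⟩ hx₁
  simp only at h
  have hx₁0 := hx.trans_le hx₁
  rw [Real.rpow_neg hx.le, Real.rpow_neg hx₁0.le, ← div_eq_mul_inv, ← div_eq_mul_inv,
    div_le_div_iff₀ (by positivity) (by positivity)] at h
  rw [Real.div_rpow hx.le hx₁0.le, div_mul_eq_mul_div, le_div_iff₀ (by positivity)]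
  linarith

/-- The Wronskian in quotient form. It transfers information on J_n to Y_n. -/
theorem hasDerivAt_besselY_div {n : ℕ} {x : ℝ} (hx : 0 < x) (hJ : besselJ n x ≠ 0) :
    HasDerivAt (fun x => besselY n x / besselJ n x) (2 / (Real.pi * x * besselJ n x ^ 2)) x := by
  refine ((hasDerivAt_besselY n hx.ne').div (hasDerivAt_besselJ n hx.ne') hJ).congr_deriv ?_
  have hw := wronskian_bessel n hx
  have hp := Real.pi_ne_zero
  have := hx.ne'
  rw [eq_div_iff hp] at hw
  field_simp
  linear_combination hw

/-- The comparison function for Y/J: when θ is close to n J, the derivative of -J⁻²/(πn) is close to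
2/(π x J²). -/
theorem hasDerivAt_inv_besselJ_sq {n : ℕ} {x : ℝ} (hx : 0 < x) (hJ : besselJ n x ≠ 0) :
    HasDerivAt (fun x => (besselJ n x ^ 2)⁻¹) (-(2 * besselTheta n x / (x * besselJ n x ^ 3))) x := by
  refine (((hasDerivAt_besselJ_theta n hx).pow 2).inv (pow_ne_zero 2 hJ)).congr_deriv ?_
  have := hx.ne'
  simp only [Pi.pow_apply]
  push_cast
  field_simp

/-- J_n H_n is a Fourier coefficient, hence O(1 + |log(zn)|) uniformly in n. The weaker linear bound
suffices, because it is always multiplied by a geometric factor. -/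
theorem exists_besselJ_mul_le_mul {z : ℝ} (hz : 0 < z) : ∃ K : ℝ, 0 < K ∧ ∀ n : ℕ, 1 ≤ n →
    besselJ n (z * n) ^ 2 ≤ K * n ∧ |besselJ n (z * n) * besselY n (z * n)| ≤ K * n := by
  obtain ⟨K, hK, h⟩ := exists_norm_sineAvg_hankelH1_le
  refine ⟨K * (2 + |Real.log z|), by positivity, fun n hn => ?_⟩
  have hn1 : (1 : ℝ) ≤ n := by exact_mod_cast hn
  have hx : 0 < z * n := by positivity
  have h1 := h n (z * n) hx
  rw [sineAvg_hankelH1_eq n _ hx, norm_mul, Complex.norm_real, Real.norm_eq_abs] at h1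
  have h2 : K * (1 + |Real.log (z * n)|) ≤ K * (2 + |Real.log z|) * n := by
    rw [mul_assoc]
    refine mul_le_mul_of_nonneg_left ?_ hK.le
    rw [Real.log_mul hz.ne' (by positivity)]
    have h3 := abs_add_le (Real.log z) (Real.log n)
    rw [abs_of_nonneg (Real.log_nonneg hn1)] at h3
    have h4 := Real.log_le_self (Nat.cast_nonneg n : (0 : ℝ) ≤ n)
    nlinarith [abs_nonneg (Real.log z)]
  have hre : |besselJ n (z * n)| ≤ ‖hankelH1 n (z * n)‖ := by
    simpa [hankelH1] using Complex.abs_re_le_norm (hankelH1 n (z * n))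
  have him : |besselY n (z * n)| ≤ ‖hankelH1 n (z * n)‖ := by
    simpa [hankelH1] using Complex.abs_im_le_norm (hankelH1 n (z * n))
  constructor
  · rw [← sq_abs, sq]
    exact (mul_le_mul_of_nonneg_left hre (abs_nonneg _)).trans (h1.trans h2)
  · rw [abs_mul]
    exact (mul_le_mul_of_nonneg_left him (abs_nonneg _)).trans (h1.trans h2)

theorem exists_sq_mul_pow_le {r : ℝ} (hr : 0 ≤ r) (hr1 : r < 1) :
    ∃ M : ℝ, 0 < M ∧ ∀ n : ℕ, (n : ℝ) ^ 2 * r ^ n ≤ M := by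
  have h := tendsto_pow_const_mul_const_pow_of_abs_lt_one 2 (by rwa [abs_of_nonneg hr] : |r| < 1)
  obtain ⟨M, hM⟩ := h.bddAbove_range
  refine ⟨|M| + 1, by positivity, fun n => ?_⟩
  have := hM ⟨n, rfl⟩
  simp only at this
  linarith [le_abs_self M]

theorem abs_mul_le_of_div_mem {j y r₁ e q B : ℝ} (hj : 0 < j) (hup : y / j ≤ r₁)
    (hlo : r₁ - e / j ^ 2 ≤ y / j) (hq : |j ^ 2 * r₁| ≤ q * B) : |j * y| ≤ q * B + |e| := by
  have hy : j * y = j ^ 2 * (y / j) := by field_simp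
  have h1 : j ^ 2 * (y / j) ≤ j ^ 2 * r₁ := by gcongr
  have h2 : j ^ 2 * r₁ - e ≤ j ^ 2 * (y / j) := by
    calc j ^ 2 * r₁ - e = j ^ 2 * (r₁ - e / j ^ 2) := by field_simp
      _ ≤ _ := by gcongr
  rw [hy, abs_le]
  have := abs_le.mp hq
  have := le_abs_self e
  constructor <;> linarith [abs_nonneg e]

/-- Away from the turning point the products `n J_n²` and `n J_n Y_n` are bounded. -/
theorem exists_mul_bessel_le {z₂ z₁ : ℝ} (hz₂ : 0 < z₂) (h21 : z₂ < z₁) (hz₁ : z₁ < 1) :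
    ∃ C : ℝ, 0 < C ∧ ∀ (n : ℕ) (x : ℝ), 1 ≤ n → 0 < x → x ≤ z₂ * n →
      n * besselJ n x ^ 2 ≤ C ∧ n * |besselJ n x * besselY n x| ≤ C := by
  have hz₁0 := hz₂.trans h21
  obtain ⟨K, hK, hKn⟩ := exists_besselJ_mul_le_mul hz₁0
  -- On (0, z₁ n] one has √(n² - x²) ≥ c n, hence θ ≥ c n J. Integrating from x ≤ z₂ n up to z₁ n
  -- makes J² smaller by the factor rⁿ.
  set c := √(1 - z₁ ^ 2)
  have hc : 0 < c := Real.sqrt_pos.mpr (by nlinarith)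
  have hcsq : c ^ 2 = 1 - z₁ ^ 2 := Real.sq_sqrt (by nlinarith)
  set r := (z₂ / z₁) ^ (2 * c)
  have hr0 : 0 ≤ r := by positivity
  have hr1 : r < 1 := Real.rpow_lt_one (by positivity) (by rwa [div_lt_one hz₁0]) (by positivity)
  obtain ⟨M, hM, hMn⟩ := exists_sq_mul_pow_le hr0 hr1
  have hp := Real.pi_pos
  refine ⟨M * K + 1 / (Real.pi * c), by positivity, fun n x hn hx hxn => ?_⟩
  have hn0 : (0 : ℝ) < n := by exact_mod_cast hn
  set x₁ := z₁ * n
  have hxx₁ : x ≤ x₁ := hxn.trans (mul_le_mul_of_nonneg_right h21.le hn0.le)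
  have hx₁0 : 0 < x₁ := by positivity
  have hx₁n : x₁ ≤ n := by
    simp only [x₁]; nlinarith
  have hpos : ∀ y, 0 < y → y ≤ x₁ → 0 < besselJ n y := fun y hy hy1 =>
    besselJ_pos hn hy (hy1.trans hx₁n)
  have hth : ∀ y, 0 < y → y ≤ x₁ → c * n * besselJ n y ≤ besselTheta n y := fun y hy hy1 => by
    refine mul_besselJ_le_theta hn hy (hy1.trans hx₁n) ?_
    rw [mul_pow, hcsq]
    have : y ^ 2 ≤ (z₁ * n) ^ 2 := by gcongr
    nlinarith
  have hJx := hpos x hx hxx₁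
  have hJx₁ := hpos x₁ hx₁0 le_rfl
  obtain ⟨k1, k2⟩ := hKn n hn
  have hdec : besselJ n x ^ 2 ≤ r ^ n * besselJ n x₁ ^ 2 := by
    refine (besselJ_sq_le_rpow_mul (p := 2 * c * n) (fun y hy hy1 => by
      linarith [hth y hy hy1]) hpos hx hxx₁).trans ?_
    rw [Real.rpow_mul (by positivity), Real.rpow_natCast]
    have : x / x₁ ≤ z₂ / z₁ := by
      rw [div_le_div_iff₀ hx₁0 hz₁0]
      simp only [x₁]
      nlinarith
    gcongr
    exact Real.rpow_le_rpow (by positivity) this (by positivity)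
  constructor
  · calc n * besselJ n x ^ 2 ≤ n * (r ^ n * (K * n)) := by
          gcongr
          exact hdec.trans (by gcongr)
      _ = (n : ℝ) ^ 2 * r ^ n * K := by ring
      _ ≤ M * K := by gcongr; exact hMn n
      _ ≤ _ := by
        have : 0 < 1 / (Real.pi * c) := by positivity
        linarith
  -- Y/J increases, while Y/J + J⁻²/(πcn) decreases because θ ≥ c n J. The two traps enclose Y/J at
  -- x in terms of its value at x₁.
  · have hR := monotoneOn_Icc_of_hasDerivAt (a := x) (b := x₁)
      (f := fun x => besselY n x / besselJ n x)
      (fun y hy => (hasDerivAt_besselY_div (hx.trans_le hy.1)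
        (hpos y (hx.trans_le hy.1) hy.2).ne').continuousAt.continuousWithinAt)
      (fun y hy => hasDerivAt_besselY_div (hx.trans hy.1) (hpos y (hx.trans hy.1) hy.2.le).ne')
      (fun y hy => by
        have := hx.trans hy.1
        positivity)
    have hU := antitoneOn_Icc_of_hasDerivAt (a := x) (b := x₁)
      (f := fun x => besselY n x / besselJ n x + 1 / (Real.pi * c * n) * (besselJ n x ^ 2)⁻¹)
      (fun y hy => ((hasDerivAt_besselY_div (hx.trans_le hy.1)
        (hpos y (hx.trans_le hy.1) hy.2).ne').add ((hasDerivAt_inv_besselJ_sq (hx.trans_le hy.1)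
        (hpos y (hx.trans_le hy.1) hy.2).ne').const_mul _)).continuousAt.continuousWithinAt)
      (fun y hy => (hasDerivAt_besselY_div (hx.trans hy.1)
        (hpos y (hx.trans hy.1) hy.2.le).ne').add ((hasDerivAt_inv_besselJ_sq (hx.trans hy.1)
        (hpos y (hx.trans hy.1) hy.2.le).ne').const_mul _))
      (fun y hy => by
        have hy0 := hx.trans hy.1
        have hJy := hpos y hy0 hy.2.le
        have e : 2 / (Real.pi * y * besselJ n y ^ 2)
            + 1 / (Real.pi * c * n) * -(2 * besselTheta n y / (y * besselJ n y ^ 3))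
            = 2 / (Real.pi * c * n * y * besselJ n y ^ 3)
              * (c * n * besselJ n y - besselTheta n y) := by
          field_simp
          ring
        rw [e]
        exact mul_nonpos_of_nonneg_of_nonpos (by positivity) (by linarith [hth y hy0 hy.2.le]))
    have h1 := hR ⟨le_rfl, hxx₁⟩ ⟨hxx₁, le_rfl⟩ hxx₁
    have h2 := hU ⟨le_rfl, hxx₁⟩ ⟨hxx₁, le_rfl⟩ hxx₁
    simp only at h1 h2
    have h3 : 0 ≤ 1 / (Real.pi * c * n) * (besselJ n x₁ ^ 2)⁻¹ := by positivity
    have hq : |besselJ n x ^ 2 * (besselY n x₁ / besselJ n x₁)| ≤ r ^ n * (K * n) := by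
      have e : besselJ n x ^ 2 * (besselY n x₁ / besselJ n x₁)
          = besselJ n x ^ 2 / besselJ n x₁ ^ 2 * (besselJ n x₁ * besselY n x₁) := by
        field_simp
      rw [e, abs_mul, abs_of_pos (by positivity)]
      have : besselJ n x ^ 2 / besselJ n x₁ ^ 2 ≤ r ^ n := by
        rwa [div_le_iff₀ (by positivity)]
      gcongr
    have h4 := abs_mul_le_of_div_mem (e := 1 / (Real.pi * c * n)) hJx h1
      (by rw [div_eq_mul_inv (1 / (Real.pi * c * n))]; linarith) hq
    rw [abs_of_pos (by positivity : 0 < 1 / (Real.pi * c * n))] at h4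
    calc n * |besselJ n x * besselY n x| ≤ n * (r ^ n * (K * n) + 1 / (Real.pi * c * n)) := by
          gcongr
      _ = (n : ℝ) ^ 2 * r ^ n * K + 1 / (Real.pi * c) := by field_simp
      _ ≤ M * K + 1 / (Real.pi * c) := by gcongr; exact hMn n

/-- For small `x / n`, the leading behaviour `π n J_n Y_n ≈ -1` with error `O(x / n)`. -/
theorem exists_mul_bessel_add_le : ∃ C : ℝ, 0 < C ∧ ∀ (n : ℕ) (x : ℝ), 1 ≤ n → 0 < x →
    x ≤ 1 / 2 * n → n * besselJ n x ^ 2 ≤ C * (x / n) ∧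
      |Real.pi * n * (besselJ n x * besselY n x) + 1| ≤ C * (x / n) := by
  obtain ⟨K, hK, hKn⟩ := exists_besselJ_mul_le_mul (by norm_num : (0 : ℝ) < 4 / 5)
  obtain ⟨M, hM, hMn⟩ := exists_sq_mul_pow_le (by norm_num : (0 : ℝ) ≤ 5 / 8) (by norm_num)
  have hp := Real.pi_pos
  refine ⟨2 * M * (Real.pi * K + K + 1) + 10, by positivity, fun n x hn hx hxn => ?_⟩
  have hn0 : (0 : ℝ) < n := by exact_mod_cast hn
  have hn1 : (1 : ℝ) ≤ n := by exact_mod_cast hn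
  -- With 4/5 the root √(1 - (4/5)²) = 3/5 is rational and exceeds 1/2, so J² decays at least like
  -- (x/x₁)ⁿ; and x ≤ n/2 gives x/x₁ ≤ 5/8.
  set x₁ : ℝ := 4 / 5 * n
  have hxx₁ : x ≤ x₁ := by simp only [x₁]; linarith
  have hx₁0 : 0 < x₁ := by positivity
  have hx₁n : x₁ ≤ n := by simp only [x₁]; linarith
  have hpos : ∀ y, 0 < y → y ≤ x₁ → 0 < besselJ n y := fun y hy hy1 =>
    besselJ_pos hn hy (hy1.trans hx₁n)
  have hth : ∀ y, 0 < y → y ≤ x₁ → 3 / 5 * n * besselJ n y ≤ besselTheta n y := fun y hy hy1 => by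
    refine mul_besselJ_le_theta hn hy (hy1.trans hx₁n) ?_
    have : y ^ 2 ≤ (4 / 5 * n) ^ 2 := by gcongr
    nlinarith
  have hJx := hpos x hx hxx₁
  have hJx₁ := hpos x₁ hx₁0 le_rfl
  obtain ⟨k1, k2⟩ := hKn n hn
  set q := (x / x₁) ^ n
  have hq0 : 0 < q := by positivity
  have hdec : besselJ n x ^ 2 ≤ q * besselJ n x₁ ^ 2 := by
    have := besselJ_sq_le_rpow_mul (p := n) (fun y hy hy1 => by
      have := mul_pos hn0 (hpos y hy hy1)
      linarith [hth y hy hy1]) hpos hx hxx₁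
    rwa [Real.rpow_natCast] at this
  -- One factor x/x₁ = (5/4)(x/n) is kept for the rate; the other n-1 are bounded by 5/8 and absorb
  -- n². The 2 is (5/4)(8/5).
  have hqn : (n : ℝ) ^ 2 * q ≤ 2 * M * (x / n) := by
    obtain ⟨m, rfl⟩ : ∃ m, n = m + 1 := ⟨n - 1, by omega⟩
    have h1 : x / x₁ ≤ 5 / 8 := by
      rw [div_le_iff₀ hx₁0]; simp only [x₁]; linarith
    have h2 : x / x₁ = 5 / 4 * (x / ((m + 1 : ℕ) : ℝ)) := by
      simp only [x₁]; field_simp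
    have h3 : (5 / 8 : ℝ) ^ m = 8 / 5 * (5 / 8) ^ (m + 1) := by rw [pow_succ]; ring
    calc (((m + 1 : ℕ) : ℝ)) ^ 2 * q
        = ((m + 1 : ℕ) : ℝ) ^ 2 * (x / x₁) ^ m * (x / x₁) := by simp only [q, pow_succ]; ring
      _ ≤ ((m + 1 : ℕ) : ℝ) ^ 2 * (5 / 8) ^ m * (x / x₁) := by gcongr
      _ = 2 * (((m + 1 : ℕ) : ℝ) ^ 2 * (5 / 8) ^ (m + 1)) * (x / ((m + 1 : ℕ) : ℝ)) := by
        rw [h2, h3]; ring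
      _ ≤ 2 * M * (x / ((m + 1 : ℕ) : ℝ)) := by gcongr; exact hMn _
  have hxn0 : 0 < x / n := by positivity
  constructor
  · calc n * besselJ n x ^ 2 ≤ n * (q * (K * n)) := by
          gcongr
          exact hdec.trans (by gcongr)
      _ = (n : ℝ) ^ 2 * q * K := by ring
      _ ≤ 2 * M * (x / n) * K := by gcongr
      _ = 2 * M * K * (x / n) := by ring
      _ ≤ _ := by
        have : 0 ≤ (2 * M * (Real.pi * K + 1) + 10) * (x / n) := by positivity
        linarith
  · have dU : ∀ y, 0 < y → y ≤ x₁ → HasDerivAt (fun x => besselY n x / besselJ n x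
        + 1 / (Real.pi * n) * (besselJ n x ^ 2)⁻¹)
        (2 / (Real.pi * n * y * besselJ n y ^ 3) * (n * besselJ n y - besselTheta n y)) y :=
      fun y hy hy1 => by
        have hJy := hpos y hy hy1
        refine ((hasDerivAt_besselY_div hy hJy.ne').add
          ((hasDerivAt_inv_besselJ_sq hy hJy.ne').const_mul _)).congr_deriv ?_
        field_simp
        ring
    -- The corrector offsetting the growth of Y/J + J⁻²/(πn), whose derivative is at most 2/(πn J²)
    -- as nJ - θ ≤ yJ. Since J - 2θ ≤ -(n/5) J, the constant 10 makes the corrector's derivative at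
    -- most -2/(πn J²).
    have dW : ∀ y, 0 < y → y ≤ x₁ → HasDerivAt (fun x => 10 / (Real.pi * n ^ 2) *
        (x * (besselJ n x ^ 2)⁻¹))
        (10 / (Real.pi * n ^ 2 * besselJ n y ^ 3) * (besselJ n y - 2 * besselTheta n y)) y :=
      fun y hy hy1 => by
        have hJy := hpos y hy hy1
        refine (((hasDerivAt_id' y).mul
          (hasDerivAt_inv_besselJ_sq hy hJy.ne')).const_mul _).congr_deriv ?_
        field_simp
        ring
    have hU := monotoneOn_Icc_of_hasDerivAt (a := x) (b := x₁)
      (fun y hy => (dU y (hx.trans_le hy.1) hy.2).continuousAt.continuousWithinAt)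
      (fun y hy => dU y (hx.trans hy.1) hy.2.le)
      (fun y hy => by
        have hy0 := hx.trans hy.1
        have hJy := hpos y hy0 hy.2.le
        have := besselTheta_le hn hy0 (hy.2.le.trans hx₁n)
        exact mul_nonneg (by positivity) (by linarith))
    have hV := antitoneOn_Icc_of_hasDerivAt (a := x) (b := x₁)
      (fun y hy => ((dU y (hx.trans_le hy.1) hy.2).add
        (dW y (hx.trans_le hy.1) hy.2)).continuousAt.continuousWithinAt)
      (fun y hy => (dU y (hx.trans hy.1) hy.2.le).add (dW y (hx.trans hy.1) hy.2.le))
      (fun y hy => by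
        have hy0 := hx.trans hy.1
        have hJy := hpos y hy0 hy.2.le
        have hyn : y ≤ n := hy.2.le.trans hx₁n
        have t1 : n * besselJ n y - besselTheta n y ≤ y * besselJ n y := by
          have h1 := sub_mul_besselJ_le_theta hn hy0 hyn
          have h2 : y ^ 2 / n ≤ y := by
            rw [div_le_iff₀ hn0]; nlinarith
          nlinarith
        have t2 : besselJ n y - 2 * besselTheta n y ≤ -(n / 5 * besselJ n y) := by
          nlinarith [hth y hy0 hy.2.le]
        calc _ ≤ 2 / (Real.pi * n * y * besselJ n y ^ 3) * (y * besselJ n y)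
              + 10 / (Real.pi * n ^ 2 * besselJ n y ^ 3) * -(n / 5 * besselJ n y) := by gcongr
          _ = 0 := by field_simp; ring
          _ ≤ 0 := le_rfl)
    have h1 := hU ⟨le_rfl, hxx₁⟩ ⟨hxx₁, le_rfl⟩ hxx₁
    have h2 := hV ⟨le_rfl, hxx₁⟩ ⟨hxx₁, le_rfl⟩ hxx₁
    simp only [Pi.add_apply] at h1 h2
    have h3 : 0 ≤ 10 / (Real.pi * n ^ 2) * (x₁ * (besselJ n x₁ ^ 2)⁻¹) := by positivity
    set U₁ := besselY n x₁ / besselJ n x₁ + 1 / (Real.pi * n) * (besselJ n x₁ ^ 2)⁻¹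
    have hq : |besselJ n x ^ 2 * U₁| ≤ q * (K * n + 1 / (Real.pi * n)) := by
      have e : besselJ n x ^ 2 * U₁ = besselJ n x ^ 2 / besselJ n x₁ ^ 2 *
          (besselJ n x₁ * besselY n x₁ + 1 / (Real.pi * n)) := by
        simp only [U₁]
        field_simp
      rw [e, abs_mul, abs_of_pos (by positivity)]
      have h5 : besselJ n x ^ 2 / besselJ n x₁ ^ 2 ≤ q := by
        rwa [div_le_iff₀ (by positivity)]
      have h6 := abs_add_le (besselJ n x₁ * besselY n x₁) (1 / (Real.pi * n))
      rw [abs_of_pos (by positivity : 0 < 1 / (Real.pi * n))] at h6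
      gcongr
      exact h6.trans (by gcongr)
    have e0 : (besselY n x + 1 / (Real.pi * n) * (besselJ n x)⁻¹) / besselJ n x
        = besselY n x / besselJ n x + 1 / (Real.pi * n) * (besselJ n x ^ 2)⁻¹ := by
      field_simp
    rw [← e0] at h1 h2
    have h4 := abs_mul_le_of_div_mem (e := 10 / (Real.pi * n ^ 2) * x) hJx h1
      (by
        rw [mul_div_assoc, div_eq_mul_inv x]
        linarith) hq
    rw [abs_of_pos (by positivity : 0 < 10 / (Real.pi * n ^ 2) * x)] at h4
    have e1 : Real.pi * n * (besselJ n x * besselY n x) + 1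
        = Real.pi * n * (besselJ n x * (besselY n x + 1 / (Real.pi * n) * (besselJ n x)⁻¹)) := by
      field_simp
    rw [e1, abs_mul, abs_of_pos (by positivity : 0 < Real.pi * n)]
    have hn2 : q ≤ (n : ℝ) ^ 2 * q := by
      have : 1 ≤ (n : ℝ) ^ 2 := one_le_pow₀ hn1
      nlinarith
    calc _ ≤ Real.pi * n * (q * (K * n + 1 / (Real.pi * n)) + 10 / (Real.pi * n ^ 2) * x) := by
          gcongr
      _ = (n : ℝ) ^ 2 * q * (Real.pi * K) + q + 10 * (x / n) := by field_simp
      _ ≤ 2 * M * (x / n) * (Real.pi * K) + 2 * M * (x / n) + 10 * (x / n) := by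
        gcongr
        exact hn2.trans hqn
      _ ≤ _ := by
        have : 0 ≤ 2 * M * K * (x / n) := by positivity
        linarith

/-- Uniform bounds on the products entering `λ_n(x)` for `x ≤ z n`, `z < 1`. -/
theorem exists_bessel_products_le {z : ℝ} (hz : z < 1) :
    ∃ C : ℝ, 0 < C ∧ ∀ (n : ℕ) (x : ℝ), 1 ≤ n → 0 < x → x ≤ z * n →
      n * besselJ n x ^ 2 ≤ C * (x / n) ∧ n * |besselJ n x * besselY n x| ≤ C ∧
      |Real.pi * (besselTheta n x * besselY n x) + 1| ≤ C * (x / n) := by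
  -- Keeps the threshold positive even when z ≤ 0, and still below 1.
  set z₂ := max z (1 / 2)
  have hz₂ : 0 < z₂ := lt_max_of_lt_right (by norm_num)
  have hz₂1 : z₂ < 1 := max_lt hz (by norm_num)
  obtain ⟨C₁, hC₁, h₁⟩ := exists_mul_bessel_le hz₂ (by linarith : z₂ < (z₂ + 1) / 2) (by linarith)
  obtain ⟨C₂, hC₂, h₂⟩ := exists_mul_bessel_add_le
  have hp := Real.pi_pos
  refine ⟨2 * C₁ + C₂ + Real.pi * C₁ + 2 * (Real.pi * C₁ + 1), by positivity,
    fun n x hn hx hxn => ?_⟩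
  have hn0 : (0 : ℝ) < n := by exact_mod_cast hn
  have hxz₂ : x ≤ z₂ * n := hxn.trans (mul_le_mul_of_nonneg_right (le_max_left _ _) hn0.le)
  have hxle : x ≤ n := by nlinarith
  obtain ⟨a1, a2⟩ := h₁ n x hn hx hxz₂
  have hu0 : 0 < x / n := by positivity
  have hu1 : x / n ≤ 1 := by rwa [div_le_one hn0]
  have hJ := besselJ_pos hn hx hxle
  have hθ0 := besselTheta_nonneg hn hx hxle
  have hθ1 := besselTheta_le hn hx hxle
  have hsecond : n * |besselJ n x * besselY n x|
      ≤ 2 * C₁ + C₂ + Real.pi * C₁ + 2 * (Real.pi * C₁ + 1) :=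
    a2.trans (by nlinarith [mul_pos hp hC₁])
  have pC := mul_pos hp hC₁
  rcases le_total x (1 / 2 * n) with hle | hge
  · obtain ⟨b1, b2⟩ := h₂ n x hn hx hle
    refine ⟨b1.trans (by gcongr; nlinarith), hsecond, ?_⟩
    have e : Real.pi * (besselTheta n x * besselY n x) + 1
        = (Real.pi * n * (besselJ n x * besselY n x) + 1)
          + Real.pi * ((besselTheta n x - n * besselJ n x) * besselY n x) := by ring
    have t : |besselTheta n x - n * besselJ n x| ≤ x * besselJ n x := by
      have h2 : x ^ 2 / n ≤ x := by
        rw [div_le_iff₀ hn0]; nlinarith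
      have h1 := sub_mul_besselJ_le_theta hn hx hxle
      rw [abs_le]
      constructor <;> nlinarith
    have e3 : |Real.pi * ((besselTheta n x - n * besselJ n x) * besselY n x)|
        ≤ Real.pi * C₁ * (x / n) := by
      rw [abs_mul, abs_mul, abs_of_pos hp]
      calc Real.pi * (|besselTheta n x - n * besselJ n x| * |besselY n x|)
          ≤ Real.pi * (x * besselJ n x * |besselY n x|) := by gcongr
        _ = Real.pi * (x / n) * (n * |besselJ n x * besselY n x|) := by
          rw [abs_mul, abs_of_pos hJ]; field_simp
        _ ≤ Real.pi * (x / n) * C₁ := by gcongr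
        _ = _ := by ring
    rw [e]
    refine (abs_add_le _ _).trans ?_
    have : 0 ≤ (2 * C₁ + 2 * (Real.pi * C₁ + 1)) * (x / n) := by positivity
    linarith
  · have hu2 : 1 / 2 ≤ x / n := by rwa [le_div_iff₀ hn0]
    -- For x ≥ n/2 the ratio x/n is bounded below, so plain boundedness already has the required
    -- form.
    have hbig : ∀ B : ℝ, 0 ≤ B → B ≤ 2 * B * (x / n) := fun B hB => by nlinarith
    refine ⟨?_, hsecond, ?_⟩
    · have h3 := hbig C₁ hC₁.le
      have : 0 ≤ (C₂ + Real.pi * C₁ + 2 * (Real.pi * C₁ + 1)) * (x / n) := by positivity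
      linarith
    · have e3 : |Real.pi * (besselTheta n x * besselY n x) + 1| ≤ Real.pi * C₁ + 1 := by
        refine (abs_add_le _ _).trans ?_
        rw [abs_one, abs_mul, abs_mul, abs_of_pos hp, abs_of_nonneg hθ0]
        have : besselTheta n x * |besselY n x| ≤ C₁ := by
          refine le_trans ?_ a2
          rw [abs_mul, abs_of_pos hJ, ← mul_assoc]
          gcongr
        gcongr
      have h3 := hbig (Real.pi * C₁ + 1) (by positivity)
      have : 0 ≤ (2 * C₁ + C₂ + Real.pi * C₁) * (x / n) := by positivity
      linarith

/-- Expand with k J' = θ. The real part of λ_m contains -πθY, which is close to 1 and is paired with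
the -1; the other three products are small separately. -/
theorem norm_circleLambda_sub_one_le {m : ℤ} {k : ℝ} (hk : 0 < k) :
    ‖circleLambda m k - 1‖ ≤ Real.pi * k * besselJ m.natAbs k ^ 2
      + |Real.pi * (besselTheta m.natAbs k * besselY m.natAbs k) + 1|
      + Real.pi * |besselJ m.natAbs k * besselTheta m.natAbs k|
      + Real.pi * k * |besselJ m.natAbs k * besselY m.natAbs k| := by
  rw [circleLambda]
  generalize m.natAbs = n
  have hkc : (k : ℂ) ≠ 0 := by exact_mod_cast hk.ne'
  have e : (Real.pi : ℂ) * k * hankelH1 n k * (Complex.I * ((deriv (besselJ n) k : ℝ) : ℂ)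
      + ((besselJ n k : ℝ) : ℂ)) - 1
      = ((Real.pi * k * besselJ n k ^ 2 : ℝ) : ℂ)
        + -((Real.pi * (besselTheta n k * besselY n k) + 1 : ℝ) : ℂ)
        + Complex.I * ((Real.pi * (besselJ n k * besselTheta n k) : ℝ) : ℂ)
        + Complex.I * ((Real.pi * k * (besselJ n k * besselY n k) : ℝ) : ℂ) := by
    rw [(hasDerivAt_besselJ_theta n hk).deriv, hankelH1]
    push_cast
    field_simp
    linear_combination (Real.pi : ℂ) * besselTheta n k * besselY n k * Complex.I_sq
  rw [e]
  refine (norm_add_le _ _).trans (add_le_add ((norm_add₃_le).trans (add_le_add (add_le_add ?_ ?_) ?_))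
    ?_)
  · rw [Complex.norm_real, Real.norm_eq_abs, abs_of_nonneg (by positivity)]
  · rw [norm_neg, Complex.norm_real, Real.norm_eq_abs]
  · rw [norm_mul, Complex.norm_I, one_mul, Complex.norm_real, Real.norm_eq_abs, abs_mul,
      abs_of_pos Real.pi_pos]
  · rw [norm_mul, Complex.norm_I, one_mul, Complex.norm_real, Real.norm_eq_abs, abs_mul,
      abs_of_pos (by positivity)]

theorem exists_norm_circleLambda_sub_one_le {δ : ℝ} (hδ : 0 < δ) :
    ∃ C : ℝ, 0 < C ∧ ∀ (m : ℤ) (k : ℝ), 0 < k → 0 < k / (m : ℝ) → k / (m : ℝ) < 1 - δ →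
      ‖circleLambda m k - 1‖ ≤ C * (k / (m : ℝ)) := by
  obtain ⟨C, hC, h⟩ := exists_bessel_products_le (by linarith : 1 - δ < 1)
  have hp := Real.pi_pos
  -- Three of the four terms contribute πC each, and the term πθY + 1 contributes C.
  refine ⟨3 * Real.pi * C + C, by positivity, fun m k hk hkm hkm1 => ?_⟩
  -- With k > 0, positivity of k/m excludes negative m, and also m = 0, where the quotient is 0 by
  -- convention.
  have hm0 : (0 : ℝ) < m := by
    by_contra! hneg
    exact absurd (div_nonpos_of_nonneg_of_nonpos hk.le hneg) (by linarith)
  have hm0' : 0 < m := by exact_mod_cast hm0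
  have hcast : ((m.natAbs : ℕ) : ℝ) = m := by
    rw [Nat.cast_natAbs, abs_of_pos hm0']
  have hn : 1 ≤ m.natAbs := by omega
  refine (norm_circleLambda_sub_one_le hk).trans ?_
  rw [← hcast] at hkm hkm1 hm0 ⊢
  generalize m.natAbs = n at *
  have hkn : k ≤ (1 - δ) * n := (div_lt_iff₀ hm0).mp hkm1 |>.le
  have hkn' : k ≤ n := by nlinarith
  obtain ⟨h1, h2, h3⟩ := h n k hn hk hkn
  have hJ := besselJ_pos hn hk hkn'
  have hθ0 := besselTheta_nonneg hn hk hkn'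
  have hθ1 := besselTheta_le hn hk hkn'
  have t1 : Real.pi * k * besselJ n k ^ 2 ≤ Real.pi * (C * (k / n)) := by
    rw [mul_assoc]
    exact mul_le_mul_of_nonneg_left
      ((mul_le_mul_of_nonneg_right hkn' (sq_nonneg _)).trans h1) hp.le
  have t2 : Real.pi * |besselJ n k * besselTheta n k| ≤ Real.pi * (C * (k / n)) := by
    rw [abs_of_nonneg (by positivity)]
    refine mul_le_mul_of_nonneg_left (le_trans ?_ h1) hp.le
    calc besselJ n k * besselTheta n k ≤ besselJ n k * (n * besselJ n k) := by gcongr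
      _ = _ := by ring
  have t3 : Real.pi * k * |besselJ n k * besselY n k| ≤ Real.pi * (C * (k / n)) := by
    calc _ = Real.pi * (n * |besselJ n k * besselY n k| * (k / n)) := by field_simp
      _ ≤ _ := by gcongr
  linarith

theorem lemmaA3 :
    (∀ k : ℝ, 0 < k →
      (∀ (m : ℤ) (t : ℝ),
        2 * combinedLayer k (fun s => Complex.exp (Complex.I * (m : ℂ) * (s : ℂ))) t =
          circleLambda m k * Complex.exp (Complex.I * (m : ℂ) * (t : ℂ))) ∧
      (∀ μ : ℂ, IsEigenvalueTwoA k μ ↔ ∃ m : ℤ, μ = circleLambda m k)) ∧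
    (∀ δ : ℝ, 0 < δ → ∃ C : ℝ, 0 < C ∧ ∀ (m : ℤ) (k : ℝ), 0 < k →
      0 < k / (m : ℝ) → k / (m : ℝ) < 1 - δ →
        ‖circleLambda m k - 1‖ ≤ C * (k / (m : ℝ))) :=
  ⟨fun _ hk => ⟨combinedLayer_exp hk, isEigenvalueTwoA_iff hk⟩,
    fun _ hδ => exists_norm_circleLambda_sub_one_le hδ⟩
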